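/- **Setting.** Let $T>0$, $r\ge 0$, $H\in(1/2,1)$, let $(\Omega,\mathcal F,\mathbb P)$ be a probability space and $X,Y$ real separable Hilbert spaces. Let $A$ be the infinitesimal generator of an analytic semigroup $(S(t))_{t\ge0}$ of bounded linear operators on $X$, with $\sup_{t\ge0}\|S(t)\|<\infty$ and $0$ in the resolvent set of $A$. For $0<\alpha<1$ let $$(-A)^{-\alpha}=\frac{\sin\pi\alpha}{\pi}\int_0^\infty\mu^{-\alpha}(\mu-A)^{-1}\,d\mu,$$ and let $(-A)^{\alpha}$ be its inverse, with domain $D((-A)^\alpha)=\operatorname{Range}((-A)^{-\alpha})$. Let $Q$ be a bounded operator on $Y$ with $Qe_n=\lambda_ne_n$, where $(e_n)$ is a complete orthonormal basis of $Y$, $\lambda_n\ge 0$ and $\sum_n\lambda_n<\infty$. Let $\beta^H_n$ be independent real fractional Brownian motions on $[0,T]$, i.e. centered Gaussian processes with covariance $R_H(s,t)=\frac12(t^{2H}+s^{2H}-|t-s|^{2H})$, and let $B_Q^H(t)=\sum_n\sqrt{\lambda_n}\,\beta^H_n(t)e_n$. For $\psi\in\mathcal L(Y,X)$ put $\|\psi\|^2_{\mathcal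 L_2^0}=\sum_n\|\sqrt{\lambda_n}\psi e_n\|^2$. For deterministic $\Phi:[0,t]\to\mathcal L(Y,X)$ put $\int_0^t\Phi\,dB_Q^H=\sum_n\int_0^t\sqrt{\lambda_n}\,\Phi(s)e_n\,d\beta_n^H(s)$ (convergence in $L^2(\Omega,X)$). Here $h\mapsto\int_0^t h\,d\beta^H_n$ is the extension of $1_{[0,a]}v\mapsto\beta_n^H(a)v$ ($a\in[0,t]$, $v\in X$) by linearity and by continuity from the norm $\|h\|_{|\mathcal H|}^2=H(2H-1)\int_0^t\!\int_0^t\|h(s)\|\|h(u)\||s-u|^{2H-2}\,ds\,du$ to $L^2(\Omega,X)$. **Assumptions.** Let $f,g:[0,T]\times X\to X$, $\sigma:[0,T]\to\mathcal L(Y,X)$ and $\rho:[0,T]\to\mathbb R$, with $f(\cdot,x)$ measurable for every $x$, and let $\varphi\in C([-r,0],L^2(\Omega,X))$. * (H.1) There is $K:[0,T]\times[0,\infty)\to[0,\infty)$ such that $K(t,\cdot)$ is continuous, non-decreasing and concave for every $t$; $\int_0^TK(s,x)\,ds<\infty$ for every $x\ge 0$; $\|f(t,x)\|^2\le K(t,\|x\|^2)$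 for all $t,x$; and for all $\alpha>0$, $u_0\ge0$ the equation $u(t)=u_0+\alpha\int_0^tK(s,u(s))\,ds$ has a (continuous, nonnegative) solution on all of $[0,T]$. Moreover $\sigma$ is measurable into $\mathcal L_2^0$ and $\int_0^T\|\sigma(t)\|^2_{\mathcal L_2^0}\,dt<\infty$. * (H.2) There is $G:[0,T]\times[0,\infty)\to[0,\infty)$ such that $G(t,\cdot)$ is continuous, non-decreasing and concave with $G(t,0)=0$ for every $t$; $\int_0^TG(s,x)\,ds<\infty$ for every $x\ge0$; $\|f(t,x)-f(t,y)\|^2\le G(t,\|x-y\|^2)$ for all $t,x,y$; and for every $D>0$, if $z:[0,T]\to[0,\infty)$ satisfies $z(0)=0$, $G(\cdot,z(\cdot))$ is integrable on $[0,T]$, and $z(t)\le D\int_0^tG(s,z(s))\,ds$ for all $t\in[0,T]$, then $z=0$ on $[0,T]$. * (H.3) There are constants $\frac12<\beta<1$, $l$, $M_g$ such that $g$ takes values in $D((-A)^\beta)$; $(-A)^\beta g:[0,T]\times X\to X$ is continuous; $\|(-A)^\beta g(t,x)\|^2\le l(\|x\|^2+1)$ and $\|(-A)^\beta g(t,x)-(-A)^\beta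 g(t,y)\|\le M_g\|x-y\|$ for all $t,x,y$; and $3\|(-A)^{-\beta}\|^2M_g^2<1$, $5\|(-A)^{-\beta}\|^2\,l<1$. * (H.4) $\rho$ is continuous and $-r\le\rho(t)\le t$ for all $t\in[0,T]$. **Theorem 3.1.** Under these assumptions the neutral stochastic functional differential equation $$d[x(t)+g(t,x(\rho(t)))]=[Ax(t)+f(t,x(\rho(t)))]\,dt+\sigma(t)\,dB_Q^H(t),\quad 0\le t\le T,\qquad x(t)=\varphi(t),\quad -r\le t\le0,$$ has a unique mild solution on $[-r,T]$. That is, there is exactly one $x\in C([-r,T],L^2(\Omega,X))$ with $x=\varphi$ on $[-r,0]$ such that for every $t\in[0,T]$ all terms below are well defined in $L^2(\Omega,X)$ and, $\mathbb P$-a.s., $$x(t)=S(t)\big(\varphi(0)+g(0,\varphi(\rho(0)))\big)-g(t,x(\rho(t)))-\int_0^tAS(t-s)g(s,x(\rho(s)))\,ds+\int_0^tS(t-s)f(s,x(\rho(s)))\,ds+\int_0^tS(t-s)\sigma(s)\,dB_Q^H(s),$$ the $ds$-integrals being Bochner integrals in $L^2(\Omega,X)$. -/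

import Mathlib

open MeasureTheory ProbabilityTheory Filter Topology Set
open scoped ENNReal

noncomputable section

set_option linter.unusedSectionVars false

namespace NeutralSFDE

/-! ### Complexification of a real Hilbert space

It is only needed to say that a semigroup on a real space has a holomorphic extension to a sector. -/

/-- The complexification `X + iX` of a real Hilbert space, with `‖x + iy‖² = ‖x‖² + ‖y‖²`. -/
def Complexification (X : Type*) : Type _ := WithLp 2 (X × X)

namespace Complexification

variable {X : Type*} [NormedAddCommGroup X] [InnerProductSpace ℝ X]

instance : NormedAddCommGroup (Complexification X) :=
  inferInstanceAs (NormedAddCommGroup (WithLp 2 (X × X)))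

instance [CompleteSpace X] : CompleteSpace (Complexification X) :=
  inferInstanceAs (CompleteSpace (WithLp 2 (X × X)))

/-- The vector `x + iy`. -/
def mk (x y : X) : Complexification X := WithLp.toLp 2 (x, y)

/-- Real part. -/
def re (v : Complexification X) : X := WithLp.fst v

/-- Imaginary part. -/
def im (v : Complexification X) : X := WithLp.snd v

@[simp] theorem re_mk (x y : X) : re (mk x y) = x := rfl

@[simp] theorem im_mk (x y : X) : im (mk x y) = y := rfl

@[simp] theorem re_add (v w : Complexification X) : re (v + w) = re v + re w := rfl

@[simp] theorem im_add (v w : Complexification X) : im (v + w) = im v + im w := rfl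

@[simp] theorem re_zero : re (0 : Complexification X) = 0 := rfl

@[simp] theorem im_zero : im (0 : Complexification X) = 0 := rfl

@[ext] theorem ext {v w : Complexification X} (h₁ : re v = re w) (h₂ : im v = im w) : v = w :=
  WithLp.ofLp_injective 2 (Prod.ext h₁ h₂)

theorem norm_sq (v : Complexification X) : ‖v‖ ^ 2 = ‖re v‖ ^ 2 + ‖im v‖ ^ 2 :=
  WithLp.prod_norm_sq_eq_of_L2 v

/-- `(a + ib)(x + iy) = (ax - by) + i(ay + bx)`. -/
instance : SMul ℂ (Complexification X) where
  smul c v := mk (c.re • re v - c.im • im v) (c.re • im v + c.im • re v)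

@[simp] theorem re_smul (c : ℂ) (v : Complexification X) :
    re (c • v) = c.re • re v - c.im • im v := rfl

@[simp] theorem im_smul (c : ℂ) (v : Complexification X) :
    im (c • v) = c.re • im v + c.im • re v := rfl

instance : Module ℂ (Complexification X) where
  one_smul v := by ext <;> simp
  mul_smul a b v := by
    ext <;> simp <;> module
  smul_zero a := by ext <;> simp
  smul_add a v w := by ext <;> simp <;> module
  add_smul a b v := by ext <;> simp <;> module
  zero_smul v := by ext <;> simp

theorem norm_smul_eq (c : ℂ) (v : Complexification X) : ‖c • v‖ = ‖c‖ * ‖v‖ := by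
  refine (sq_eq_sq₀ (norm_nonneg _) (by positivity)).1 ?_
  rw [mul_pow, norm_sq, norm_sq, Complex.sq_norm, Complex.normSq_apply, re_smul, im_smul,
    norm_sub_sq_real, norm_add_sq_real]
  simp only [norm_smul, inner_smul_left, inner_smul_right, mul_pow, Real.norm_eq_abs, sq_abs,
    real_inner_comm (re v) (im v)]
  simp
  ring

instance : NormedSpace ℂ (Complexification X) where
  norm_smul_le c v := (norm_smul_eq c v).le

/-- The complex-linear extension `x + iy ↦ Lx + iLy` of a bounded real-linear operator. -/
def extend (L : X →L[ℝ] X) : Complexification X →L[ℂ] Complexification X :=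
  LinearMap.mkContinuous
    { toFun := fun v => mk (L (re v)) (L (im v))
      map_add' := fun v w => by ext <;> simp
      map_smul' := fun c v => by ext <;> simp }
    ‖L‖ (fun v => by
      refine (sq_le_sq₀ (norm_nonneg _) (by positivity)).1 ?_
      rw [mul_pow, norm_sq, norm_sq]
      have h₁ : ‖L (re v)‖ ^ 2 ≤ (‖L‖ * ‖re v‖) ^ 2 := by gcongr; exact L.le_opNorm _
      have h₂ : ‖L (im v)‖ ^ 2 ≤ (‖L‖ * ‖im v‖) ^ 2 := by gcongr; exact L.le_opNorm _
      simp only [LinearMap.coe_mk, AddHom.coe_mk, re_mk, im_mk]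
      nlinarith [h₁, h₂])

end Complexification

/-! ### Semigroups, generators, fractional powers -/

section Semigroup

variable {X : Type*} [NormedAddCommGroup X] [InnerProductSpace ℝ X]

/-- `(S t)_{t ≥ 0}` is a strongly continuous semigroup; values at negative times are irrelevant. -/
structure IsC0Semigroup (S : ℝ → X →L[ℝ] X) : Prop where
  zero : S 0 = 1
  add : ∀ s t : ℝ, 0 ≤ s → 0 ≤ t → S (s + t) = S s * S t
  tendsto_zero : ∀ x : X, Tendsto (fun t => S t x) (𝓝[>] 0) (𝓝 x)

/-- The open sector of half-angle `θ` around the positive real axis. -/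
def sector (θ : ℝ) : Set ℂ := {z | z ≠ 0 ∧ |z.arg| < θ}

/-- `S` is an analytic semigroup: it extends to a sector around the positive half-line as a family
of bounded operators on the complexified space that is holomorphic, satisfies the semigroup law,
and tends strongly to the identity at `0` within the sector. -/
def IsAnalyticSemigroup (S : ℝ → X →L[ℝ] X) : Prop :=
  IsC0Semigroup S ∧
  ∃ θ : ℝ, 0 < θ ∧ θ ≤ Real.pi / 2 ∧
    ∃ U : ℂ → Complexification X →L[ℂ] Complexification X,
      DifferentiableOn ℂ U (sector θ) ∧
      (∀ z ∈ sector θ, ∀ w ∈ sector θ, U (z + w) = U z * U w) ∧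
      (∀ v, Tendsto (fun z => U z v) (𝓝[sector θ] 0) (𝓝 v)) ∧
      ∀ t : ℝ, 0 ≤ t → U (t : ℂ) = Complexification.extend (S t)

/-- `A` is the infinitesimal generator of `S`: its domain consists of all `x` for which the limit
`y = lim_{h → 0+} h⁻¹ (S h x - x)` exists, and then `A x = y`. -/
def IsGenerator (A : X →ₗ.[ℝ] X) (S : ℝ → X →L[ℝ] X) : Prop :=
  ∀ x y : X, (x, y) ∈ A.graph ↔ Tendsto (fun h : ℝ => h⁻¹ • (S h x - x)) (𝓝[>] 0) (𝓝 y)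

/-- `R` is the bounded two-sided inverse of `μ - A : D(A) → X`. -/
def IsResolventAt (A : X →ₗ.[ℝ] X) (μ : ℝ) (R : X →L[ℝ] X) : Prop :=
  ∀ z x : X, R z = x ↔ (x, μ • x - z) ∈ A.graph

/-- The (real) resolvent set of `A`. -/
def resolventSet (A : X →ₗ.[ℝ] X) : Set ℝ := {μ | ∃ R, IsResolventAt A μ R}

open Classical in
/-- `(μ - A)⁻¹` for `μ` in the resolvent set (and `0` otherwise). -/
def resolvent (A : X →ₗ.[ℝ] X) (μ : ℝ) : X →L[ℝ] X :=
  if h : μ ∈ resolventSet A then h.choose else 0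

/-- The bounded operator `(-A)^{-α} = (sin πα / π) ∫₀^∞ μ^{-α} (μ - A)⁻¹ dμ`, for `0 < α < 1`. -/
def negFracPow (A : X →ₗ.[ℝ] X) (α : ℝ) : X →L[ℝ] X :=
  (Real.sin (Real.pi * α) / Real.pi) • ∫ μ in Ioi (0 : ℝ), μ ^ (-α) • resolvent A μ

/-- The fractional power `(-A)^α`, `0 < α < 1`: the inverse of `(-A)^{-α}`, with domain the range
of `(-A)^{-α}`. -/
def fracPow (A : X →ₗ.[ℝ] X) (α : ℝ) : X →ₗ.[ℝ] X :=
  ((negFracPow A α : X →ₗ[ℝ] X).toPMap ⊤).inverse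

open Classical in
/-- The value `L v` of a partially defined operator at a vector `v` of its domain (`0` off the
domain). -/
def pval (L : X →ₗ.[ℝ] X) (v : X) : X := if h : v ∈ L.domain then L ⟨v, h⟩ else 0

end Semigroup

/-! ### Fractional Brownian motion and Wiener integrals -/

section Noise

variable {Ω : Type*} [MeasurableSpace Ω]

/-- The covariance `R_H(s, t) = (t^{2H} + s^{2H} - |t - s|^{2H}) / 2`. -/
def fbmCov (H s t : ℝ) : ℝ := (t ^ (2 * H) + s ^ (2 * H) - |t - s| ^ (2 * H)) / 2

/-- `β` is a one-dimensional fractional Brownian motion on `[0, T]` with Hurst parameter `H`. -/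
structure IsFBM (P : Measure Ω) (H T : ℝ) (β : ℝ → Ω → ℝ) : Prop where
  measurable : ∀ t ∈ Icc 0 T, Measurable (β t)
  gaussian : IsGaussianProcess (fun t : Icc (0 : ℝ) T => β t) P
  centered : ∀ t ∈ Icc 0 T, ∫ ω, β t ω ∂P = 0
  covariance : ∀ s ∈ Icc 0 T, ∀ t ∈ Icc 0 T, ∫ ω, β s ω * β t ω ∂P = fbmCov H s t

/-- The data of a `Q`-fractional Brownian motion `B_Q^H(t) = ∑ √λ_n β_n(t) e_n` on `[0, T]`. -/
structure QFBM (P : Measure Ω) (H T : ℝ) (ι Y : Type*)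
    [NormedAddCommGroup Y] [InnerProductSpace ℝ Y] where
  /-- the covariance operator -/
  Q : Y →L[ℝ] Y
  /-- a complete orthonormal basis of eigenvectors -/
  e : HilbertBasis ι ℝ Y
  /-- the eigenvalues -/
  lam : ι → ℝ
  lam_nonneg : ∀ n, 0 ≤ lam n
  Q_apply : ∀ n, Q (e n) = lam n • e n
  finite_trace : Summable lam
  /-- the real fractional Brownian motions -/
  β : ι → ℝ → Ω → ℝ
  isFBM : ∀ n, IsFBM P H T (β n)
  indep : iIndepFun (fun n ω (t : Icc (0 : ℝ) T) => β n t ω) P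

/-- The `Y`-valued process `B_Q^H`. -/
def QFBM.process {P : Measure Ω} {H T : ℝ} {ι Y : Type*}
    [NormedAddCommGroup Y] [InnerProductSpace ℝ Y] (W : QFBM P H T ι Y) (t : ℝ) (ω : Ω) : Y :=
  ∑' n, (√(W.lam n) * W.β n t ω) • W.e n

variable {X : Type*} [NormedAddCommGroup X] [InnerProductSpace ℝ X]

/-- The squared norm
`‖h‖²_{|𝓗|} = H(2H-1) ∫₀ᵗ ∫₀ᵗ ‖h(s)‖ ‖h(u)‖ |s-u|^{2H-2} du ds` on `[0, t]`. -/
def absHNormSq (H t : ℝ) (h : ℝ → X) : ℝ≥0∞ :=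
  ENNReal.ofReal (H * (2 * H - 1)) *
    ∫⁻ s in Icc 0 t, ∫⁻ u in Icc 0 t, ‖h s‖ₑ * ‖h u‖ₑ * ENNReal.ofReal (|s - u| ^ (2 * H - 2))

/-- The step function `∑_a 1_{[0,a]} c_a` with finitely many `a ∈ [0, t]`, `c_a ∈ X`. -/
def stepFun {t : ℝ} (c : Icc (0 : ℝ) t →₀ X) (s : ℝ) : X :=
  c.sum fun a v => (Icc (0 : ℝ) (a : ℝ)).indicator (fun _ => v) s

/-- The integral `∑_a β(a) c_a` of the step function `∑_a 1_{[0,a]} c_a`. -/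
def stepIntegral {t : ℝ} (β : ℝ → Ω → ℝ) (c : Icc (0 : ℝ) t →₀ X) (ω : Ω) : X :=
  c.sum fun a v => β a ω • v

/-- `I = ∫₀ᵗ h dβ`, the Wiener integral of a deterministic `X`-valued `h` with respect to a real
fractional Brownian motion: the extension by continuity of `1_{[0,a]} v ↦ β(a) v`, i.e. `I` is the
limit in `L²(Ω; X)` of the integrals of step functions that approximate `h` in `|𝓗|`. -/
def IsWienerIntegral (P : Measure Ω) (H : ℝ) (β : ℝ → Ω → ℝ) (t : ℝ) (h : ℝ → X)
    (I : Lp X 2 P) : Prop :=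
  AEStronglyMeasurable h (volume.restrict (Icc 0 t)) ∧
  ∃ c : ℕ → (Icc (0 : ℝ) t →₀ X),
    Tendsto (fun k => absHNormSq H t (fun s => h s - stepFun (c k) s)) atTop (𝓝 0) ∧
    Tendsto (fun k => eLpNorm (fun ω => stepIntegral β (c k) ω - I ω) 2 P) atTop (𝓝 0)

variable {Y : Type*} [NormedAddCommGroup Y] [InnerProductSpace ℝ Y]

/-- The squared `Q`-Hilbert–Schmidt norm `∑ ‖√λ_n ψ e_n‖²` of `ψ : Y → X`. -/
def QFBM.hsNormSq {P : Measure Ω} {H T : ℝ} {ι : Type*} (W : QFBM P H T ι Y)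
    (ψ : Y →L[ℝ] X) : ℝ≥0∞ :=
  ∑' n, ‖√(W.lam n) • ψ (W.e n)‖ₑ ^ 2

/-- `J = ∫₀ᵗ Φ(s) dB_Q^H(s) = ∑_n ∫₀ᵗ √λ_n Φ(s) e_n dβ_n(s)`, the series converging in
`L²(Ω; X)`. -/
def QFBM.IsIntegral {P : Measure Ω} {H T : ℝ} {ι : Type*} (W : QFBM P H T ι Y) (t : ℝ)
    (Φ : ℝ → Y →L[ℝ] X) (J : Lp X 2 P) : Prop :=
  ∃ I : ι → Lp X 2 P,
    (∀ n, IsWienerIntegral P H (W.β n) t (fun s => √(W.lam n) • Φ s (W.e n)) (I n)) ∧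
    HasSum I J

/-- `σ ∈ L²([0, T]; L₂⁰(Y, X))`: strongly measurable and square-integrable in the
`Q`-Hilbert–Schmidt norm. -/
structure QFBM.SquareIntegrable {P : Measure Ω} {H T : ℝ} {ι : Type*} (W : QFBM P H T ι Y)
    (σ : ℝ → Y →L[ℝ] X) : Prop where
  measurable : ∀ n, AEStronglyMeasurable (fun s => √(W.lam n) • σ s (W.e n))
    (volume.restrict (Icc 0 T))
  finite : ∫⁻ s in Icc 0 T, W.hsNormSq (σ s) < ∞

end Noise

/-! ### Hypotheses on the coefficients -/

section Coefficients

variable {X : Type*} [NormedAddCommGroup X] [InnerProductSpace ℝ X]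

/-- `F` is a nonnegative function on `[0, T] × [0, ∞)`, with `F t` continuous, non-decreasing and
concave for each `t`, and `∫₀ᵀ F(s, x) ds < ∞` for each `x`. -/
structure IsConcaveModulus (T : ℝ) (F : ℝ → ℝ → ℝ) : Prop where
  nonneg : ∀ t ∈ Icc 0 T, ∀ x, 0 ≤ x → 0 ≤ F t x
  continuousOn : ∀ t ∈ Icc 0 T, ContinuousOn (F t) (Ici 0)
  monotoneOn : ∀ t ∈ Icc 0 T, MonotoneOn (F t) (Ici 0)
  concaveOn : ∀ t ∈ Icc 0 T, ConcaveOn ℝ (Ici 0) (F t)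
  integrable : ∀ x, 0 ≤ x → IntegrableOn (fun s => F s x) (Icc 0 T)

/-- Growth condition on `f`. -/
structure GrowthCondition (T : ℝ) (f : ℝ → X → X) (K : ℝ → ℝ → ℝ) : Prop where
  modulus : IsConcaveModulus T K
  bound : ∀ t ∈ Icc 0 T, ∀ x, ‖f t x‖ ^ 2 ≤ K t (‖x‖ ^ 2)
  /-- `u(t) = u₀ + α ∫₀ᵗ K(s, u(s)) ds` has a global solution on `[0, T]`. -/
  global : ∀ α u₀ : ℝ, 0 < α → 0 ≤ u₀ → ∃ u : ℝ → ℝ,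
    ContinuousOn u (Icc 0 T) ∧ (∀ t ∈ Icc 0 T, 0 ≤ u t) ∧
    IntegrableOn (fun s => K s (u s)) (Icc 0 T) ∧
    ∀ t ∈ Icc 0 T, u t = u₀ + α * ∫ s in (0 : ℝ)..t, K s (u s)

/-- Continuity condition on `f`. -/
structure OsgoodCondition (T : ℝ) (f : ℝ → X → X) (G : ℝ → ℝ → ℝ) : Prop where
  modulus : IsConcaveModulus T G
  zero : ∀ t ∈ Icc 0 T, G t 0 = 0
  bound : ∀ t ∈ Icc 0 T, ∀ x y, ‖f t x - f t y‖ ^ 2 ≤ G t (‖x - y‖ ^ 2)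
  /-- The only nonnegative `z` with `z(0) = 0` and `z(t) ≤ D ∫₀ᵗ G(s, z(s)) ds` is `0`. -/
  unique : ∀ D : ℝ, 0 < D → ∀ z : ℝ → ℝ, (∀ t ∈ Icc 0 T, 0 ≤ z t) → z 0 = 0 →
    IntegrableOn (fun s => G s (z s)) (Icc 0 T) →
    (∀ t ∈ Icc 0 T, z t ≤ D * ∫ s in (0 : ℝ)..t, G s (z s)) →
    ∀ t ∈ Icc 0 T, z t = 0

/-- Condition on the neutral term `g`, with constants `β`, `l`, `Mg`. -/
structure NeutralCondition (T : ℝ) (A : X →ₗ.[ℝ] X) (g : ℝ → X → X) (β l Mg : ℝ) : Prop where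
  half_lt : 1 / 2 < β
  lt_one : β < 1
  mem_domain : ∀ t ∈ Icc 0 T, ∀ x, g t x ∈ (fracPow A β).domain
  continuousOn : ContinuousOn (fun p : ℝ × X => pval (fracPow A β) (g p.1 p.2))
    (Icc 0 T ×ˢ univ)
  growth : ∀ t ∈ Icc 0 T, ∀ x, ‖pval (fracPow A β) (g t x)‖ ^ 2 ≤ l * (‖x‖ ^ 2 + 1)
  lipschitz : ∀ t ∈ Icc 0 T, ∀ x y,
    ‖pval (fracPow A β) (g t x) - pval (fracPow A β) (g t y)‖ ≤ Mg * ‖x - y‖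
  small_lipschitz : 3 * ‖negFracPow A β‖ ^ 2 * Mg ^ 2 < 1
  small_growth : 5 * ‖negFracPow A β‖ ^ 2 * l < 1

/-- Condition on the delay. -/
structure DelayCondition (r T : ℝ) (ρ : ℝ → ℝ) : Prop where
  continuousOn : ContinuousOn ρ (Icc 0 T)
  lower : ∀ t ∈ Icc 0 T, -r ≤ ρ t
  upper : ∀ t ∈ Icc 0 T, ρ t ≤ t

end Coefficients

/-! ### Mild solutions -/

section Mild

variable {Ω : Type*} [MeasurableSpace Ω] {X : Type*} [NormedAddCommGroup X] [InnerProductSpace ℝ X]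

open Classical in
/-- The random variable `F(u)`, `ω ↦ F (u ω)`, as an element of `L²(Ω; X)` when it is one
(and `0` otherwise). -/
def superpose {P : Measure Ω} (F : X → X) (u : Lp X 2 P) : Lp X 2 P :=
  if h : MemLp (fun ω => F (u ω)) 2 P then h.toLp _ else 0

/-- `x` is a mild solution on `[-r, T]` of
`d[x(t) + g(t, x(ρ(t)))] = [A x(t) + f(t, x(ρ(t)))] dt + σ(t) dB_Q^H(t)`, `x = φ` on `[-r, 0]`.
A process is a curve in `L²(Ω; X)`; the time integrals are Bochner integrals in `L²(Ω; X)`, and that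
all terms of the equation are well defined is part of the definition. -/
structure IsMildSolution {P : Measure Ω} {H T : ℝ} {ι Y : Type*}
    [NormedAddCommGroup Y] [InnerProductSpace ℝ Y]
    (W : QFBM P H T ι Y) (r : ℝ) (A : X →ₗ.[ℝ] X) (S : ℝ → X →L[ℝ] X)
    (f g : ℝ → X → X) (σ : ℝ → Y →L[ℝ] X) (ρ : ℝ → ℝ) (φ x : ℝ → Lp X 2 P) : Prop where
  continuousOn : ContinuousOn x (Icc (-r) T)
  initial : ∀ t ∈ Icc (-r) 0, x t = φ t
  memLp_g : ∀ t ∈ Icc 0 T, MemLp (fun ω => g t (x (ρ t) ω)) 2 P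
  memLp_Ag : ∀ t ∈ Icc 0 T, ∀ s ∈ Ico 0 t,
    MemLp (fun ω => pval A (S (t - s) (g s (x (ρ s) ω)))) 2 P
  memLp_f : ∀ t ∈ Icc 0 T, MemLp (fun ω => f t (x (ρ t) ω)) 2 P
  integrable_Ag : ∀ t ∈ Icc 0 T, IntervalIntegrable
    (fun s => superpose (fun v => pval A (S (t - s) (g s v))) (x (ρ s))) volume 0 t
  integrable_f : ∀ t ∈ Icc 0 T, IntervalIntegrable
    (fun s => superpose (fun v => S (t - s) (f s v)) (x (ρ s))) volume 0 t
  equation : ∀ t ∈ Icc 0 T, ∃ J : Lp X 2 P,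
    W.IsIntegral t (fun s => (S (t - s)).comp (σ s)) J ∧
    x t = (S t).compLp (φ 0 + superpose (g 0) (φ (ρ 0)))
      - superpose (g t) (x (ρ t))
      - (∫ s in (0 : ℝ)..t, superpose (fun v => pval A (S (t - s) (g s v))) (x (ρ s)))
      + (∫ s in (0 : ℝ)..t, superpose (fun v => S (t - s) (f s v)) (x (ρ s)))
      + J

end Mild

end NeutralSFDE

end

noncomputable section

set_option linter.unusedSectionVars false

namespace NeutralSFDE

/-! ### Bounded C₀-semigroups and their resolvents -/

section

section SemigroupTheory

variable {X : Type*} [NormedAddCommGroup X] [InnerProductSpace ℝ X]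

/-! A mild solution is a fixed point of the map Λ that sends a curve x in L²(Ω; X) to the right-hand
side of the mild equation. Each term of Λ x has to be defined and continuous in t, and Λ has to
satisfy an estimate that follows from the concave modulus G and still forces convergence.

Neutral term. Put B = (-A)^{-β} and 𝔤 = (-A)^β g, so that g = B 𝔤. Since (-A)^β is the inverse of B,
this requires B to be injective, which is `IsResolventFamily.eq_zero_of_integral_eq_zero`: a Fubini
argument using only the resolvent identity and decay. Then A S(t) g = Θ(t) 𝔤 with Θ(t) = A S(t) B.
Analyticity gives ‖A S(t)‖ = O(1/t) by Cauchy's estimate, and averaging over resolvents improves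
this to ‖Θ(t)‖ = O(t^{β-1}) (`exists_generator_mul_negFracPow`). As β > 1/2, this kernel is square
integrable at 0, and Cauchy–Schwarz controls the singular convolution by an integral of ‖x - y‖².

Noise. For H > 1/2 the covariance of fractional Brownian motion is a double integral of the Riesz
kernel |s - u|^{2H-2}. Hence the integral of a step function has L²(Ω; X) norm at most its |𝓗| norm,
which Schur's test bounds by the L²([0, T]; X) norm. Step functions are dense there, so the integral
extends. Integrals against independent noises are orthogonal, so the series over the eigenbasis
converges, and dominated convergence makes the stochastic convolution continuous in t
(`QFBM.exists_stochasticConvolution`). It does not depend on x.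

Fixed point. In Λ x - Λ y the initial term and the noise cancel and three differences remain. If z
is a nonnegative non-decreasing bound for ‖x - y‖² on [-r, s], then ‖Λ x(t) - Λ y(t)‖² ≤ q z(t) + c
∫₀ᵗ z + c ∫₀ᵗ G(s, z(s)) ds with q = 3‖B‖²Mg² < 1, by Jensen's inequality for G. This is not a
contraction. However, a nonnegative non-decreasing z bounded by its own right-hand side vanishes:
absorb q z, remove ∫ z by a Gronwall argument, and apply the Osgood hypothesis to z ≤ D ∫ G(s, z).
For the running supremum of the difference of two solutions this is uniqueness. For the limiting
tail oscillation of the Picard iterates it is convergence (`exists_unique_fixedPoint_of_osgood`).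
The iterates stay bounded because a concave modulus grows at most linearly. -/

theorem IsC0Semigroup.continuous_abs {S : ℝ → X →L[ℝ] X} (hS : IsC0Semigroup S) {M : ℝ}
    (hM : ∀ t, 0 ≤ t → ‖S t‖ ≤ M) (x : X) : Continuous fun t => S |t| x := by
  have h0 : Tendsto (fun t => S t x) (𝓝[≥] 0) (𝓝 x) := by
    have : Ici (0 : ℝ) = insert 0 (Ioi 0) := by ext t; simp [le_iff_eq_or_lt, eq_comm]
    rw [this, nhdsWithin_insert, tendsto_sup]
    refine ⟨?_, hS.tendsto_zero x⟩
    have h1 : S 0 x = x := by simp [hS.zero]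
    exact (tendsto_pure_nhds (fun t => S t x) 0).trans (by rw [h1])
  -- The semigroup law and the uniform bound reduce continuity at any time to right continuity at 0.
  -- Composing with the absolute value then gives a function continuous on all of ℝ.
  have key : ∀ s t : ℝ, 0 ≤ s → s ≤ t → ‖S t x - S s x‖ ≤ M * ‖S (t - s) x - x‖ := by
    intro s t hs hst
    have h1 : S t x - S s x = S s (S (t - s) x - x) := by
      have := hS.add s (t - s) hs (by linarith)
      rw [add_sub_cancel] at this
      rw [this, map_sub]; rfl
    rw [h1]
    exact ((S s).le_opNorm _).trans (by gcongr; exact hM s hs)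
  have key2 : ∀ s t : ℝ, ‖S |t| x - S |s| x‖ ≤ M * ‖S (|(|t| - |s|)|) x - x‖ := by
    intro s t
    rcases le_total |s| |t| with h | h
    · rw [abs_of_nonneg (sub_nonneg.2 h)]; exact key _ _ (abs_nonneg s) h
    · rw [abs_of_nonpos (sub_nonpos.2 h), neg_sub, norm_sub_rev]
      exact key _ _ (abs_nonneg t) h
  rw [continuous_iff_continuousAt]
  intro s
  rw [ContinuousAt, tendsto_iff_norm_sub_tendsto_zero]
  refine squeeze_zero (fun _ => norm_nonneg _) (fun t => key2 s t) ?_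
  have h3 : Tendsto (fun t : ℝ => |(|t| - |s|)|) (𝓝 s) (𝓝[≥] 0) := by
    refine tendsto_nhdsWithin_iff.2 ⟨?_, Eventually.of_forall fun t => mem_Ici.2 (abs_nonneg _)⟩
    have : Continuous fun t : ℝ => |(|t| - |s|)| := by fun_prop
    simpa using this.tendsto s
  have h4 := ((h0.comp h3).sub_const x).norm.const_mul M
  simpa using h4

theorem IsC0Semigroup.graph_map {S : ℝ → X →L[ℝ] X} (hS : IsC0Semigroup S) {A : X →ₗ.[ℝ] X}
    (hA : IsGenerator A S) {x y : X} (h : (x, y) ∈ A.graph) {t : ℝ} (ht : 0 ≤ t) :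
    (S t x, S t y) ∈ A.graph := by
  rw [hA] at h ⊢
  refine (((S t).continuous.tendsto y).comp h).congr' ?_
  filter_upwards [self_mem_nhdsWithin] with u hu
  have hu : 0 < u := hu
  have h1 : S t (S u x) = S u (S t x) := by
    have h2 := hS.add t u ht hu.le
    have h3 := hS.add u t hu.le ht
    rw [add_comm, h2] at h3
    exact congrArg (fun L => L x) h3
  simp [h1]

theorem IsResolventAt.unique {A : X →ₗ.[ℝ] X} {μ : ℝ} {R R' : X →L[ℝ] X}
    (h : IsResolventAt A μ R) (h' : IsResolventAt A μ R') : R = R' := by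
  ext z
  exact ((h' z _).2 ((h z _).1 rfl)).symm

theorem isResolventAt_resolvent {A : X →ₗ.[ℝ] X} {μ : ℝ} (h : μ ∈ resolventSet A) :
    IsResolventAt A μ (resolvent A μ) := by
  rw [resolvent, dif_pos h]; exact h.choose_spec

/-- Since (μ - A) R' z = z - (ν - μ) R' z, the operator R sends the right-hand side back to R' z. -/
theorem IsResolventAt.resolvent_identity {A : X →ₗ.[ℝ] X} {μ ν : ℝ} {R R' : X →L[ℝ] X}
    (h : IsResolventAt A μ R) (h' : IsResolventAt A ν R') :
    R - R' = (ν - μ) • R * R' := by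
  ext z
  have h1 : (R' z, ν • R' z - z) ∈ A.graph := (h' z _).1 rfl
  have h2 : R (z - (ν - μ) • R' z) = R' z := by
    rw [h]
    convert h1 using 2
    module
  simp only [map_sub, map_smul] at h2
  change R z - R' z = (ν - μ) • R (R' z)
  rw [sub_eq_iff_eq_add] at h2 ⊢
  rw [h2, add_comm]

theorem IsResolventAt.injective_zero {A : X →ₗ.[ℝ] X} {R : X →L[ℝ] X} {μ : ℝ}
    (h : IsResolventAt A μ R) {x : X} (hx : R x = 0) : x = 0 := by
  have := (h x 0).1 hx
  have h2 := A.graph_fst_eq_zero_snd this rfl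
  simpa using h2

variable [CompleteSpace X]

theorem integrableOn_exp_smul_semigroup {S : ℝ → X →L[ℝ] X} (hS : IsC0Semigroup S) {M : ℝ}
    (hM : ∀ t, 0 ≤ t → ‖S t‖ ≤ M) {μ : ℝ} (hμ : 0 < μ) (z : X) :
    IntegrableOn (fun t => Real.exp (-μ * t) • S |t| z) (Ioi 0) := by
  have h1 := (exp_neg_integrableOn_Ioi 0 hμ).mul_const (M * ‖z‖)
  refine h1.mono' ?_ ?_
  · exact ((by fun_prop : Continuous fun t : ℝ => Real.exp (-μ * t)).smul
      (hS.continuous_abs hM z)).aestronglyMeasurable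
  · refine Eventually.of_forall fun t => ?_
    rw [norm_smul, Real.norm_eq_abs, Real.abs_exp]
    gcongr
    exact ((S |t|).le_opNorm _).trans (by gcongr; exact hM _ (abs_nonneg t))

/-- The Laplace transform `z ↦ ∫₀^∞ e^{-μ t} S(t) z dt` of a bounded semigroup. -/
theorem exists_laplace {S : ℝ → X →L[ℝ] X} (hS : IsC0Semigroup S) {M : ℝ}
    (hM : ∀ t, 0 ≤ t → ‖S t‖ ≤ M) {μ : ℝ} (hμ : 0 < μ) :
    ∃ R : X →L[ℝ] X, ‖R‖ ≤ M / μ ∧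
      ∀ z, R z = ∫ t in Ioi (0 : ℝ), Real.exp (-μ * t) • S |t| z := by
  have hM0 : 0 ≤ M := (norm_nonneg _).trans (hM 0 le_rfl)
  have hb : ∀ z, ‖∫ t in Ioi (0 : ℝ), Real.exp (-μ * t) • S |t| z‖ ≤ M / μ * ‖z‖ := by
    intro z
    have h1 : ∫ t in Ioi (0 : ℝ), Real.exp (-μ * t) * (M * ‖z‖) = M / μ * ‖z‖ := by
      rw [integral_mul_const]
      have := integral_exp_mul_Ioi (a := -μ) (by linarith) 0
      rw [this]; simp; field_simp
    rw [← h1]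
    refine norm_integral_le_of_norm_le ((exp_neg_integrableOn_Ioi 0 hμ).mul_const (M * ‖z‖)) ?_
    refine Eventually.of_forall fun t => ?_
    rw [norm_smul, Real.norm_eq_abs, Real.abs_exp]
    gcongr
    exact ((S |t|).le_opNorm _).trans (by gcongr; exact hM _ (abs_nonneg t))
  refine ⟨LinearMap.mkContinuous
    { toFun := fun z => ∫ t in Ioi (0 : ℝ), Real.exp (-μ * t) • S |t| z
      map_add' := fun z w => ?_
      map_smul' := fun c z => ?_ } (M / μ) hb, LinearMap.mkContinuous_norm_le _ (by positivity) _,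
    fun z => rfl⟩
  · rw [← integral_add (integrableOn_exp_smul_semigroup hS hM hμ z)
      (integrableOn_exp_smul_semigroup hS hM hμ w)]
    simp
  · simp only [map_smul, RingHom.id_apply]
    rw [← integral_smul]
    simp only [smul_comm c]

/-- The resolvent is the Laplace transform R of the semigroup. Translating the integral gives S(h) R
z = e^{μh} (R z - ∫₀ʰ e^{-μt} S(t) z dt), whose right derivative at 0 is μ R z - z; this is A R z.
Conversely R commutes with the semigroup, so applying R to the difference quotients of x in D(A)
gives R (μ x - A x) = x. -/
theorem exists_resolvent_of_pos {S : ℝ → X →L[ℝ] X} (hS : IsC0Semigroup S)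
    {A : X →ₗ.[ℝ] X} (hA : IsGenerator A S) {M : ℝ}
    (hM : ∀ t, 0 ≤ t → ‖S t‖ ≤ M) {μ : ℝ} (hμ : 0 < μ) :
    ∃ R : X →L[ℝ] X, ‖R‖ ≤ M / μ ∧ IsResolventAt A μ R := by
  obtain ⟨R, hRn, hR⟩ := exists_laplace hS hM hμ
  refine ⟨R, hRn, ?_⟩
  have hcomm : ∀ a b : ℝ, 0 ≤ a → 0 ≤ b → ∀ z, S a (S b z) = S (a + b) z := by
    intro a b ha hb z; rw [hS.add a b ha hb]; rfl
  have hint := integrableOn_exp_smul_semigroup hS hM hμ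
  -- limit of difference quotients of `R z`
  have hlim : ∀ z, Tendsto (fun h : ℝ => h⁻¹ • (S h (R z) - R z)) (𝓝[>] 0) (𝓝 (μ • R z - z)) := by
    intro z
    set φ : ℝ → X := fun t => Real.exp (-μ * t) • S |t| z with hφ
    have hφc : Continuous φ :=
      (by fun_prop : Continuous fun t : ℝ => Real.exp (-μ * t)).smul (hS.continuous_abs hM z)
    have h1 : ∀ h : ℝ, 0 < h → S h (R z) = Real.exp (μ * h) • (R z - ∫ t in (0 : ℝ)..h, φ t) := by
      intro h hh
      have e1 : S h (R z) = ∫ t in Ioi (0 : ℝ), S h (φ t) := by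
        rw [hR, ContinuousLinearMap.integral_comp_comm _ (hint z)]
      have e2 : ∫ t in Ioi (0 : ℝ), S h (φ t)
          = ∫ t in Ioi (0 : ℝ), Real.exp (μ * h) • φ (t + h) := by
        refine setIntegral_congr_fun measurableSet_Ioi fun t ht => ?_
        have ht : 0 < t := ht
        simp only [hφ, map_smul, smul_smul, ← Real.exp_add]
        rw [abs_of_pos ht, abs_of_pos (by linarith : 0 < t + h), hcomm h t hh.le ht.le,
          add_comm h t]
        congr 2; ring
      have e3 : ∫ t in Ioi (0 : ℝ), φ (t + h) = ∫ t in Ioi h, φ t := by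
        have := (measurePreserving_add_right volume h).setIntegral_preimage_emb
          (measurableEmbedding_addRight h) φ (Ioi h)
        simpa using this
      have e4 : (∫ t in (0 : ℝ)..h, φ t) + ∫ t in Ioi h, φ t = R z := by
        rw [hR, intervalIntegral.integral_of_le hh.le,
          ← setIntegral_union (Ioc_disjoint_Ioi le_rfl) measurableSet_Ioi
            ((hint z).mono_set Ioc_subset_Ioi_self) ((hint z).mono_set (Ioi_subset_Ioi hh.le)),
          Ioc_union_Ioi_eq_Ioi hh.le]
      rw [e1, e2, integral_smul, e3, ← e4, add_sub_cancel_left]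
    have hd1 : HasDerivAt (fun h : ℝ => Real.exp (μ * h) • (R z - ∫ t in (0 : ℝ)..h, φ t))
        (Real.exp (μ * 0) • (0 - φ 0) + (Real.exp (μ * 0) * (μ * 1)) •
          (R z - ∫ t in (0 : ℝ)..0, φ t)) 0 := by
      refine HasDerivAt.fun_smul ?_ ?_
      · exact ((hasDerivAt_id (0 : ℝ)).const_mul μ).exp
      · exact (hasDerivAt_const _ _).sub (hφc.integral_hasStrictDerivAt 0 0).hasDerivAt
    have h2 := hd1.tendsto_slope_zero_right
    have hφ0 : φ 0 = z := by simp [hφ, hS.zero]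
    simp only [mul_zero, Real.exp_zero, one_smul, hφ0, intervalIntegral.integral_same, sub_zero,
      zero_sub, mul_one, one_mul, zero_add] at h2
    rw [neg_add_eq_sub] at h2
    refine h2.congr' ?_
    filter_upwards [self_mem_nhdsWithin] with h hh
    rw [h1 h hh]
  intro z x
  constructor
  · rintro rfl
    rw [hA]; exact hlim z
  · intro hx
    have hy := (hA _ _).1 hx
    have hRS : ∀ h : ℝ, 0 ≤ h → ∀ v, R (S h v) = S h (R v) := by
      intro h hh v
      rw [hR, hR, ← ContinuousLinearMap.integral_comp_comm _ (hint v)]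
      refine setIntegral_congr_fun measurableSet_Ioi fun t ht => ?_
      have ht : 0 < t := ht
      simp only [map_smul]
      rw [hcomm _ _ (abs_nonneg t) hh, hcomm _ _ hh (abs_nonneg t), add_comm]
    have h3 := (R.continuous.tendsto _).comp hy
    have h4 := tendsto_nhds_unique (h3.congr' ?_) (hlim x)
    · rw [map_sub, map_smul] at h4
      exact sub_right_injective h4
    · filter_upwards [self_mem_nhdsWithin] with h hh
      simp [hRS h (le_of_lt hh)]

end SemigroupTheory

end

/-! ### Resolvent families and injectivity of the negative fractional powers -/

section

theorem integrableOn_rpow_neg_div_one_add {α : ℝ} (h0 : 0 < α) (h1 : α < 1) :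
    IntegrableOn (fun t : ℝ => t ^ (-α) / (1 + t)) (Ioi 0) := by
  have hm : ∀ s : Set ℝ, AEStronglyMeasurable (fun t : ℝ => t ^ (-α) / (1 + t))
      (volume.restrict s) := fun s =>
    ((measurable_id.pow_const (-α)).div (measurable_const.add measurable_id)).aestronglyMeasurable
  rw [← Ioc_union_Ioi_eq_Ioi (zero_le_one' ℝ)]
  refine IntegrableOn.union ?_ ?_
  · have h2 : IntegrableOn (fun t : ℝ => t ^ (-α)) (Ioc 0 1) :=
      (intervalIntegrable_iff_integrableOn_Ioc_of_le zero_le_one).1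
        (intervalIntegral.intervalIntegrable_rpow' (by linarith))
    refine h2.mono' (hm _) ((ae_restrict_mem measurableSet_Ioc).mono fun t ht => ?_)
    have := Real.rpow_nonneg ht.1.le (-α)
    rw [Real.norm_of_nonneg (div_nonneg this (by linarith [ht.1]))]
    exact div_le_self this (by linarith [ht.1])
  · have h2 : IntegrableOn (fun t : ℝ => t ^ (-α - 1)) (Ioi 1) :=
      integrableOn_Ioi_rpow_of_lt (by linarith) one_pos
    refine h2.mono' (hm _) ((ae_restrict_mem measurableSet_Ioi).mono fun t ht => ?_)
    have ht : 1 < t := ht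
    have := Real.rpow_nonneg (by linarith : 0 ≤ t) (-α)
    rw [Real.norm_of_nonneg (div_nonneg this (by linarith)), Real.rpow_sub_one (by linarith)]
    gcongr; linarith

variable {X : Type*} [NormedAddCommGroup X] [InnerProductSpace ℝ X]

/-- The resolvent identity and decay on `[0, ∞)`. -/
structure IsResolventFamily (R : ℝ → X →L[ℝ] X) (C : ℝ) : Prop where
  identity : ∀ μ ν, 0 ≤ μ → 0 ≤ ν → R μ - R ν = (ν - μ) • (R μ * R ν)
  bound : ∀ μ, 0 ≤ μ → ‖R μ‖ ≤ C / (1 + μ)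

namespace IsResolventFamily

variable {R : ℝ → X →L[ℝ] X} {C : ℝ}

theorem const_nonneg (h : IsResolventFamily R C) : 0 ≤ C := by
  have := (norm_nonneg _).trans (h.bound 0 le_rfl)
  simpa using this

theorem bound_const (h : IsResolventFamily R C) {μ : ℝ} (hμ : 0 ≤ μ) : ‖R μ‖ ≤ C :=
  (h.bound μ hμ).trans (div_le_self h.const_nonneg (by linarith))

theorem commute (h : IsResolventFamily R C) {μ ν : ℝ} (hμ : 0 ≤ μ) (hν : 0 ≤ ν) :
    R μ * R ν = R ν * R μ := by
  rcases eq_or_ne μ ν with rfl | hne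
  · rfl
  have h1 := h.identity μ ν hμ hν
  have h2 := h.identity ν μ hν hμ
  have h3 : (ν - μ) • (R μ * R ν) = (ν - μ) • (R ν * R μ) := by
    rw [← h1, ← neg_sub (R ν), h2, ← neg_smul, neg_sub]
  exact smul_right_injective _ (sub_ne_zero.2 hne.symm) h3

theorem continuousOn (h : IsResolventFamily R C) : ContinuousOn R (Ici 0) := by
  have : LipschitzOnWith (Real.toNNReal (C * C)) R (Ici 0) := by
    refine LipschitzOnWith.of_dist_le_mul fun μ hμ ν hν => ?_
    rw [dist_eq_norm, h.identity μ ν hμ hν, norm_smul, dist_comm, dist_eq_norm, mul_comm,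
      Real.coe_toNNReal _ (mul_nonneg h.const_nonneg h.const_nonneg)]
    gcongr
    exact (norm_mul_le _ _).trans (mul_le_mul (h.bound_const hμ) (h.bound_const hν)
      (norm_nonneg _) h.const_nonneg)
  exact this.continuousOn

theorem hasDerivAt (h : IsResolventFamily R C) {μ : ℝ} (hμ : 0 < μ) :
    HasDerivAt R (-(R μ * R μ)) μ := by
  rw [hasDerivAt_iff_tendsto_slope]
  have h1 : Tendsto (fun ν => -(R μ * R ν)) (𝓝[≠] μ) (𝓝 (-(R μ * R μ))) := by
    have : Tendsto R (𝓝 μ) (𝓝 (R μ)) := h.continuousOn.continuousAt (Ici_mem_nhds hμ)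
    exact ((tendsto_const_nhds.mul this).neg).mono_left nhdsWithin_le_nhds
  refine h1.congr' ?_
  filter_upwards [self_mem_nhdsWithin, nhdsWithin_le_nhds (Ioi_mem_nhds hμ)] with ν hν hν0
  have hν : ν ≠ μ := hν
  rw [slope_def_module, ← neg_sub (R μ), h.identity μ ν hμ.le (le_of_lt hν0), smul_neg, smul_smul,
    inv_mul_cancel₀ (sub_ne_zero.2 hν), one_smul]

variable [CompleteSpace X]

theorem integrableOn_rpow_smul (h : IsResolventFamily R C) {α : ℝ} (h0 : 0 < α) (h1 : α < 1) :
    IntegrableOn (fun μ => μ ^ (-α) • R μ) (Ioi 0) := by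
  refine ((integrableOn_rpow_neg_div_one_add h0 h1).const_mul C).mono' ?_
    ((ae_restrict_mem measurableSet_Ioi).mono fun t ht => ?_)
  · exact ((measurable_id.pow_const (-α)).aestronglyMeasurable).smul
      ((h.continuousOn.mono Ioi_subset_Ici_self).aestronglyMeasurable measurableSet_Ioi)
  · have ht : 0 < t := ht
    rw [norm_smul, Real.norm_of_nonneg (Real.rpow_nonneg ht.le _), mul_comm C, div_mul_eq_mul_div,
      mul_div_assoc]
    gcongr
    exact h.bound t ht.le

/-- The lower bound ν for the parameter is kept separate so that one integrable function of ν
dominates R² along a whole segment of parameters. -/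
theorem norm_sq_apply_le (h : IsResolventFamily R C) (x : X) {μ ν : ℝ} (hν : 0 ≤ ν)
    (hμ : ν ≤ μ) : ‖R μ (R μ x)‖ ≤ C * C * ‖x‖ * (1 + ν ^ 2)⁻¹ := by
  have h0 : 0 ≤ μ := hν.trans hμ
  have hC := h.const_nonneg
  have h1 : ‖R μ (R μ x)‖ ≤ C / (1 + μ) * (C / (1 + μ) * ‖x‖) :=
    ((R μ).le_opNorm _).trans (mul_le_mul (h.bound μ h0) (((R μ).le_opNorm _).trans
      (by gcongr; exact h.bound μ h0)) (norm_nonneg _) (by positivity))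
  have h2 : C / (1 + μ) * (C / (1 + μ) * ‖x‖) = C * C * ‖x‖ * ((1 + μ) ^ 2)⁻¹ := by
    field_simp
  rw [h2] at h1
  refine h1.trans ?_
  gcongr
  nlinarith

theorem integrableOn_sq (h : IsResolventFamily R C) (x : X) :
    IntegrableOn (fun μ => R μ (R μ x)) (Ioi 0) := by
  refine (integrable_inv_one_add_sq.integrableOn.const_mul (C * C * ‖x‖)).mono' ?_
    ((ae_restrict_mem measurableSet_Ioi).mono fun t ht =>
      h.norm_sq_apply_le x (le_of_lt ht) le_rfl)
  have h1 : ContinuousOn R (Ioi 0) := h.continuousOn.mono Ioi_subset_Ici_self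
  exact (h1.clm_apply (h1.clm_apply continuousOn_const)).aestronglyMeasurable measurableSet_Ioi

/-- The derivative of R is -R², and R μ x tends to 0 at infinity. -/
theorem integral_sq (h : IsResolventFamily R C) (x : X) :
    ∫ μ in Ioi (0 : ℝ), R μ (R μ x) = R 0 x := by
  have hC := h.const_nonneg
  have h1 : Tendsto (fun μ => R μ x) atTop (𝓝 0) := by
    rw [tendsto_zero_iff_norm_tendsto_zero]
    have h2 : Tendsto (fun μ : ℝ => C / (1 + μ) * ‖x‖) atTop (𝓝 0) := by
      have := ((tendsto_const_nhds (x := C)).div_atTop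
        (tendsto_atTop_add_const_left atTop (1 : ℝ) tendsto_id)).mul_const ‖x‖
      simpa using this
    refine squeeze_zero' (Eventually.of_forall fun _ => norm_nonneg _) ?_ h2
    filter_upwards [eventually_ge_atTop 0] with μ hμ
    exact ((R μ).le_opNorm x).trans (by gcongr; exact h.bound μ hμ)
  have h3 := integral_Ioi_of_hasDerivAt_of_tendsto (a := (0 : ℝ)) (f := fun μ => R μ x)
    (f' := fun μ => -(R μ (R μ x))) (m := 0)
    ((h.continuousOn.clm_apply continuousOn_const) 0 self_mem_Ici)
    (fun μ hμ => by simpa using (h.hasDerivAt hμ).clm_apply (hasDerivAt_const μ x))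
    (h.integrableOn_sq x).neg h1
  rw [integral_neg, zero_sub, neg_inj] at h3
  exact h3

theorem integral_sq_comp_mul (h : IsResolventFamily R C) (x : X) {σ : ℝ} (hσ : 0 < σ) :
    ∫ ν in Ioi (0 : ℝ), R (ν * σ) (R (ν * σ) x) = σ⁻¹ • R 0 x := by
  have := integral_comp_mul_right_Ioi (fun μ => R μ (R μ x)) 0 hσ
  rw [this, zero_mul, h.integral_sq]

/-- By the resolvent identity the product R(ν) R(νs) is, up to sign, the divided difference of R
between ν and νs. As R' = -R², it is the average of R² over the segment joining them. -/
theorem apply_apply_eq_integral (h : IsResolventFamily R C) (x : X) {ν s : ℝ} (hν : 0 < ν)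
    (hs : 0 < s) :
    R ν (R (ν * s) x) =
      ∫ θ in (0 : ℝ)..1, R (ν * (1 + θ * (s - 1))) (R (ν * (1 + θ * (s - 1))) x) := by
  rcases eq_or_ne s 1 with rfl | hne
  · simp
  have hpos : ∀ θ ∈ uIcc (0 : ℝ) 1, 0 < ν * (1 + θ * (s - 1)) := by
    intro θ hθ
    rw [uIcc_of_le zero_le_one] at hθ
    have : 0 < 1 + θ * (s - 1) := by
      rcases le_total s 1 with h1 | h1 <;> nlinarith [hθ.1, hθ.2]
    positivity
  have hd : ∀ θ ∈ uIcc (0 : ℝ) 1, HasDerivAt (fun θ : ℝ => R (ν * (1 + θ * (s - 1))) x)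
      ((ν * (s - 1)) • -(R (ν * (1 + θ * (s - 1))) (R (ν * (1 + θ * (s - 1))) x))) θ := by
    intro θ hθ
    have h1 : HasDerivAt (fun θ : ℝ => ν * (1 + θ * (s - 1))) (ν * (s - 1)) θ := by
      simpa using (((hasDerivAt_id θ).mul_const (s - 1)).const_add 1).const_mul ν
    have h2 := HasDerivAt.scomp (h := fun θ : ℝ => ν * (1 + θ * (s - 1))) θ
      (h.hasDerivAt (hpos θ hθ)) h1
    exact ((ContinuousLinearMap.apply ℝ X x).hasFDerivAt.comp_hasDerivAt θ h2 :)
  have hmaps : MapsTo (fun θ : ℝ => ν * (1 + θ * (s - 1))) (uIcc 0 1) (Ici 0) :=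
    fun θ hθ => (hpos θ hθ).le
  have hc : ContinuousOn (fun θ : ℝ => R (ν * (1 + θ * (s - 1)))) (uIcc 0 1) :=
    h.continuousOn.comp (by fun_prop) hmaps
  have h3 := intervalIntegral.integral_eq_sub_of_hasDerivAt hd
    (((hc.clm_apply (hc.clm_apply continuousOn_const)).neg.const_smul
      (ν * (s - 1))).intervalIntegrable)
  rw [intervalIntegral.integral_smul, intervalIntegral.integral_neg] at h3
  have h4 := h.identity (ν * s) ν (by positivity) hν.le
  have h5 := congrArg (fun L : X →L[ℝ] X => L x) h4
  simp only [sub_apply, smul_apply] at h5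
  rw [h.commute (by positivity) hν.le] at h5
  have h6 : ν * (1 + 1 * (s - 1)) = ν * s := by ring
  simp only [h6, zero_mul, add_zero, mul_one, h5] at h3
  rw [smul_neg, ← neg_smul] at h3
  have h7 : -(ν * (s - 1)) = ν - ν * s := by ring
  rw [h7] at h3
  have h8 : ν - ν * s ≠ 0 := by
    rw [← h7]; exact neg_ne_zero.2 (mul_ne_zero hν.ne' (sub_ne_zero.2 hne))
  exact (smul_right_injective X h8 h3).symm

/-- After Fubini, the ν-integral at fixed θ is the rescaled integral of R², which is (1 + θ(s -
1))⁻¹ R(0) x. The product thus integrates to a positive multiple of R(0) x. -/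
theorem integral_apply_apply (h : IsResolventFamily R C) (x : X) {s : ℝ} (hs : 0 < s) :
    ∫ ν in Ioi (0 : ℝ), R ν (R (ν * s) x) =
      (∫ θ in (0 : ℝ)..1, (1 + θ * (s - 1))⁻¹) • R 0 x := by
  -- A lower bound for all the factors 1 + θ(s - 1), so that (1 + (σ₀ ν)²)⁻¹ serves as a majorant
  -- independent of θ.
  set σ₀ := min 1 s with hσ₀
  have hσ₀pos : 0 < σ₀ := lt_min one_pos hs
  have hσ : ∀ θ ∈ Ioc (0 : ℝ) 1, σ₀ ≤ 1 + θ * (s - 1) := by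
    intro θ hθ
    have h1 : σ₀ ≤ 1 := min_le_left _ _
    have h2 : σ₀ ≤ s := min_le_right _ _
    nlinarith [hθ.1, hθ.2]
  have e1 : ∫ ν in Ioi (0 : ℝ), R ν (R (ν * s) x) = ∫ ν in Ioi (0 : ℝ), ∫ θ in Ioc (0 : ℝ) 1,
      R (ν * (1 + θ * (s - 1))) (R (ν * (1 + θ * (s - 1))) x) := by
    refine setIntegral_congr_fun measurableSet_Ioi fun ν hν => ?_
    rw [h.apply_apply_eq_integral x hν hs, intervalIntegral.integral_of_le zero_le_one]
  have hint : Integrable (Function.uncurry fun ν θ : ℝ =>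
      R (ν * (1 + θ * (s - 1))) (R (ν * (1 + θ * (s - 1))) x))
      ((volume.restrict (Ioi 0)).prod (volume.restrict (Ioc 0 1))) := by
    have hb : Integrable (fun p : ℝ × ℝ => C * C * ‖x‖ * (1 + (σ₀ * p.1) ^ 2)⁻¹)
        ((volume.restrict (Ioi 0)).prod (volume.restrict (Ioc 0 1))) := by
      have h2 : Integrable (fun ν : ℝ => C * C * ‖x‖ * (1 + (σ₀ * ν) ^ 2)⁻¹)
          (volume.restrict (Ioi 0)) :=
        ((integrable_inv_one_add_sq.comp_mul_left' hσ₀pos.ne').const_mul _).integrableOn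
      exact h2.comp_fst _
    have hmem : ∀ᵐ p : ℝ × ℝ ∂((volume.restrict (Ioi 0)).prod (volume.restrict (Ioc 0 1))),
        p ∈ Ioi (0 : ℝ) ×ˢ Ioc (0 : ℝ) 1 := by
      rw [Measure.prod_restrict]
      exact ae_restrict_mem (measurableSet_Ioi.prod measurableSet_Ioc)
    refine hb.mono' ?_ (hmem.mono fun p hp => ?_)
    · rw [Measure.prod_restrict]
      have hc : ContinuousOn (fun p : ℝ × ℝ => R (p.1 * (1 + p.2 * (s - 1))))
          (Ioi 0 ×ˢ Ioc 0 1) := by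
        refine h.continuousOn.comp (by fun_prop) fun p hp => ?_
        exact mul_nonneg (le_of_lt hp.1) (hσ₀pos.le.trans (hσ _ hp.2))
      exact (hc.clm_apply (hc.clm_apply continuousOn_const)).aestronglyMeasurable
        (measurableSet_Ioi.prod measurableSet_Ioc)
    · have hp1 : 0 < p.1 := hp.1
      refine h.norm_sq_apply_le x (by positivity) ?_
      rw [mul_comm]
      gcongr
      exact hσ _ hp.2
  rw [e1, integral_integral_swap hint, intervalIntegral.integral_of_le zero_le_one,
    ← integral_smul_const]
  refine setIntegral_congr_fun measurableSet_Ioc fun θ hθ => ?_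
  exact h.integral_sq_comp_mul x (hσ₀pos.trans_le (hσ θ hθ))

/-- The resolvent decay bounds the integrand by a constant times ν^α/(1 + ν) · f₀(νs), where f₀(t) =
t^{-α}/(1 + t). Integrating out s leaves ν^{α-1}/(1 + ν), which is integrable because 0 < 1 - α < 1.
-/
theorem integrable_double (h : IsResolventFamily R C) (x : X) {α : ℝ} (h0 : 0 < α)
    (h1 : α < 1) :
    Integrable (Function.uncurry fun ν s : ℝ => s ^ (-α) • R ν (R (ν * s) x))
      ((volume.restrict (Ioi 0)).prod (volume.restrict (Ioi 0))) := by
  have hC := h.const_nonneg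
  have hmem : ∀ᵐ p : ℝ × ℝ ∂((volume.restrict (Ioi 0)).prod (volume.restrict (Ioi 0))),
      p ∈ Ioi (0 : ℝ) ×ˢ Ioi (0 : ℝ) := by
    rw [Measure.prod_restrict]
    exact ae_restrict_mem (measurableSet_Ioi.prod measurableSet_Ioi)
  set f₀ : ℝ → ℝ := fun t => t ^ (-α) / (1 + t) with hf₀
  have hf₀i : IntegrableOn f₀ (Ioi 0) := integrableOn_rpow_neg_div_one_add h0 h1
  have hf₀m : Measurable f₀ := (measurable_id.pow_const (-α)).div (measurable_const.add measurable_id)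
  have hb : Integrable (fun p : ℝ × ℝ => p.1 ^ α / (1 + p.1) * f₀ (p.1 * p.2))
      ((volume.restrict (Ioi 0)).prod (volume.restrict (Ioi 0))) := by
    have hm : AEStronglyMeasurable (fun p : ℝ × ℝ => p.1 ^ α / (1 + p.1) * f₀ (p.1 * p.2))
        ((volume.restrict (Ioi 0)).prod (volume.restrict (Ioi 0))) :=
      (((measurable_fst.pow_const α).div (measurable_const.add measurable_fst)).mul
        (hf₀m.comp (measurable_fst.mul measurable_snd))).aestronglyMeasurable
    rw [integrable_prod_iff hm]
    have hin : ∀ ν : ℝ, 0 < ν → IntegrableOn (fun s => f₀ (ν * s)) (Ioi 0) := fun ν hν => by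
      have := (integrableOn_Ioi_comp_mul_left_iff f₀ 0 hν).2 (by simpa using hf₀i)
      exact this
    refine ⟨(ae_restrict_mem measurableSet_Ioi).mono fun ν hν =>
      (hin ν hν).const_mul (ν ^ α / (1 + ν)), ?_⟩
    have h3 : IntegrableOn (fun ν : ℝ => (∫ t in Ioi 0, f₀ t) * (ν ^ (-(1 - α)) / (1 + ν)))
        (Ioi 0) := (integrableOn_rpow_neg_div_one_add (by linarith) (by linarith)).const_mul _
    refine h3.congr ((ae_restrict_mem measurableSet_Ioi).mono fun ν hν => ?_)
    have hν : 0 < ν := hν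
    have h4 : ∫ s in Ioi (0 : ℝ), ‖ν ^ α / (1 + ν) * f₀ (ν * s)‖
        = ∫ s in Ioi (0 : ℝ), ν ^ α / (1 + ν) * f₀ (ν * s) := by
      refine setIntegral_congr_fun measurableSet_Ioi fun s hs => ?_
      have hs : 0 < s := hs
      refine Real.norm_of_nonneg ?_
      simp only [hf₀]; positivity
    simp only [h4]
    rw [integral_const_mul, integral_comp_mul_left_Ioi f₀ 0 hν, mul_zero, smul_eq_mul, neg_sub,
      Real.rpow_sub_one hν.ne']
    field_simp
  refine (hb.const_mul (C * C * ‖x‖)).mono' ?_ (hmem.mono fun p hp => ?_)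
  · rw [Measure.prod_restrict]
    have hc1 : ContinuousOn (fun p : ℝ × ℝ => R p.1) (Ioi 0 ×ˢ Ioi 0) :=
      h.continuousOn.comp (by fun_prop) fun p hp => mem_Ici.2 (le_of_lt hp.1)
    have hc2 : ContinuousOn (fun p : ℝ × ℝ => R (p.1 * p.2)) (Ioi 0 ×ˢ Ioi 0) :=
      h.continuousOn.comp (by fun_prop) fun p hp =>
        mem_Ici.2 (mul_pos hp.1 hp.2).le
    exact ((measurable_snd.pow_const (-α)).aestronglyMeasurable).smul
      ((hc1.clm_apply (hc2.clm_apply continuousOn_const)).aestronglyMeasurable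
        (measurableSet_Ioi.prod measurableSet_Ioi))
  · have hν : 0 < p.1 := hp.1
    have hs : 0 < p.2 := hp.2
    simp only [Function.uncurry, norm_smul, hf₀]
    rw [Real.norm_of_nonneg (Real.rpow_nonneg hs.le _), Real.mul_rpow hν.le hs.le]
    have h5 : ‖R p.1 (R (p.1 * p.2) x)‖ ≤ C / (1 + p.1) * (C / (1 + p.1 * p.2) * ‖x‖) :=
      ((R p.1).le_opNorm _).trans (mul_le_mul (h.bound _ hν.le) (((R _).le_opNorm _).trans
        (by gcongr; exact h.bound _ (by positivity))) (norm_nonneg _) (by positivity))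
    refine (mul_le_mul_of_nonneg_left h5 (Real.rpow_nonneg hs.le _)).trans (le_of_eq ?_)
    have h6 : p.1 ^ α * p.1 ^ (-α) = 1 := by
      rw [← Real.rpow_add hν]; simp
    field_simp
    rw [mul_assoc (C ^ 2 * ‖x‖), h6, mul_one]

/-- Substitute μ = νs in the vanishing integral and apply R(ν): the integral of s^{-α} R(ν) R(νs) x
over s is 0 for every ν > 0. Integrating over ν and exchanging the order turns this into (∫ κ) R(0)
x = 0 with κ strictly positive, so R(0) x = 0. No composition law for fractional powers is needed.
-/
theorem eq_zero_of_integral_eq_zero (h : IsResolventFamily R C) (hinj : ∀ x, R 0 x = 0 → x = 0)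
    {α : ℝ} (h0 : 0 < α) (h1 : α < 1) {x : X}
    (hx : ∫ μ in Ioi (0 : ℝ), μ ^ (-α) • R μ x = 0) : x = 0 := by
  by_contra hne
  have hv : R 0 x ≠ 0 := fun h2 => hne (hinj x h2)
  have hint := h.integrable_double x h0 h1
  have hswap := integral_integral_swap hint
  have hleft : ∫ ν in Ioi (0 : ℝ), ∫ s in Ioi (0 : ℝ), s ^ (-α) • R ν (R (ν * s) x) = 0 := by
    refine setIntegral_eq_zero_of_forall_eq_zero fun ν hν => ?_
    have hν : 0 < ν := hν
    have e1 : ∫ s in Ioi (0 : ℝ), s ^ (-α) • R ν (R (ν * s) x) =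
        ∫ s in Ioi (0 : ℝ), ν ^ α • R ν ((ν * s) ^ (-α) • R (ν * s) x) := by
      refine setIntegral_congr_fun measurableSet_Ioi fun s hs => ?_
      have hs : 0 < s := hs
      have h6 : ν ^ α * (ν ^ (-α) * s ^ (-α)) = s ^ (-α) := by
        rw [← mul_assoc, ← Real.rpow_add hν]; simp
      simp only [map_smul, smul_smul]
      rw [Real.mul_rpow hν.le hs.le, h6]
    have hi : IntegrableOn (fun μ => μ ^ (-α) • R μ x) (Ioi 0) := by
      have := (ContinuousLinearMap.apply ℝ X x).integrable_comp (h.integrableOn_rpow_smul h0 h1)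
      exact this
    have hi2 : IntegrableOn (fun s => (ν * s) ^ (-α) • R (ν * s) x) (Ioi 0) :=
      (integrableOn_Ioi_comp_mul_left_iff (fun μ => μ ^ (-α) • R μ x) 0 hν).2 (by simpa using hi)
    rw [e1, integral_smul, ContinuousLinearMap.integral_comp_comm _ hi2,
      integral_comp_mul_left_Ioi (fun μ => μ ^ (-α) • R μ x) 0 hν, mul_zero, hx]
    simp
  set κ : ℝ → ℝ := fun s => s ^ (-α) * ∫ θ in (0 : ℝ)..1, (1 + θ * (s - 1))⁻¹ with hκ
  have hκpos : ∀ s, 0 < s → 0 < κ s := by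
    intro s hs
    refine mul_pos (Real.rpow_pos_of_pos hs _) ?_
    have hp : ∀ θ ∈ Icc (0 : ℝ) 1, 0 < 1 + θ * (s - 1) := fun θ hθ => by
      rcases le_total s 1 with h1 | h1 <;> nlinarith [hθ.1, hθ.2]
    refine intervalIntegral.intervalIntegral_pos_of_pos_on ?_
      (fun θ hθ => inv_pos.2 (hp θ (Ioo_subset_Icc_self hθ))) one_pos
    refine ContinuousOn.intervalIntegrable ?_
    rw [uIcc_of_le zero_le_one]
    exact ContinuousOn.inv₀ (by fun_prop) fun θ hθ => (hp θ hθ).ne'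
  have hinner : ∀ s ∈ Ioi (0 : ℝ), ∫ ν in Ioi (0 : ℝ), s ^ (-α) • R ν (R (ν * s) x)
      = κ s • R 0 x := fun s hs => by
    rw [integral_smul, h.integral_apply_apply x hs, smul_smul]
  rw [hleft, setIntegral_congr_fun measurableSet_Ioi hinner, integral_smul_const] at hswap
  have hκi : IntegrableOn κ (Ioi 0) := by
    have h7 := hint.integral_prod_right
    refine (integrable_smul_const hv).1 ?_
    exact h7.congr ((ae_restrict_mem measurableSet_Ioi).mono fun s hs => hinner s hs)
  have hzero : ∫ s in Ioi (0 : ℝ), κ s = 0 := (smul_eq_zero.1 hswap.symm).resolve_right hv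
  rw [setIntegral_eq_zero_iff_of_nonneg_ae
    ((ae_restrict_mem measurableSet_Ioi).mono fun s hs => (hκpos s hs).le) hκi] at hzero
  have h8 : ∀ᵐ s ∂(volume.restrict (Ioi (0 : ℝ))), False := by
    filter_upwards [hzero, ae_restrict_mem measurableSet_Ioi] with s h9 hs
    exact (hκpos s hs).ne' h9
  rw [eventually_false_iff_eq_bot, ae_eq_bot, Measure.restrict_eq_zero] at h8
  simp at h8

end IsResolventFamily

end

/-! ### Analytic semigroups and the smoothing estimate for A S(t) (-A)^{-α} -/

section

theorem isOpen_sector {θ : ℝ} (hθ : θ ≤ Real.pi / 2) : IsOpen (sector θ) := by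
  have h1 : sector θ = Complex.slitPlane ∩ Complex.arg ⁻¹' {x | |x| < θ} := by
    ext z
    simp only [sector, mem_ofPred_eq, mem_inter_iff, Complex.mem_slitPlane_iff_arg, mem_preimage]
    refine ⟨fun h => ⟨⟨fun h2 => ?_, h.1⟩, h.2⟩, fun h => ⟨h.1.2, h.2⟩⟩
    have := h.2
    rw [h2, abs_of_pos Real.pi_pos] at this
    linarith [Real.pi_pos]
  rw [h1]
  have h2 : ContinuousOn Complex.arg Complex.slitPlane := fun z hz =>
    (Complex.continuousAt_arg hz).continuousWithinAt
  exact h2.isOpen_inter_preimage Complex.isOpen_slitPlane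
    (isOpen_lt continuous_abs continuous_const)

theorem ofReal_mem_sector {θ : ℝ} (hθ : 0 < θ) {t : ℝ} (ht : 0 < t) : (t : ℂ) ∈ sector θ :=
  ⟨by exact_mod_cast ht.ne', by rw [Complex.arg_ofReal_of_nonneg ht.le]; simpa using hθ⟩

/-- The sector is invariant under positive dilations, so a disc around 1 can be rescaled to every t
> 0. -/
theorem exists_closedBall_subset_sector {θ : ℝ} (hθ0 : 0 < θ) (hθ : θ ≤ Real.pi / 2) :
    ∃ c : ℝ, 0 < c ∧ c < 1 ∧ ∀ t : ℝ, 0 < t → Metric.closedBall (t : ℂ) (c * t) ⊆ sector θ := by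
  have h1 : sector θ ∈ 𝓝 (1 : ℂ) := (isOpen_sector hθ).mem_nhds
    (by simpa using ofReal_mem_sector hθ0 one_pos)
  obtain ⟨ε, hε, hball⟩ := Metric.mem_nhds_iff.1 h1
  -- The half of ε makes the closed disc fit into the open one; the bound 1/2 keeps c below 1.
  refine ⟨min (ε / 2) (1 / 2), by positivity, (min_le_right _ _).trans_lt (by norm_num), ?_⟩
  intro t ht z hz
  have htc : (t : ℂ) ≠ 0 := by exact_mod_cast ht.ne'
  have h2 : z / t ∈ sector θ := by
    apply hball
    rw [Metric.mem_ball, dist_eq_norm]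
    rw [Metric.mem_closedBall, dist_eq_norm] at hz
    have h3 : z / t - 1 = (z - t) / t := by field_simp
    rw [h3, norm_div, Complex.norm_real, Real.norm_of_nonneg ht.le, div_lt_iff₀ ht]
    refine hz.trans_lt ?_
    have : min (ε / 2) (1 / 2) ≤ ε / 2 := min_le_left _ _
    gcongr
    linarith
  have h4 : z = t * (z / t) := by field_simp
  rw [h4]
  exact ⟨mul_ne_zero htc h2.1, by rw [Complex.arg_real_mul _ ht]; exact h2.2⟩

variable {X : Type*} [NormedAddCommGroup X] [InnerProductSpace ℝ X]

namespace Complexification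

theorem norm_re_le (v : Complexification X) : ‖re v‖ ≤ ‖v‖ := by
  refine (sq_le_sq₀ (norm_nonneg _) (norm_nonneg _)).1 ?_
  rw [norm_sq]; nlinarith [sq_nonneg ‖im v‖]

theorem norm_mk_zero (x : X) : ‖mk x 0‖ = ‖x‖ := by
  refine (sq_eq_sq₀ (norm_nonneg _) (norm_nonneg _)).1 ?_
  rw [norm_sq]; simp

/-- The real operator `x ↦ Re (V x)` defined by a complex operator `V` on `X + iX`. -/
def restrictReal (V : Complexification X →L[ℂ] Complexification X) : X →L[ℝ] X :=
  LinearMap.mkContinuous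
    { toFun := fun x => re (V (mk x 0))
      map_add' := fun x y => by
        have : mk (x + y) 0 = mk x 0 + mk y 0 := by ext <;> simp
        rw [this, map_add, re_add]
      map_smul' := fun c x => by
        have : mk (c • x) 0 = (c : ℂ) • mk x 0 := by
          ext
          · rw [re_smul]; simp
          · rw [im_smul]; simp
        rw [this, map_smul, re_smul]; simp }
    ‖V‖ (fun x => by
      refine (norm_re_le _).trans ((V.le_opNorm _).trans ?_)
      rw [norm_mk_zero])

theorem norm_restrictReal_le (V : Complexification X →L[ℂ] Complexification X) :
    ‖restrictReal V‖ ≤ ‖V‖ :=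
  ContinuousLinearMap.opNorm_le_bound _ (norm_nonneg _) fun x =>
    (norm_re_le _).trans ((V.le_opNorm _).trans (by rw [norm_mk_zero]))

/-- `restrictReal` as a contraction of real normed spaces. -/
def restrictRealL : (Complexification X →L[ℂ] Complexification X) →L[ℝ] (X →L[ℝ] X) :=
  LinearMap.mkContinuous
    { toFun := restrictReal
      map_add' := fun V W => by ext x; simp [restrictReal]
      map_smul' := fun c V => by
        ext x
        change re ((c • V) (mk x 0)) = c • re (V (mk x 0))
        have : (c • V) (mk x 0) = (c : ℂ) • V (mk x 0) := rfl
        rw [this, re_smul]; simp } 1 (fun V => by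
      rw [one_mul]
      exact norm_restrictReal_le V)

theorem restrictRealL_extend (L : X →L[ℝ] X) : restrictRealL (extend L) = L := by
  ext x
  rfl

theorem norm_restrictRealL_le (V : Complexification X →L[ℂ] Complexification X) :
    ‖restrictRealL V‖ ≤ ‖V‖ :=
  norm_restrictReal_le V

end Complexification

open Complexification

variable [CompleteSpace X]

/-- If the norms were unbounded near the vertex, some sequence tending to 0 in the sector would have
unbounded operator norms, although it converges strongly. This contradicts the uniform boundedness
principle. -/
theorem exists_norm_le_of_tendsto_sector {θ : ℝ}
    {U : ℂ → Complexification X →L[ℂ] Complexification X}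
    (hU : ∀ v, Tendsto (fun z => U z v) (𝓝[sector θ] 0) (𝓝 v)) :
    ∃ δ C : ℝ, 0 < δ ∧ ∀ z ∈ sector θ, ‖z‖ < δ → ‖U z‖ ≤ C := by
  by_contra! hcon
  have h1 : ∀ n : ℕ, ∃ z ∈ sector θ, ‖z‖ < 1 / ((n : ℝ) + 1) ∧ (n : ℝ) < ‖U z‖ := fun n =>
    hcon _ _ (by positivity)
  choose z hz hz1 hz2 using h1
  have h2 : Tendsto z atTop (𝓝[sector θ] 0) := by
    refine tendsto_nhdsWithin_iff.2 ⟨?_, Eventually.of_forall hz⟩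
    rw [tendsto_zero_iff_norm_tendsto_zero]
    exact squeeze_zero (fun _ => norm_nonneg _) (fun n => (hz1 n).le)
      tendsto_one_div_add_atTop_nhds_zero_nat
  obtain ⟨C, hC⟩ := banach_steinhaus (g := fun n => U (z n)) (fun v => by
    obtain ⟨C, hC⟩ := ((hU v).comp h2).norm.bddAbove_range
    exact ⟨C, fun n => hC ⟨n, rfl⟩⟩)
  obtain ⟨n, hn⟩ := exists_nat_gt C
  exact absurd (hC n) (not_le.2 (hn.trans (hz2 n)))

/-- The derivative is the real part of the complex derivative of the holomorphic extension. Cauchy's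
estimate on a circle of radius proportional to t gives the rate 1/t near 0. -/
theorem IsAnalyticSemigroup.exists_deriv {S : ℝ → X →L[ℝ] X} (hS : IsAnalyticSemigroup S) :
    ∃ D : ℝ → X →L[ℝ] X, ContinuousOn D (Ioi 0) ∧ (∀ t, 0 < t → HasDerivAt S (D t) t) ∧
      ∀ T : ℝ, ∃ C : ℝ, 0 ≤ C ∧ ∀ t ∈ Ioc 0 T, ‖D t‖ ≤ C / t := by
  obtain ⟨_, θ, hθ0, hθ, U, hU, -, hU0, hUS⟩ := hS
  have hopen := isOpen_sector hθ
  have hDc : ContinuousOn (fun t : ℝ => restrictRealL (deriv U t)) (Ioi 0) := by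
    refine restrictRealL.continuous.comp_continuousOn ?_
    exact (hU.deriv hopen).continuousOn.comp Complex.continuous_ofReal.continuousOn
      fun t ht => ofReal_mem_sector hθ0 ht
  refine ⟨fun t => restrictRealL (deriv U t), hDc, ?_, ?_⟩
  · intro t ht
    have h1 : HasDerivAt U (deriv U t) (t : ℂ) :=
      (hU.differentiableAt (hopen.mem_nhds (ofReal_mem_sector hθ0 ht))).hasDerivAt
    have h2 := restrictRealL.hasFDerivAt.comp_hasDerivAt t 
      (HasDerivAt.scomp (h := fun u : ℝ => (u : ℂ)) t h1 Complex.ofRealCLM.hasDerivAt)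
    rw [Complex.ofRealCLM_apply, Complex.ofReal_one, one_smul] at h2
    refine h2.congr_of_eventuallyEq ?_
    filter_upwards [Ioi_mem_nhds ht] with u hu
    simp only [Function.comp]
    rw [hUS u (le_of_lt hu), restrictRealL_extend]
  · intro T
    obtain ⟨c, hc0, hc1, hball⟩ := exists_closedBall_subset_sector hθ0 hθ
    obtain ⟨δ, C₀, hδ, hC₀⟩ := exists_norm_le_of_tendsto_sector hU0
    -- On the circle of radius c t around t one has |z| ≤ (1 + c) t < 2t < δ, so the uniform bound
    -- near the vertex applies.
    have hsmall : ∀ t, 0 < t → t < δ / 2 → ‖restrictRealL (deriv U t)‖ ≤ |C₀| / c / t := by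
      intro t ht htδ
      refine (norm_restrictRealL_le _).trans ?_
      rw [div_div]
      refine Complex.norm_deriv_le_of_forall_mem_sphere_norm_le (by positivity) ?_ ?_
      · refine ⟨hU.mono (Metric.ball_subset_closedBall.trans (hball t ht)), ?_⟩
        exact hU.continuousOn.mono (Metric.closure_ball_subset_closedBall.trans (hball t ht))
      · intro z hz
        have hzb := Metric.sphere_subset_closedBall hz
        refine (hC₀ z (hball t ht hzb) ?_).trans (le_abs_self _)
        rw [mem_sphere_iff_norm] at hz
        calc ‖z‖ = ‖(z - t) + t‖ := by rw [sub_add_cancel]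
          _ ≤ ‖z - t‖ + ‖(t : ℂ)‖ := norm_add_le _ _
          _ = c * t + t := by rw [hz, Complex.norm_real, Real.norm_of_nonneg ht.le]
          _ < δ := by nlinarith
    -- Away from 0 the derivative is bounded by compactness; multiplying by t ≤ |T| puts this bound
    -- in the form constant over t.
    obtain ⟨C₁, hC₁⟩ := (isCompact_Icc (a := δ / 2) (b := T)).exists_bound_of_continuousOn
      (hDc.mono fun t ht => (by linarith [ht.1] : (0 : ℝ) < t))
    refine ⟨|C₀| / c + |C₁| * |T|, by positivity, fun t ht => ?_⟩
    have ht0 : 0 < t := ht.1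
    rcases lt_or_ge t (δ / 2) with h | h
    · refine (hsmall t ht.1 h).trans ?_
      gcongr
      have : 0 ≤ |C₁| * |T| := by positivity
      linarith
    · refine (hC₁ t ⟨h, ht.2⟩).trans ?_
      rw [le_div_iff₀ ht0]
      have h5 : C₁ * t ≤ |C₁| * |T| := by
        have := ht.2.trans (le_abs_self T)
        exact mul_le_mul (le_abs_self _) this ht0.le (abs_nonneg _)
      have : 0 ≤ |C₀| / c := by positivity
      linarith

/-- The Laplace transform gives ‖R(μ)‖ ≤ M/μ, which is useless near 0. There R(μ) = R(0) - μ R(μ)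
R(0) and the same bound give ‖R(μ)‖ ≤ (1 + M)‖R(0)‖. Adding the bounds for ‖R(μ)‖ and μ‖R(μ)‖ yields
decay like 1/(1 + μ). -/
theorem isResolventFamily {S : ℝ → X →L[ℝ] X} (hS : IsC0Semigroup S)
    {A : X →ₗ.[ℝ] X} (hA : IsGenerator A S) {M : ℝ}
    (hM : ∀ t, 0 ≤ t → ‖S t‖ ≤ M) (h0 : (0 : ℝ) ∈ resolventSet A) :
    (∀ μ, 0 ≤ μ → IsResolventAt A μ (resolvent A μ)) ∧
      ∃ C, IsResolventFamily (resolvent A) C := by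
  have hM0 : 0 ≤ M := (norm_nonneg _).trans (hM 0 le_rfl)
  have h1 : ∀ μ, 0 ≤ μ → IsResolventAt A μ (resolvent A μ) := by
    intro μ hμ
    rcases hμ.eq_or_lt with rfl | hμ
    · exact isResolventAt_resolvent h0
    · obtain ⟨R, -, hR⟩ := exists_resolvent_of_pos hS hA hM hμ
      exact isResolventAt_resolvent ⟨R, hR⟩
  have h2 : ∀ μ, 0 < μ → ‖resolvent A μ‖ ≤ M / μ := by
    intro μ hμ
    obtain ⟨R, hRn, hR⟩ := exists_resolvent_of_pos hS hA hM hμ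
    rw [(h1 μ hμ.le).unique hR]; exact hRn
  have hid : ∀ μ ν, 0 ≤ μ → 0 ≤ ν → resolvent A μ - resolvent A ν =
      (ν - μ) • (resolvent A μ * resolvent A ν) := fun μ ν hμ hν => by
    rw [(h1 μ hμ).resolvent_identity (h1 ν hν), smul_mul_assoc]
  set L := ‖resolvent A 0‖ with hL
  have h3 : ∀ μ, 0 ≤ μ → ‖resolvent A μ‖ ≤ L * (1 + M) := by
    intro μ hμ
    rcases hμ.eq_or_lt with rfl | hμ
    · nlinarith [norm_nonneg (resolvent A 0)]
    · have h4 := hid μ 0 hμ.le le_rfl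
      rw [sub_eq_iff_eq_add] at h4
      rw [h4]
      refine (norm_add_le _ _).trans ?_
      rw [norm_smul, zero_sub, norm_neg, Real.norm_of_nonneg hμ.le]
      have h5 : μ * ‖resolvent A μ * resolvent A 0‖ ≤ μ * (M / μ * L) := by
        gcongr
        refine (norm_mul_le _ _).trans ?_
        gcongr
        exact h2 μ hμ
      have h6 : μ * (M / μ * L) = M * L := by field_simp
      linarith
  refine ⟨h1, L * (1 + M) + M, hid, fun μ hμ => ?_⟩
  rw [le_div_iff₀ (by linarith), mul_add, mul_one]
  refine add_le_add (h3 μ hμ) ?_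
  rcases hμ.eq_or_lt with rfl | hμ
  · simpa using hM0
  · exact (le_div_iff₀ hμ).1 (h2 μ hμ)

theorem pval_eq_of_mem_graph {L : X →ₗ.[ℝ] X} {x y : X} (h : (x, y) ∈ L.graph) :
    pval L x = y := by
  obtain ⟨z, rfl, h2⟩ := L.mem_graph_iff.1 h
  rw [pval, dif_pos z.2]; exact h2

/-- The swapped graph of (-A)^{-α} is the graph of its `LinearPMap.inverse` only when the kernel is
trivial, hence the injectivity hypothesis. -/
theorem negFracPow_pval_fracPow {A : X →ₗ.[ℝ] X} {α : ℝ}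
    (hinj : ∀ x, negFracPow A α x = 0 → x = 0) {v : X} (hv : v ∈ (fracPow A α).domain) :
    negFracPow A α (pval (fracPow A α) v) = v := by
  set f : X →ₗ.[ℝ] X := ((negFracPow A α : X →ₗ[ℝ] X).toPMap ⊤) with hf
  have hker : LinearMap.ker f.toFun = ⊥ := by
    rw [LinearMap.ker_eq_bot']
    intro x hx
    ext
    exact hinj x hx
  have h1 : (v, pval (fracPow A α) v) ∈ (fracPow A α).graph := by
    rw [pval, dif_pos hv]
    exact (fracPow A α).mem_graph ⟨v, hv⟩
  rw [fracPow, LinearPMap.inverse_graph hker] at h1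
  obtain ⟨⟨a, b⟩, hab, h2⟩ := h1
  simp only [LinearEquiv.coe_coe, LinearEquiv.prodComm_apply, Prod.swap_prod_mk,
    Prod.mk.injEq] at h2
  obtain ⟨z, hz1, hz2⟩ := f.mem_graph_iff.1 hab
  simp only at hz1 hz2
  change negFracPow A α (pval (fracPow A α) v) = v
  have h3 : f z = negFracPow A α z := rfl
  rw [fracPow, ← h2.2, ← hz1, ← h3, hz2, h2.1]

/-- The substitution u = tμ extracts the power t^{α-1} from the integral of μ^{-α}/(1 + tμ). -/
theorem norm_mul_integral_rpow_smul_le {R : ℝ → X →L[ℝ] X} {C : ℝ} (hR : IsResolventFamily R C)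
    {α : ℝ} (h0 : 0 < α) (h1 : α < 1) (D : X →L[ℝ] X) {K t : ℝ} (ht : 0 < t)
    (hD : ∀ μ, 0 < μ → ‖D * R μ‖ ≤ K / (1 + t * μ)) :
    ‖D * ∫ μ in Ioi (0 : ℝ), μ ^ (-α) • R μ‖ ≤
      K * (∫ u in Ioi (0 : ℝ), u ^ (-α) / (1 + u)) * t ^ (α - 1) := by
  set f₀ : ℝ → ℝ := fun t => t ^ (-α) / (1 + t) with hf₀
  have hf₀i : IntegrableOn f₀ (Ioi 0) := integrableOn_rpow_neg_div_one_add h0 h1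
  have e1 : D * ∫ μ in Ioi (0 : ℝ), μ ^ (-α) • R μ = ∫ μ in Ioi (0 : ℝ), D * (μ ^ (-α) • R μ) :=
    ((ContinuousLinearMap.mul ℝ (X →L[ℝ] X) D).integral_comp_comm
      (hR.integrableOn_rpow_smul h0 h1)).symm
  have e2 : ∫ μ in Ioi (0 : ℝ), K * t ^ α * f₀ (t * μ) =
      K * (∫ u in Ioi (0 : ℝ), f₀ u) * t ^ (α - 1) := by
    rw [integral_const_mul, integral_comp_mul_left_Ioi f₀ 0 ht, mul_zero, smul_eq_mul,
      Real.rpow_sub_one ht.ne']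
    field_simp
  rw [e1, ← e2]
  refine norm_integral_le_of_norm_le ?_ ((ae_restrict_mem measurableSet_Ioi).mono fun μ hμ => ?_)
  · exact ((integrableOn_Ioi_comp_mul_left_iff f₀ 0 ht).2 (by simpa using hf₀i)).const_mul _
  · have hμ : 0 < μ := hμ
    rw [mul_smul_comm, norm_smul, Real.norm_of_nonneg (Real.rpow_nonneg hμ.le _)]
    refine (mul_le_mul_of_nonneg_left (hD μ hμ) (Real.rpow_nonneg hμ.le _)).trans (le_of_eq ?_)
    have h6 : t ^ α * t ^ (-α) = 1 := by rw [← Real.rpow_add ht]; simp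
    simp only [hf₀]
    rw [Real.mul_rpow ht.le hμ.le]
    calc μ ^ (-α) * (K / (1 + t * μ)) = (t ^ α * t ^ (-α)) * (μ ^ (-α) * (K / (1 + t * μ))) := by
          rw [h6, one_mul]
      _ = _ := by ring

/-- The operators `A S(t) (-A)^{-α}` are continuous in `t > 0` and of size `O(t^{α - 1})`. -/
theorem exists_generator_mul_negFracPow {S : ℝ → X →L[ℝ] X} (hS : IsAnalyticSemigroup S)
    {A : X →ₗ.[ℝ] X} (hA : IsGenerator A S) (hb : ∃ M : ℝ, ∀ t, 0 ≤ t → ‖S t‖ ≤ M)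
    (h0 : (0 : ℝ) ∈ resolventSet A) {α : ℝ} (hα0 : 0 < α) (hα1 : α < 1) :
    (∀ v ∈ (fracPow A α).domain, negFracPow A α (pval (fracPow A α) v) = v) ∧
    ∃ Θ : ℝ → X →L[ℝ] X, ContinuousOn Θ (Ioi 0) ∧
      (∀ t, 0 < t → ∀ w, pval A (S t (negFracPow A α w)) = Θ t w) ∧
      ∀ T : ℝ, ∃ C : ℝ, 0 ≤ C ∧ ∀ t ∈ Ioc 0 T, ‖Θ t‖ ≤ C * t ^ (α - 1) := by
  obtain ⟨M, hM⟩ := hb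
  have hM0 : 0 ≤ M := (norm_nonneg _).trans (hM 0 le_rfl)
  obtain ⟨hres, C, hR⟩ := isResolventFamily hS.1 hA hM h0
  have hC := hR.const_nonneg
  have hsin : 0 < Real.sin (Real.pi * α) / Real.pi :=
    div_pos (Real.sin_pos_of_pos_of_lt_pi (by positivity) (by nlinarith [Real.pi_pos])) Real.pi_pos
  have hinj : ∀ x, negFracPow A α x = 0 → x = 0 := by
    intro x hx
    refine hR.eq_zero_of_integral_eq_zero (fun x => (hres 0 le_rfl).injective_zero) hα0 hα1 ?_
    rw [negFracPow, smul_apply, smul_eq_zero] at hx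
    have h2 := hx.resolve_left hsin.ne'
    rw [ContinuousLinearMap.integral_apply (hR.integrableOn_rpow_smul hα0 hα1)] at h2
    exact h2
  refine ⟨fun v hv => negFracPow_pval_fracPow hinj hv, ?_⟩
  obtain ⟨D, hDc, hD, hDb⟩ := hS.exists_deriv
  -- Differentiability at t puts S(t) v into D(A) for every v, so the derivative D(t) is the bounded
  -- operator A S(t).
  have hgraph : ∀ t, 0 < t → ∀ v, (S t v, D t v) ∈ A.graph := by
    intro t ht v
    rw [hA]
    have h1 : HasDerivAt (fun u => S u v) (D t v) t := by
      simpa using (hD t ht).clm_apply (hasDerivAt_const t v)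
    refine h1.tendsto_slope_zero_right.congr' ?_
    filter_upwards [self_mem_nhdsWithin] with h hh
    rw [add_comm, hS.1.add h t (le_of_lt hh) ht.le]
    rfl
  refine ⟨fun t => D t * negFracPow A α, hDc.mul continuousOn_const,
    fun t ht w => pval_eq_of_mem_graph (hgraph t ht _), fun T => ?_⟩
  obtain ⟨C₁, hC₁, hC₁b⟩ := hDb T
  set K := 2 * (C₁ * C + M * (C + 1)) with hK
  set I := ∫ u in Ioi (0 : ℝ), u ^ (-α) / (1 + u) with hI
  have hI0 : 0 ≤ I := setIntegral_nonneg measurableSet_Ioi fun u hu => by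
    have hu : 0 < u := hu
    positivity
  refine ⟨Real.sin (Real.pi * α) / Real.pi * (K * I), by positivity, fun t ht => ?_⟩
  have ht0 : 0 < t := ht.1
  -- Two bounds for A S(t) R(μ) are combined: the rate 1/t with resolvent decay, good for tμ ≥ 1,
  -- and the identity A R(μ) = μ R(μ) - 1, which gives a constant bound, good for tμ ≤ 1. The factor
  -- 2 in K covers 1 + tμ ≤ 2 max(1, tμ).
  have hDR : ∀ μ, 0 < μ → ‖D t * resolvent A μ‖ ≤ K / (1 + t * μ) := by
    intro μ hμ
    have b1 : ‖D t * resolvent A μ‖ ≤ C₁ / t * (C / (1 + μ)) :=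
      (norm_mul_le _ _).trans (mul_le_mul (hC₁b t ht) (hR.bound μ hμ.le) (norm_nonneg _)
        (by positivity))
    have b2 : ‖D t * resolvent A μ‖ ≤ M * (C + 1) := by
      have e : D t * resolvent A μ = S t * (μ • resolvent A μ - 1) := by
        ext z
        exact A.mem_graph_snd_inj (hgraph t ht0 (resolvent A μ z))
          (hS.1.graph_map hA ((hres μ hμ.le z _).1 rfl) ht0.le) rfl
      rw [e]
      refine (norm_mul_le _ _).trans (mul_le_mul (hM t ht0.le) ?_ (norm_nonneg _) hM0)
      refine (norm_sub_le _ _).trans (add_le_add ?_ ContinuousLinearMap.norm_id_le)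
      rw [norm_smul, Real.norm_of_nonneg hμ.le]
      calc μ * ‖resolvent A μ‖ ≤ μ * (C / (1 + μ)) := by gcongr; exact hR.bound μ hμ.le
        _ ≤ C := by rw [mul_div_assoc', div_le_iff₀ (by linarith)]; nlinarith
    rw [le_div_iff₀ (by positivity)]
    have p1 : 0 ≤ C₁ * C := by positivity
    have p2 : 0 ≤ M * (C + 1) := by positivity
    rcases le_total (t * μ) 1 with h | h
    · nlinarith [norm_nonneg (D t * resolvent A μ)]
    · have b3 : C₁ / t * (C / (1 + μ)) ≤ C₁ * C / (t * μ) := by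
        rw [div_mul_div_comm]; gcongr; linarith
      have b4 := (le_div_iff₀ (by positivity)).1 (b1.trans b3)
      nlinarith [norm_nonneg (D t * resolvent A μ)]
  have h7 := norm_mul_integral_rpow_smul_le hR hα0 hα1 (D t) ht0 hDR
  simp only [negFracPow]
  rw [mul_smul_comm, norm_smul, Real.norm_of_nonneg hsin.le, mul_assoc]
  gcongr

end

/-! ### The Riesz kernel, the covariance of fractional Brownian motion, and step integrals -/

section

theorem intervalIntegrable_abs_sub_rpow {a : ℝ} (ha : -1 < a) {s t : ℝ} (hs : 0 ≤ s)
    (hst : s ≤ t) : IntervalIntegrable (fun u => |s - u| ^ a) volume 0 t ∧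
      ∫ u in (0 : ℝ)..t, |s - u| ^ a = (s ^ (a + 1) + (t - s) ^ (a + 1)) / (a + 1) := by
  have ha1 : a + 1 ≠ 0 := by linarith
  have e1 : EqOn (fun u => (s - u) ^ a) (fun u => |s - u| ^ a) (uIoc 0 s) := fun u hu => by
    rw [uIoc_of_le hs] at hu
    simp only
    rw [abs_of_nonneg (by linarith [hu.2])]
  have e2 : EqOn (fun u => (u - s) ^ a) (fun u => |s - u| ^ a) (uIoc s t) := fun u hu => by
    rw [uIoc_of_le hst] at hu
    simp only
    rw [abs_of_nonpos (by linarith [hu.1]), neg_sub]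
  have r1 : IntervalIntegrable (fun u => (s - u) ^ a) volume 0 s := by
    have := (intervalIntegral.intervalIntegrable_rpow' (a := s) (b := 0) ha).comp_sub_left s
    simpa using this
  have r2 : IntervalIntegrable (fun u => (u - s) ^ a) volume s t := by
    have := (intervalIntegral.intervalIntegrable_rpow' (a := 0) (b := t - s) ha).comp_sub_right s
    simpa using this
  have i1 : IntervalIntegrable (fun u => |s - u| ^ a) volume 0 s := r1.congr e1
  have i2 : IntervalIntegrable (fun u => |s - u| ^ a) volume s t := r2.congr e2
  refine ⟨i1.trans i2, ?_⟩
  rw [← intervalIntegral.integral_add_adjacent_intervals i1 i2]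
  have c1 : ∫ u in (0 : ℝ)..s, |s - u| ^ a = s ^ (a + 1) / (a + 1) := by
    rw [← intervalIntegral.integral_congr_ae (Eventually.of_forall fun u hu => e1 hu)]
    rw [intervalIntegral.integral_comp_sub_left (fun v => v ^ a) s, sub_self, sub_zero,
      integral_rpow (Or.inl ha), Real.zero_rpow ha1, sub_zero]
  have c2 : ∫ u in s..t, |s - u| ^ a = (t - s) ^ (a + 1) / (a + 1) := by
    rw [← intervalIntegral.integral_congr_ae (Eventually.of_forall fun u hu => e2 hu)]
    rw [intervalIntegral.integral_comp_sub_right (fun v => v ^ a) s, sub_self,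
      integral_rpow (Or.inl ha), Real.zero_rpow ha1, sub_zero]
  rw [c1, c2, add_div]

/-- The Riesz kernel `|s - u|^{2H - 2}` with values in `[0, ∞]`. -/
def rieszKernel (H s u : ℝ) : ℝ≥0∞ := ENNReal.ofReal (|s - u| ^ (2 * H - 2))

theorem measurable_rieszKernel (H : ℝ) : Measurable fun p : ℝ × ℝ => rieszKernel H p.1 p.2 := by
  unfold rieszKernel
  fun_prop

theorem rieszKernel_comm (H s u : ℝ) : rieszKernel H s u = rieszKernel H u s := by
  rw [rieszKernel, rieszKernel, abs_sub_comm]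

/-- A bound for `∫₀ᵀ |s - u|^{2H - 2} du`. -/
def rieszBound (H T : ℝ) : ℝ≥0∞ := ENNReal.ofReal (2 * T ^ (2 * H - 1) / (2 * H - 1))

theorem lintegral_rieszKernel_le {H T s : ℝ} (hH : 1 / 2 < H) (hs : s ∈ Icc 0 T) :
    ∫⁻ u in Icc 0 T, rieszKernel H s u ≤ rieszBound H T := by
  have ha : -1 < 2 * H - 2 := by linarith
  obtain ⟨h1, h2⟩ := intervalIntegrable_abs_sub_rpow ha hs.1 hs.2
  have hT : 0 ≤ T := hs.1.trans hs.2
  rw [intervalIntegrable_iff_integrableOn_Icc_of_le hT] at h1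
  rw [intervalIntegral.integral_of_le hT, ← integral_Icc_eq_integral_Ioc] at h2
  unfold rieszKernel rieszBound
  rw [← ofReal_integral_eq_lintegral_ofReal h1 (Eventually.of_forall fun u => by positivity), h2]
  refine ENNReal.ofReal_le_ofReal ?_
  have e : 2 * H - 2 + 1 = 2 * H - 1 := by ring
  rw [e]
  have hp : 0 < 2 * H - 1 := by linarith
  have b1 : s ^ (2 * H - 1) ≤ T ^ (2 * H - 1) := Real.rpow_le_rpow hs.1 hs.2 hp.le
  have b2 : (T - s) ^ (2 * H - 1) ≤ T ^ (2 * H - 1) :=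
    Real.rpow_le_rpow (by linarith [hs.2]) (by linarith [hs.1]) hp.le
  gcongr
  linarith

theorem integrableOn_riesz {H : ℝ} (hH : 1 / 2 < H) (T : ℝ) :
    IntegrableOn (fun p : ℝ × ℝ => |p.1 - p.2| ^ (2 * H - 2)) (Icc 0 T ×ˢ Icc 0 T) := by
  refine ⟨(by fun_prop : Measurable fun p : ℝ × ℝ => |p.1 - p.2| ^ (2 * H - 2)).aestronglyMeasurable,
    ?_⟩
  rw [hasFiniteIntegral_iff_ofReal (Eventually.of_forall fun p => by positivity),
    Measure.volume_eq_prod, ← Measure.prod_restrict]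
  change ∫⁻ p : ℝ × ℝ, rieszKernel H p.1 p.2 ∂_ < _
  rw [lintegral_prod _ (measurable_rieszKernel H).aemeasurable]
  calc ∫⁻ s in Icc 0 T, ∫⁻ u in Icc 0 T, rieszKernel H s u
      ≤ ∫⁻ s in Icc 0 T, rieszBound H T :=
        setLIntegral_mono measurable_const fun s hs => lintegral_rieszKernel_le hH hs
    _ < ∞ := by
        rw [setLIntegral_const]
        exact ENNReal.mul_lt_top ENNReal.ofReal_lt_top (by simp)

theorem integral_riesz_of_le {H : ℝ} (hH : 1 / 2 < H) {x y : ℝ} (hx : 0 ≤ x) (hxy : x ≤ y) :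
    ∫ p in Icc 0 x ×ˢ Icc 0 y, |p.1 - p.2| ^ (2 * H - 2) =
      (x ^ (2 * H) + y ^ (2 * H) - (y - x) ^ (2 * H)) / (2 * H * (2 * H - 1)) := by
  have hi := (integrableOn_riesz hH y).mono_set (prod_mono_left (Icc_subset_Icc_right hxy))
  have e0 : 2 * H - 2 + 1 = 2 * H - 1 := by ring
  have hp : -1 < 2 * H - 1 := by linarith
  have hp1 : 2 * H - 1 ≠ 0 := by linarith
  have hp2 : 2 * H ≠ 0 := by linarith
  rw [Measure.volume_eq_prod] at hi ⊢
  rw [setIntegral_prod _ hi]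
  have e1 : ∫ s in Icc 0 x, ∫ u in Icc 0 y, |s - u| ^ (2 * H - 2) =
      ∫ s in (0 : ℝ)..x, (s ^ (2 * H - 1) + (y - s) ^ (2 * H - 1)) / (2 * H - 1) := by
    rw [intervalIntegral.integral_of_le hx, ← integral_Icc_eq_integral_Ioc]
    refine setIntegral_congr_fun measurableSet_Icc fun s hs => ?_
    have := (intervalIntegrable_abs_sub_rpow (by linarith : -1 < 2 * H - 2) hs.1
      (hs.2.trans hxy)).2
    rw [intervalIntegral.integral_of_le (hx.trans hxy), ← integral_Icc_eq_integral_Ioc, e0] at this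
    exact this
  have i1 : IntervalIntegrable (fun s : ℝ => s ^ (2 * H - 1)) volume 0 x :=
    intervalIntegral.intervalIntegrable_rpow' hp
  have i2 : IntervalIntegrable (fun s : ℝ => (y - s) ^ (2 * H - 1)) volume 0 x := by
    have := (intervalIntegral.intervalIntegrable_rpow' (a := y) (b := y - x) hp).comp_sub_left y
    simpa using this
  rw [e1, intervalIntegral.integral_div, intervalIntegral.integral_add i1 i2,
    intervalIntegral.integral_comp_sub_left (fun v => v ^ (2 * H - 1)) y,
    integral_rpow (Or.inl hp), integral_rpow (Or.inl hp), sub_zero]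
  have e2 : 2 * H - 1 + 1 = 2 * H := by ring
  rw [e2, Real.zero_rpow hp2]
  field_simp
  ring

/-- `R_H(x, y) = H (2H - 1) ∫₀ˣ ∫₀ʸ |s - u|^{2H - 2} du ds`. -/
theorem fbmCov_eq_integral {H : ℝ} (hH : 1 / 2 < H) {x y : ℝ} (hx : 0 ≤ x) (hy : 0 ≤ y) :
    fbmCov H x y = H * (2 * H - 1) * ∫ p in Icc 0 x ×ˢ Icc 0 y, |p.1 - p.2| ^ (2 * H - 2) := by
  have hp1 : 2 * H - 1 ≠ 0 := by linarith
  have hp2 : H ≠ 0 := by linarith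
  rcases le_total x y with h | h
  · rw [integral_riesz_of_le hH hx h, fbmCov, abs_of_nonneg (sub_nonneg.2 h)]
    field_simp
    ring
  · have e : ∫ p in Icc 0 x ×ˢ Icc 0 y, |p.1 - p.2| ^ (2 * H - 2) =
        ∫ p in Icc 0 y ×ˢ Icc 0 x, |p.1 - p.2| ^ (2 * H - 2) := by
      rw [Measure.volume_eq_prod, ← setIntegral_prod_swap]
      simp [abs_sub_comm]
    rw [e, integral_riesz_of_le hH hy h, fbmCov, abs_of_nonpos (sub_nonpos.2 h), neg_sub]
    field_simp

/-! ### Step functions and their integrals -/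

section Steps

variable {Ω : Type*} [MeasurableSpace Ω] {X : Type*} [NormedAddCommGroup X] [InnerProductSpace ℝ X]
  {t T : ℝ}

theorem stepFun_sub (c d : Icc (0 : ℝ) t →₀ X) (s : ℝ) :
    stepFun (c - d) s = stepFun c s - stepFun d s := by
  unfold stepFun
  refine Finsupp.sum_sub_index fun a v w => ?_
  by_cases h : s ∈ Icc (0 : ℝ) a <;> simp [h]

theorem stepIntegral_sub (β : ℝ → Ω → ℝ) (c d : Icc (0 : ℝ) t →₀ X) (ω : Ω) :
    stepIntegral β (c - d) ω = stepIntegral β c ω - stepIntegral β d ω := by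
  unfold stepIntegral
  exact Finsupp.sum_sub_index fun a v w => smul_sub _ _ _

theorem stronglyMeasurable_stepFun (c : Icc (0 : ℝ) t →₀ X) : StronglyMeasurable (stepFun c) := by
  unfold stepFun Finsupp.sum
  exact Finset.stronglyMeasurable_fun_sum _ fun a _ =>
    stronglyMeasurable_const.indicator measurableSet_Icc

theorem norm_stepFun_le (c : Icc (0 : ℝ) t →₀ X) (s : ℝ) :
    ‖stepFun c s‖ ≤ ∑ a ∈ c.support, ‖c a‖ := by
  unfold stepFun Finsupp.sum
  exact norm_sum_le_of_le _ fun a _ => norm_indicator_le_norm_self (fun _ => c a) s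

theorem memLp_stepFun (c : Icc (0 : ℝ) t →₀ X) (T : ℝ) :
    MemLp (stepFun c) 2 (volume.restrict (Icc 0 T)) :=
  MemLp.of_bound (stronglyMeasurable_stepFun c).aestronglyMeasurable _
    (Eventually.of_forall (norm_stepFun_le c))

theorem stepFun_of_notMem (c : Icc (0 : ℝ) t →₀ X) {s : ℝ} (hs : s ∉ Icc 0 t) :
    stepFun c s = 0 := by
  unfold stepFun Finsupp.sum
  refine Finset.sum_eq_zero fun a _ => indicator_of_notMem (fun h => hs ?_) _
  exact ⟨h.1, h.2.trans a.2.2⟩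

/-- A step function on `[0, t]` as a step function on `[0, T]`. -/
def extendStep (htT : t ≤ T) (c : Icc (0 : ℝ) t →₀ X) : Icc (0 : ℝ) T →₀ X :=
  c.mapDomain (Set.inclusion (Icc_subset_Icc_right htT))

theorem stepFun_extendStep (htT : t ≤ T) (c : Icc (0 : ℝ) t →₀ X) :
    stepFun (extendStep htT c) = stepFun c := by
  ext s
  unfold stepFun extendStep
  rw [Finsupp.sum_mapDomain_index]
  · simp
  · intro b v w
    by_cases h : s ∈ Icc (0 : ℝ) b <;> simp only [h, indicator_of_mem, not_false_eq_true,
      indicator_of_notMem, add_zero]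

theorem stepIntegral_extendStep (β : ℝ → Ω → ℝ) (htT : t ≤ T) (c : Icc (0 : ℝ) t →₀ X) :
    stepIntegral β (extendStep htT c) = stepIntegral β c := by
  ext ω
  unfold stepIntegral extendStep
  rw [Finsupp.sum_mapDomain_index]
  · simp
  · intro b v w
    exact smul_add _ _ _

theorem IsFBM.memLp {P : Measure Ω} {H : ℝ} {β : ℝ → Ω → ℝ} (h : IsFBM P H T β)
    {s : ℝ} (hs : s ∈ Icc 0 T) : MemLp (β s) 2 P :=
  (h.gaussian.hasGaussianLaw_eval ⟨s, hs⟩).memLp (by simp)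

theorem IsFBM.memLp_stepIntegral {P : Measure Ω} {H : ℝ} {β : ℝ → Ω → ℝ} (h : IsFBM P H T β)
    (c : Icc (0 : ℝ) T →₀ X) : MemLp (stepIntegral β c) 2 P := by
  unfold stepIntegral Finsupp.sum
  exact memLp_finsetSum _ fun a _ =>
    MemLp.smul (p := 2) (q := ∞) (memLp_top_const (c a)) (h.memLp a.2)

/-- Both sides are bilinear in the coefficients. Expanding them, each covariance R_H(a, b) is the
integral of the Riesz kernel over the rectangle [0, a] × [0, b]. -/
theorem IsFBM.integral_norm_sq_stepIntegral {P : Measure Ω} {H : ℝ} {β : ℝ → Ω → ℝ}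
    (hH : 1 / 2 < H) (h : IsFBM P H T β) (c : Icc (0 : ℝ) T →₀ X) :
    ∫ ω, ‖stepIntegral β c ω‖ ^ 2 ∂P = H * (2 * H - 1) * ∫ p in Icc 0 T ×ˢ Icc 0 T,
      inner ℝ (stepFun c p.1) (stepFun c p.2) * |p.1 - p.2| ^ (2 * H - 2) := by
  have e1 : ∀ ω, ‖stepIntegral β c ω‖ ^ 2 =
      ∑ a ∈ c.support, ∑ b ∈ c.support, inner ℝ (c a) (c b) * (β a ω * β b ω) := by
    intro ω
    rw [← real_inner_self_eq_norm_sq]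
    unfold stepIntegral Finsupp.sum
    rw [sum_inner]
    refine Finset.sum_congr rfl fun a _ => ?_
    rw [inner_sum]
    refine Finset.sum_congr rfl fun b _ => ?_
    rw [real_inner_smul_left, real_inner_smul_right]
    ring
  have hint : ∀ a b : Icc (0 : ℝ) T, Integrable (fun ω => inner ℝ (c a) (c b) * (β a ω * β b ω)) P :=
    fun a b => ((h.memLp a.2).integrable_mul (h.memLp b.2)).const_mul _
  have e2 : ∀ p : ℝ × ℝ, inner ℝ (stepFun c p.1) (stepFun c p.2) * |p.1 - p.2| ^ (2 * H - 2) =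
      ∑ a ∈ c.support, ∑ b ∈ c.support, inner ℝ (c a) (c b) *
        (Icc (0 : ℝ) a ×ˢ Icc (0 : ℝ) b).indicator (fun p => |p.1 - p.2| ^ (2 * H - 2)) p := by
    intro p
    unfold stepFun Finsupp.sum
    rw [sum_inner, Finset.sum_mul]
    refine Finset.sum_congr rfl fun a _ => ?_
    rw [inner_sum, Finset.sum_mul]
    refine Finset.sum_congr rfl fun b _ => ?_
    by_cases h1 : p.1 ∈ Icc (0 : ℝ) a <;> by_cases h2 : p.2 ∈ Icc (0 : ℝ) b <;>
      simp only [indicator_apply, mem_prod, h1, h2, and_self, and_true, and_false, if_true,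
        if_false, inner_zero_left, inner_zero_right, zero_mul, mul_zero]
  have hint2 : ∀ a b : Icc (0 : ℝ) T, IntegrableOn (fun p => inner ℝ (c a) (c b) *
        (Icc (0 : ℝ) a ×ˢ Icc (0 : ℝ) b).indicator (fun p => |p.1 - p.2| ^ (2 * H - 2)) p)
        (Icc 0 T ×ˢ Icc 0 T) := fun a b =>
    ((integrableOn_riesz hH T).indicator (measurableSet_Icc.prod measurableSet_Icc)).const_mul _
  simp only [e1, e2]
  rw [integral_finsetSum _ fun a _ => integrable_finsetSum _ fun b _ => hint a b,
    integral_finsetSum _ fun a _ => integrable_finsetSum _ fun b _ => hint2 a b, Finset.mul_sum]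
  refine Finset.sum_congr rfl fun a _ => ?_
  rw [integral_finsetSum _ fun b _ => hint a b, integral_finsetSum _ fun b _ => hint2 a b,
    Finset.mul_sum]
  refine Finset.sum_congr rfl fun b _ => ?_
  rw [integral_const_mul, integral_const_mul, h.covariance a a.2 b b.2,
    setIntegral_indicator (measurableSet_Icc.prod measurableSet_Icc),
    inter_eq_right.2 (prod_mono (Icc_subset_Icc_right a.2.2) (Icc_subset_Icc_right b.2.2)),
    fbmCov_eq_integral hH a.2.1 b.2.1]
  ring

theorem eLpNorm_two_sq {α E : Type*} [MeasurableSpace α] [NormedAddCommGroup E] (f : α → E)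
    (μ : Measure α) : eLpNorm f 2 μ ^ 2 = ∫⁻ x, ‖f x‖ₑ ^ 2 ∂μ := by
  rw [eLpNorm_eq_lintegral_rpow_enorm_toReal two_ne_zero ENNReal.ofNat_ne_top,
    ← ENNReal.rpow_natCast, ← ENNReal.rpow_mul]
  simp

/-- The exact second moment involves inner products of values; Cauchy–Schwarz in X replaces them by
products of norms. This inequality is what allows the extension by continuity from |𝓗|. -/
theorem IsFBM.eLpNorm_stepIntegral_sq_le {P : Measure Ω} {H : ℝ} {β : ℝ → Ω → ℝ}
    (hH : 1 / 2 < H) (h : IsFBM P H T β) (c : Icc (0 : ℝ) T →₀ X) :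
    eLpNorm (stepIntegral β c) 2 P ^ 2 ≤ absHNormSq H T (stepFun c) := by
  have hm := h.memLp_stepIntegral c
  have e1 : eLpNorm (stepIntegral β c) 2 P ^ 2 =
      ENNReal.ofReal (∫ ω, ‖stepIntegral β c ω‖ ^ 2 ∂P) := by
    rw [eLpNorm_two_sq, ofReal_integral_eq_lintegral_ofReal (hm.integrable_norm_pow two_ne_zero)
      (Eventually.of_forall fun ω => by positivity)]
    refine lintegral_congr fun ω => ?_
    rw [ENNReal.ofReal_pow (norm_nonneg _), ofReal_norm]
  have hc : 0 ≤ H * (2 * H - 1) := mul_nonneg (by linarith) (by linarith)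
  rw [e1, h.integral_norm_sq_stepIntegral hH, ENNReal.ofReal_mul hc, absHNormSq]
  gcongr
  have hmeas : AEMeasurable (fun p : ℝ × ℝ => ‖stepFun c p.1‖ₑ * ‖stepFun c p.2‖ₑ *
      ENNReal.ofReal (|p.1 - p.2| ^ (2 * H - 2)))
      ((volume.restrict (Icc 0 T)).prod (volume.restrict (Icc 0 T))) := by
    refine Measurable.aemeasurable ?_
    have hs := (stronglyMeasurable_stepFun c)
    exact (((hs.comp_measurable measurable_fst).enorm).mul
      ((hs.comp_measurable measurable_snd).enorm)).mul (measurable_rieszKernel H)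
  have e2 := lintegral_prod _ hmeas
  rw [← e2, Measure.prod_restrict, ← Measure.volume_eq_prod]
  refine ((ENNReal.ofReal_le_ofReal (le_abs_self _)).trans ?_)
  rw [← Real.norm_eq_abs, ofReal_norm]
  refine (enorm_integral_le_lintegral_enorm _).trans (lintegral_mono fun p => ?_)
  rw [enorm_mul]
  gcongr
  · rw [← ofReal_norm, ← ofReal_norm, ← ofReal_norm, ← ENNReal.ofReal_mul (norm_nonneg _)]
    exact ENNReal.ofReal_le_ofReal (norm_inner_le_norm _ _)
  · rw [Real.enorm_of_nonneg (by positivity)]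

end Steps

end

/-! ### Energy estimates: comparing |𝓗| with L², and density of step functions -/

section

theorem ENNReal.mul_le_add_sq (x y : ℝ≥0∞) {ε : ℝ≥0∞} (h0 : ε ≠ 0) (h1 : ε ≠ ∞) :
    x * y ≤ ε * x ^ 2 + ε⁻¹ * y ^ 2 := by
  rcases le_total y (ε * x) with h | h
  · calc x * y ≤ x * (ε * x) := by gcongr
      _ = ε * x ^ 2 := by ring
      _ ≤ _ := le_self_add
  · have h2 : x ≤ ε⁻¹ * y := by
      rw [mul_comm, ← div_eq_mul_inv, ENNReal.le_div_iff_mul_le (Or.inl h0) (Or.inl h1), mul_comm]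
      exact h
    calc x * y ≤ ε⁻¹ * y * y := by gcongr
      _ = ε⁻¹ * y ^ 2 := by ring
      _ ≤ _ := le_add_self

theorem lintegral_lintegral_add {μ ν : Measure ℝ} [SFinite μ] [SFinite ν] {F G : ℝ → ℝ → ℝ≥0∞}
    (hF : AEMeasurable (Function.uncurry F) (μ.prod ν))
    (hG : AEMeasurable (Function.uncurry G) (μ.prod ν)) :
    ∫⁻ s, ∫⁻ u, F s u + G s u ∂ν ∂μ = (∫⁻ s, ∫⁻ u, F s u ∂ν ∂μ) + ∫⁻ s, ∫⁻ u, G s u ∂ν ∂μ := by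
  have e1 := lintegral_prod _ hF
  have e2 := lintegral_prod _ hG
  have e3 := lintegral_prod _ (hF.add hG)
  simp only [Pi.add_apply, Function.uncurry] at e1 e2 e3
  rw [← e1, ← e2, ← e3]
  exact lintegral_add_left' hF _

/-- The Riesz energy `∫₀ᵀ ∫₀ᵀ p(s) q(u) |s - u|^{2H - 2} du ds`. -/
def rieszEnergy (H T : ℝ) (p q : ℝ → ℝ≥0∞) : ℝ≥0∞ :=
  ∫⁻ s in Icc 0 T, ∫⁻ u in Icc 0 T, p s * q u * rieszKernel H s u

variable {H T : ℝ}

/-- Schur's test: split the product p(s) q(u) by a weighted Young inequality, then integrate the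
symmetric kernel in the variable that no longer occurs. -/
theorem rieszEnergy_le (hH : 1 / 2 < H) {p q : ℝ → ℝ≥0∞}
    (hp : AEMeasurable p (volume.restrict (Icc 0 T)))
    (hq : AEMeasurable q (volume.restrict (Icc 0 T))) {ε : ℝ≥0∞} (h0 : ε ≠ 0) (h1 : ε ≠ ∞) :
    rieszEnergy H T p q ≤ rieszBound H T *
      (ε * (∫⁻ s in Icc 0 T, p s ^ 2) + ε⁻¹ * ∫⁻ s in Icc 0 T, q s ^ 2) := by
  have hbound : ∀ r : ℝ → ℝ≥0∞, AEMeasurable r (volume.restrict (Icc 0 T)) →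
      ∫⁻ s in Icc 0 T, ∫⁻ u in Icc 0 T, r s * rieszKernel H s u ≤
        rieszBound H T * ∫⁻ s in Icc 0 T, r s := by
    intro r hr
    rw [← lintegral_const_mul'' _ hr]
    refine setLIntegral_mono' measurableSet_Icc fun s hs => ?_
    have hm : Measurable (rieszKernel H s) := (measurable_rieszKernel H).comp measurable_prodMk_left
    rw [lintegral_const_mul _ hm, mul_comm]
    gcongr
    exact lintegral_rieszKernel_le hH hs
  have hk := (measurable_rieszKernel H).aemeasurable (μ :=
    (volume.restrict (Icc 0 T)).prod (volume.restrict (Icc 0 T)))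
  have hp2 : AEMeasurable (fun s => ε * p s ^ 2) (volume.restrict (Icc 0 T)) :=
    (hp.pow_const 2).const_mul _
  have hq2 : AEMeasurable (fun s => ε⁻¹ * q s ^ 2) (volume.restrict (Icc 0 T)) :=
    (hq.pow_const 2).const_mul _
  have hm1 : AEMeasurable (Function.uncurry fun s u => ε * p s ^ 2 * rieszKernel H s u)
      ((volume.restrict (Icc 0 T)).prod (volume.restrict (Icc 0 T))) :=
    (hp2.comp_fst).mul hk
  have hm2 : AEMeasurable (Function.uncurry fun s u => ε⁻¹ * q u ^ 2 * rieszKernel H s u)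
      ((volume.restrict (Icc 0 T)).prod (volume.restrict (Icc 0 T))) :=
    (hq2.comp_snd).mul hk
  calc rieszEnergy H T p q
      ≤ ∫⁻ s in Icc 0 T, ∫⁻ u in Icc 0 T,
          (ε * p s ^ 2 * rieszKernel H s u + ε⁻¹ * q u ^ 2 * rieszKernel H s u) := by
        refine lintegral_mono fun s => lintegral_mono fun u => ?_
        rw [← add_mul]
        gcongr
        exact ENNReal.mul_le_add_sq _ _ h0 h1
    _ = (∫⁻ s in Icc 0 T, ∫⁻ u in Icc 0 T, ε * p s ^ 2 * rieszKernel H s u) +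
          ∫⁻ s in Icc 0 T, ∫⁻ u in Icc 0 T, ε⁻¹ * q u ^ 2 * rieszKernel H s u :=
        lintegral_lintegral_add hm1 hm2
    _ ≤ rieszBound H T * (∫⁻ s in Icc 0 T, ε * p s ^ 2) +
          rieszBound H T * (∫⁻ s in Icc 0 T, ε⁻¹ * q s ^ 2) := by
        refine add_le_add (hbound _ hp2) ?_
        rw [lintegral_lintegral_swap hm2]
        simp only [fun s u => rieszKernel_comm H s u]
        exact hbound _ hq2
    _ = _ := by
        rw [lintegral_const_mul'' _ (hp.pow_const 2), lintegral_const_mul'' _ (hq.pow_const 2),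
          mul_add]

/-- The energy of p enters with coefficient exactly 1. The cross terms are split with a free weight
ε, so if q tends to 0 in L² the excess can be removed by letting q → 0 and then ε → 0. This replaces
the triangle inequality for the |𝓗| norm. -/
theorem rieszEnergy_add_le (hH : 1 / 2 < H) {p q f : ℝ → ℝ≥0∞}
    (hp : AEMeasurable p (volume.restrict (Icc 0 T)))
    (hq : AEMeasurable q (volume.restrict (Icc 0 T)))
    (hf : ∀ s, f s ≤ p s + q s) {ε : ℝ≥0∞} (h0 : ε ≠ 0) (h1 : ε ≠ ∞) :
    rieszEnergy H T f f ≤ rieszEnergy H T p p + rieszBound H T *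
      (2 * (ε * ∫⁻ s in Icc 0 T, p s ^ 2) + 2 * ((ε⁻¹ + 1) * ∫⁻ s in Icc 0 T, q s ^ 2)) := by
  have hk := (measurable_rieszKernel H).aemeasurable (μ :=
    (volume.restrict (Icc 0 T)).prod (volume.restrict (Icc 0 T)))
  have hm : ∀ p q : ℝ → ℝ≥0∞, AEMeasurable p (volume.restrict (Icc 0 T)) →
      AEMeasurable q (volume.restrict (Icc 0 T)) →
      AEMeasurable (Function.uncurry fun s u => p s * q u * rieszKernel H s u)
      ((volume.restrict (Icc 0 T)).prod (volume.restrict (Icc 0 T))) := fun p q hp hq =>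
    (hp.comp_fst.mul hq.comp_snd).mul hk
  have hsplit : rieszEnergy H T (fun s => p s + q s) (fun s => p s + q s) =
      rieszEnergy H T p p + rieszEnergy H T p q + (rieszEnergy H T q p + rieszEnergy H T q q) := by
    unfold rieszEnergy
    rw [← lintegral_lintegral_add (hm _ _ hp hp) (hm _ _ hp hq),
      ← lintegral_lintegral_add (hm _ _ hq hp) (hm _ _ hq hq),
      ← lintegral_lintegral_add
        (F := fun s u => p s * p u * rieszKernel H s u + p s * q u * rieszKernel H s u)
        (G := fun s u => q s * p u * rieszKernel H s u + q s * q u * rieszKernel H s u)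
        ((hm _ _ hp hp).add (hm _ _ hp hq))
        ((hm _ _ hq hp).add (hm _ _ hq hq))]
    refine lintegral_congr fun s => lintegral_congr fun u => ?_
    ring
  have hcomm : rieszEnergy H T q p = rieszEnergy H T p q := by
    unfold rieszEnergy
    rw [lintegral_lintegral_swap (hm _ _ hq hp)]
    refine lintegral_congr fun s => lintegral_congr fun u => ?_
    rw [rieszKernel_comm, mul_comm (q u)]
  calc rieszEnergy H T f f ≤ rieszEnergy H T (fun s => p s + q s) (fun s => p s + q s) :=
        lintegral_mono fun s => lintegral_mono fun u => by gcongr <;> exact hf _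
    _ = rieszEnergy H T p p + (2 * rieszEnergy H T p q + rieszEnergy H T q q) := by
        rw [hsplit, hcomm]; ring
    _ ≤ _ := by
        gcongr
        have b1 := rieszEnergy_le hH hp hq h0 h1
        have b2 := rieszEnergy_le hH hq hq one_ne_zero ENNReal.one_ne_top
        rw [inv_one, one_mul] at b2
        calc _ ≤ 2 * (rieszBound H T *
                (ε * (∫⁻ s in Icc 0 T, p s ^ 2) + ε⁻¹ * ∫⁻ s in Icc 0 T, q s ^ 2)) +
              rieszBound H T * ((∫⁻ s in Icc 0 T, q s ^ 2) + ∫⁻ s in Icc 0 T, q s ^ 2) := by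
              gcongr
          _ = _ := by ring

variable {X : Type*} [NormedAddCommGroup X] [InnerProductSpace ℝ X]

theorem absHNormSq_eq (t : ℝ) (h : ℝ → X) : absHNormSq H t h =
    ENNReal.ofReal (H * (2 * H - 1)) * rieszEnergy H t (fun s => ‖h s‖ₑ) (fun s => ‖h s‖ₑ) := rfl

theorem absHNormSq_neg (t : ℝ) (h : ℝ → X) :
    absHNormSq H t (fun s => -h s) = absHNormSq H t h := by
  simp [absHNormSq]

theorem absHNormSq_sub_comm (t : ℝ) (f g : ℝ → X) :
    absHNormSq H t (fun s => f s - g s) = absHNormSq H t (fun s => g s - f s) := by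
  rw [← absHNormSq_neg]; simp

/-- Cutting off at t lets all integrals be constructed on the fixed interval [0, T], where those for
different t can be compared. -/
theorem absHNormSq_indicator {t : ℝ} (htT : t ≤ T) (h : ℝ → X) :
    absHNormSq H T ((Icc 0 t).indicator h) = absHNormSq H t h := by
  have key : ∀ F : ℝ → ℝ≥0∞, ∫⁻ s in Icc 0 T, (Icc 0 t).indicator F s = ∫⁻ s in Icc 0 t, F s := by
    intro F
    rw [setLIntegral_indicator measurableSet_Icc, inter_eq_left.2 (Icc_subset_Icc_right htT)]
  unfold absHNormSq
  congr 1
  rw [← key]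
  refine lintegral_congr fun s => ?_
  by_cases hs : s ∈ Icc 0 t
  · simp only [indicator_of_mem hs]
    rw [← key]
    refine lintegral_congr fun u => ?_
    by_cases hu : u ∈ Icc 0 t
    · simp only [indicator_of_mem hu]
    · simp only [indicator_of_notMem hu, enorm_zero, mul_zero, zero_mul]
  · simp only [indicator_of_notMem hs, enorm_zero, zero_mul, lintegral_zero]

/-- The constant comparing the norm of `|𝓗|` with that of `L²`. -/
def wienerConst (H T : ℝ) : ℝ≥0∞ := 1 + ENNReal.ofReal (H * (2 * H - 1)) * rieszBound H T * 2

theorem wienerConst_ne_top : wienerConst H T ≠ ∞ := by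
  unfold wienerConst rieszBound
  exact ENNReal.add_ne_top.2 ⟨by simp, ENNReal.mul_ne_top (ENNReal.mul_ne_top (by simp) (by simp))
    (by simp)⟩

theorem one_le_wienerConst : 1 ≤ wienerConst H T := le_self_add

/-- This is the energy estimate with ε = 1. The summand 1 in `wienerConst` makes the constant at
most its own square, so it can be moved inside the square. -/
theorem absHNormSq_le (hH : 1 / 2 < H) {h : ℝ → X}
    (hh : AEStronglyMeasurable h (volume.restrict (Icc 0 T))) :
    absHNormSq H T h ≤ (wienerConst H T * eLpNorm h 2 (volume.restrict (Icc 0 T))) ^ 2 := by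
  have b := rieszEnergy_le hH hh.enorm hh.enorm one_ne_zero ENNReal.one_ne_top
  rw [inv_one, one_mul, ← two_mul] at b
  rw [mul_pow, eLpNorm_two_sq, absHNormSq_eq]
  calc _ ≤ ENNReal.ofReal (H * (2 * H - 1)) *
        (rieszBound H T * (2 * ∫⁻ s in Icc 0 T, ‖h s‖ₑ ^ 2)) := by gcongr
    _ = ENNReal.ofReal (H * (2 * H - 1)) * rieszBound H T * 2 * ∫⁻ s in Icc 0 T, ‖h s‖ₑ ^ 2 := by
        ring
    _ ≤ wienerConst H T ^ 2 * ∫⁻ s in Icc 0 T, ‖h s‖ₑ ^ 2 := by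
        gcongr
        calc _ ≤ wienerConst H T := le_add_self
          _ ≤ _ := le_self_pow₀ one_le_wienerConst two_ne_zero

theorem absHNormSq_le_add (hH : 1 / 2 < H) {f g k : ℝ → X}
    (hg : AEStronglyMeasurable g (volume.restrict (Icc 0 T)))
    (hk : AEStronglyMeasurable k (volume.restrict (Icc 0 T)))
    (hf : ∀ s, f s = g s + k s) {ε : ℝ≥0∞} (h0 : ε ≠ 0) (h1 : ε ≠ ∞) :
    absHNormSq H T f ≤ absHNormSq H T g + wienerConst H T *
      (ε * eLpNorm g 2 (volume.restrict (Icc 0 T)) ^ 2 +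
        (ε⁻¹ + 1) * eLpNorm k 2 (volume.restrict (Icc 0 T)) ^ 2) := by
  have b := rieszEnergy_add_le hH hg.enorm hk.enorm (f := fun s => ‖f s‖ₑ)
    (fun s => by rw [hf]; exact enorm_add_le _ _) h0 h1
  rw [absHNormSq_eq, absHNormSq_eq, eLpNorm_two_sq, eLpNorm_two_sq]
  refine (mul_le_mul_right b _).trans ?_
  rw [mul_add]
  gcongr _ + ?_
  calc _ = ENNReal.ofReal (H * (2 * H - 1)) * rieszBound H T * 2 *
        (ε * (∫⁻ s in Icc 0 T, ‖g s‖ₑ ^ 2) + (ε⁻¹ + 1) * ∫⁻ s in Icc 0 T, ‖k s‖ₑ ^ 2) := by ring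
    _ ≤ _ := by
      gcongr
      exact le_add_self

/-! ### Density of step functions -/

/-- Summation by parts for the indicators of intervals starting at 0: at a point lying in the
intervals with index i ≥ j, the jumps add up to the single value f j. -/
theorem sum_ite_telescope {E : Type*} [AddCommGroup E] (f : ℕ → E) {j n : ℕ} (hj : j ≤ n) :
    f n + ∑ i ∈ Finset.range n, (if j ≤ i then f i - f (i + 1) else 0) = f j := by
  induction n with
  | zero => simp [Nat.le_zero.1 hj]
  | succ n ih =>
    rw [Finset.sum_range_succ]
    rcases Nat.lt_or_ge n j with h | h
    · have : j = n + 1 := by omega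
      subst this
      rw [if_neg (by omega), Finset.sum_eq_zero fun i hi => if_neg (by
        have := Finset.mem_range.1 hi; omega)]
      simp
    · rw [if_pos h]
      have := ih h
      rw [← this]; abel

theorem exists_stepFun_uniform {t : ℝ} (ht : 0 < t) {g : ℝ → X} (hg : ContinuousOn g (Icc 0 t))
    {ε : ℝ} (hε : 0 < ε) :
    ∃ c : Icc (0 : ℝ) t →₀ X, ∀ s ∈ Icc 0 t, ‖g s - stepFun c s‖ ≤ ε := by
  have huc := isCompact_Icc.uniformContinuousOn_of_continuous hg
  obtain ⟨δ, hδ, hgδ⟩ := Metric.uniformContinuousOn_iff.1 huc ε hε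
  obtain ⟨n, hn⟩ := exists_nat_gt (t / δ)
  have hn0 : 0 < n := by
    have : (0 : ℝ) < n := (by positivity : 0 < t / δ).trans hn
    exact_mod_cast this
  have hnr : (0 : ℝ) < n := by exact_mod_cast hn0
  have hx : ∀ i : ℕ, i ≤ n → t * i / n ∈ Icc 0 t := fun i hi => by
    have : (i : ℝ) ≤ n := by exact_mod_cast hi
    exact ⟨by positivity, by rw [div_le_iff₀ hnr]; gcongr⟩
  have hproj : ∀ i : ℕ, i ≤ n → ((projIcc 0 t ht.le (t * i / n) : Icc (0 : ℝ) t) : ℝ) = t * i / n :=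
    fun i hi => by rw [projIcc_of_mem ht.le (hx i hi)]
  set f : ℕ → X := fun i => g (t * i / n) with hf
  refine ⟨Finsupp.single (projIcc 0 t ht.le (t * n / n)) (f n) + ∑ i ∈ Finset.range n,
    Finsupp.single (projIcc 0 t ht.le (t * i / n)) (f i - f (i + 1)), fun s hs => ?_⟩
  have hadd : ∀ a : Icc (0 : ℝ) t, ∀ v w : X, (Icc (0 : ℝ) a).indicator (fun _ => v + w) s =
      (Icc (0 : ℝ) a).indicator (fun _ => v) s + (Icc (0 : ℝ) a).indicator (fun _ => w) s :=
    fun a v w => by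
      by_cases h : s ∈ Icc (0 : ℝ) a <;> simp only [h, indicator_of_mem, not_false_eq_true,
        indicator_of_notMem, add_zero]
  -- The intervals [0, t i / n] contain their right endpoints, so s lies in the i-th one exactly
  -- when i ≥ j. This dictates the ceiling rather than the floor.
  set j := ⌈s * n / t⌉₊ with hj
  have hjn : j ≤ n := by
    rw [hj, Nat.ceil_le, div_le_iff₀ ht, mul_comm]
    gcongr; exact hs.2
  have hstep : stepFun (Finsupp.single (projIcc 0 t ht.le (t * n / n)) (f n) +
      ∑ i ∈ Finset.range n, Finsupp.single (projIcc 0 t ht.le (t * i / n)) (f i - f (i + 1))) s =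
      f j := by
    rw [← sum_ite_telescope f hjn]
    unfold stepFun
    rw [Finsupp.sum_add_index' (by simp) hadd, Finsupp.sum_single_index (by simp),
      ← Finsupp.sum_finsetSum_index (by simp) hadd]
    congr 1
    · rw [indicator_of_mem]
      rw [hproj n le_rfl]
      exact ⟨hs.1, by rw [mul_div_assoc, div_self hnr.ne', mul_one]; exact hs.2⟩
    · refine Finset.sum_congr rfl fun i hi => ?_
      rw [Finsupp.sum_single_index (by simp), indicator_apply,
        hproj i (Finset.mem_range.1 hi).le]
      congr 1
      rw [hj, Nat.ceil_le, div_le_iff₀ ht, mem_Icc, le_div_iff₀ hnr, mul_comm t]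
      simp [hs.1]
  rw [hstep]
  have hd : dist s (t * j / n) < δ := by
    have h1 : s * n / t ≤ j := Nat.le_ceil _
    have h2 : (j : ℝ) < s * n / t + 1 := Nat.ceil_lt_add_one
      (div_nonneg (mul_nonneg hs.1 hnr.le) ht.le)
    rw [div_le_iff₀ ht] at h1
    have h3 : s ≤ t * j / n := by rw [le_div_iff₀ hnr]; linarith
    have h4 : t * j / n < s + t / n := by
      rw [div_lt_iff₀ hnr, add_mul, div_mul_cancel₀ _ hnr.ne']
      calc t * (j : ℝ) < t * (s * n / t + 1) := by gcongr
        _ = s * n + t := by field_simp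
    have h5 : t / n < δ := by
      rw [div_lt_iff₀ hnr]; rw [div_lt_iff₀ hδ] at hn; linarith
    rw [Real.dist_eq, abs_of_nonpos (by linarith)]
    linarith
  have := hgδ s hs _ (hx j hjn) hd
  rw [dist_eq_norm] at this
  exact this.le

/-- Bounded continuous functions are dense in L², and on a compact interval they are uniform limits
of step functions; η is chosen so that the uniform error costs at most ε/2 in L². -/
theorem exists_stepFun_eLpNorm_le {t : ℝ} {h : ℝ → X}
    (hh : MemLp h 2 (volume.restrict (Icc 0 t))) {ε : ℝ≥0∞} (hε : ε ≠ 0) :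
    ∃ c : Icc (0 : ℝ) t →₀ X,
      eLpNorm (fun s => h s - stepFun c s) 2 (volume.restrict (Icc 0 t)) ≤ ε := by
  rcases le_or_gt t 0 with ht | ht
  · have : (volume.restrict (Icc 0 t)) = 0 := by
      rw [Measure.restrict_eq_zero, Real.volume_Icc]; simpa using ht
    exact ⟨0, by simp [this]⟩
  have hε2 : ε / 2 ≠ 0 := (ENNReal.half_pos hε).ne'
  obtain ⟨g, hg1, hg2⟩ := hh.exists_boundedContinuous_eLpNorm_sub_le (by simp) hε2
  obtain ⟨η, hη0, hη⟩ : ∃ η : ℝ, 0 < η ∧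
      (volume.restrict (Icc 0 t)) univ ^ (2 : ℝ≥0∞).toReal⁻¹ * ENNReal.ofReal η ≤ ε / 2 := by
    have hfin : (volume.restrict (Icc 0 t)) univ ^ (2 : ℝ≥0∞).toReal⁻¹ ≠ ∞ := by
      refine ENNReal.rpow_ne_top_of_nonneg (by positivity) (by simp)
    have h1 : Tendsto (fun η : ℝ => (volume.restrict (Icc 0 t)) univ ^ (2 : ℝ≥0∞).toReal⁻¹ *
        ENNReal.ofReal η) (𝓝 0) (𝓝 0) := by
      have h2 : Tendsto ENNReal.ofReal (𝓝 0) (𝓝 0) := by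
        simpa using ENNReal.continuous_ofReal.tendsto 0
      simpa using ENNReal.Tendsto.const_mul h2 (Or.inr hfin)
    have h3 := (h1.mono_left (nhdsWithin_le_nhds (s := Ioi 0))).eventually
      (ge_mem_nhds (pos_iff_ne_zero.2 hε2))
    obtain ⟨η, h4, h5⟩ := (h3.and self_mem_nhdsWithin).exists
    exact ⟨η, h5, h4⟩
  obtain ⟨c, hc⟩ := exists_stepFun_uniform ht g.continuous.continuousOn hη0
  refine ⟨c, ?_⟩
  have e : (fun s => h s - stepFun c s) = (h - g) + fun s => g s - stepFun c s := by
    ext s; simp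
  rw [e]
  refine (eLpNorm_add_le (hh.1.sub hg2.1) (hg2.1.sub (stronglyMeasurable_stepFun c).aestronglyMeasurable)
    (by norm_num)).trans ?_
  rw [← ENNReal.add_halves ε]
  refine add_le_add hg1 ((eLpNorm_le_of_ae_bound ?_).trans hη)
  exact (ae_restrict_mem measurableSet_Icc).mono fun s hs => hc s hs

end

/-! ### Extension of the Wiener integral from step functions -/

section

theorem ENNReal.le_of_sq_le_sq {x y : ℝ≥0∞} (h : x ^ 2 ≤ y ^ 2) : x ≤ y := by
  have := ENNReal.rpow_le_rpow h (by norm_num : (0 : ℝ) ≤ 1 / 2)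
  rw [← ENNReal.rpow_natCast, ← ENNReal.rpow_natCast, ← ENNReal.rpow_mul, ← ENNReal.rpow_mul] at this
  simpa using this

theorem ENNReal.tendsto_zero_of_sq {ι : Type*} {l : Filter ι} {u : ι → ℝ≥0∞}
    (h : Tendsto (fun k => u k ^ 2) l (𝓝 0)) : Tendsto u l (𝓝 0) := by
  have h4 := ((ENNReal.continuous_rpow_const (y := 1 / 2)).tendsto 0).comp h
  rw [ENNReal.zero_rpow_of_pos (by norm_num)] at h4
  refine h4.congr fun k => ?_
  rw [Function.comp_apply, ← ENNReal.rpow_natCast, ← ENNReal.rpow_mul]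
  norm_num

theorem ENNReal.tendsto_sq_zero {ι : Type*} {l : Filter ι} {u : ι → ℝ≥0∞}
    (h : Tendsto u l (𝓝 0)) : Tendsto (fun k => u k ^ 2) l (𝓝 0) := by
  have h2 := ((ENNReal.continuous_pow 2).tendsto 0).comp h
  rw [zero_pow two_ne_zero] at h2
  exact h2

variable {Ω : Type*} [MeasurableSpace Ω] {P : Measure Ω} {H T : ℝ}
  {X : Type*} [NormedAddCommGroup X] [InnerProductSpace ℝ X]

/-- `I` is the value at `h` of the extension by continuity of `stepIntegral β`, as expressed by
the estimate `‖∫ c dβ - I‖ ≤ ‖h - c‖` for all step functions `c` on `[0, T]`. -/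
def IsWienerExtension (P : Measure Ω) (H T : ℝ) (β : ℝ → Ω → ℝ) (h : ℝ → X) (I : Lp X 2 P) : Prop :=
  ∀ c : Icc (0 : ℝ) T →₀ X, eLpNorm (fun ω => stepIntegral β c ω - I ω) 2 P ^ 2 ≤
    absHNormSq H T (fun s => h s - stepFun c s)

variable {β : ℝ → Ω → ℝ}

/-- The integral of a step function as an element of `L²`. -/
def IsFBM.stepLp (hβ : IsFBM P H T β) (c : Icc (0 : ℝ) T →₀ X) : Lp X 2 P :=
  (hβ.memLp_stepIntegral c).toLp _

theorem IsFBM.edist_stepLp (hβ : IsFBM P H T β) (c : Icc (0 : ℝ) T →₀ X) (I : Lp X 2 P) :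
    edist (hβ.stepLp c) I = eLpNorm (fun ω => stepIntegral β c ω - I ω) 2 P := by
  rw [Lp.edist_def]
  refine eLpNorm_congr_ae ?_
  filter_upwards [(hβ.memLp_stepIntegral c).coeFn_toLp] with ω hω
  simp only [Pi.sub_apply]
  rw [← hω]; rfl

theorem IsFBM.edist_stepLp_stepLp_sq_le (hH : 1 / 2 < H) (hβ : IsFBM P H T β)
    (c d : Icc (0 : ℝ) T →₀ X) :
    edist (hβ.stepLp c) (hβ.stepLp d) ^ 2 ≤
      absHNormSq H T (fun s => stepFun d s - stepFun c s) := by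
  have e1 : edist (hβ.stepLp c) (hβ.stepLp d) = eLpNorm (stepIntegral β (c - d)) 2 P := by
    unfold IsFBM.stepLp
    rw [Lp.edist_toLp_toLp]
    congr 1
    ext ω
    rw [stepIntegral_sub]; rfl
  rw [e1, absHNormSq_sub_comm]
  have := hβ.eLpNorm_stepIntegral_sq_le hH (c - d)
  have e2 : stepFun (c - d) = fun s => stepFun c s - stepFun d s := by
    ext s; exact stepFun_sub c d s
  rwa [e2] at this

theorem aestronglyMeasurable_sub_stepFun {h : ℝ → X} {t : ℝ}
    (hh : AEStronglyMeasurable h (volume.restrict (Icc 0 T))) (c : Icc (0 : ℝ) t →₀ X) :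
    AEStronglyMeasurable (fun s => h s - stepFun c s) (volume.restrict (Icc 0 T)) :=
  hh.sub (stronglyMeasurable_stepFun c).aestronglyMeasurable

theorem IsWienerExtension.edist_le (hH : 1 / 2 < H) (hβ : IsFBM P H T β) {h : ℝ → X}
    {I : Lp X 2 P} (hI : IsWienerExtension P H T β h I)
    (hh : AEStronglyMeasurable h (volume.restrict (Icc 0 T))) (c : Icc (0 : ℝ) T →₀ X) :
    edist (hβ.stepLp c) I ≤
      wienerConst H T * eLpNorm (fun s => h s - stepFun c s) 2 (volume.restrict (Icc 0 T)) := by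
  rw [hβ.edist_stepLp]
  exact ENNReal.le_of_sq_le_sq ((hI c).trans
    (absHNormSq_le hH (aestronglyMeasurable_sub_stepFun hh c)))

theorem exists_stepFun_seq {t : ℝ} {h : ℝ → X} (hh : MemLp h 2 (volume.restrict (Icc 0 t))) :
    ∃ c : ℕ → Icc (0 : ℝ) t →₀ X, ∀ k,
      eLpNorm (fun s => h s - stepFun (c k) s) 2 (volume.restrict (Icc 0 t)) ≤ (1 / 2) ^ k := by
  choose c hc using fun k : ℕ =>
    exists_stepFun_eLpNorm_le hh (ε := (1 / 2) ^ k) (pow_ne_zero _ (by simp))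
  exact ⟨c, hc⟩

theorem ENNReal.tendsto_half_pow : Tendsto (fun k : ℕ => (1 / 2 : ℝ≥0∞) ^ k) atTop (𝓝 0) :=
  ENNReal.tendsto_pow_atTop_nhds_zero_of_lt_one (by simp)

theorem IsWienerExtension.tendsto_stepLp (hH : 1 / 2 < H) (hβ : IsFBM P H T β) {h : ℝ → X}
    {I : Lp X 2 P} (hI : IsWienerExtension P H T β h I)
    (hh : AEStronglyMeasurable h (volume.restrict (Icc 0 T))) {c : ℕ → Icc (0 : ℝ) T →₀ X}
    (hc : ∀ k, eLpNorm (fun s => h s - stepFun (c k) s) 2 (volume.restrict (Icc 0 T)) ≤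
      (1 / 2) ^ k) :
    Tendsto (fun k => hβ.stepLp (c k)) atTop (𝓝 I) := by
  rw [tendsto_iff_edist_tendsto_0]
  have h1 := ENNReal.Tendsto.const_mul ENNReal.tendsto_half_pow
    (Or.inr (wienerConst_ne_top (H := H) (T := T)))
  rw [mul_zero] at h1
  refine tendsto_of_tendsto_of_tendsto_of_le_of_le tendsto_const_nhds h1 (fun _ => zero_le)
    fun k => (hI.edist_le hH hβ hh (c k)).trans ?_
  gcongr
  exact hc k

/-- The extension is Lipschitz from `L²([0, T]; X)` to `L²(Ω; X)`. -/
theorem IsWienerExtension.edist_edist_le (hH : 1 / 2 < H) (hβ : IsFBM P H T β) {h h' : ℝ → X}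
    {I I' : Lp X 2 P} (hI : IsWienerExtension P H T β h I) (hI' : IsWienerExtension P H T β h' I')
    (hh : MemLp h 2 (volume.restrict (Icc 0 T))) (hh' : MemLp h' 2 (volume.restrict (Icc 0 T))) :
    edist I I' ≤
      wienerConst H T * eLpNorm (fun s => h s - h' s) 2 (volume.restrict (Icc 0 T)) := by
  obtain ⟨c, hc⟩ := exists_stepFun_seq hh
  set n := eLpNorm (fun s => h s - h' s) 2 (volume.restrict (Icc 0 T))
  have hbound : ∀ k, edist I I' ≤ wienerConst H T * (1 / 2) ^ k +
      wienerConst H T * (n + (1 / 2) ^ k) := by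
    intro k
    refine (edist_triangle_left I I' (hβ.stepLp (c k))).trans (add_le_add ?_ ?_)
    · refine (hI.edist_le hH hβ hh.1 (c k)).trans ?_
      gcongr
      exact hc k
    · refine (hI'.edist_le hH hβ hh'.1 (c k)).trans ?_
      gcongr
      have e : (fun s => h' s - stepFun (c k) s) =
          (fun s => h' s - h s) + fun s => h s - stepFun (c k) s := by
        ext s; simp
      rw [e]
      refine (eLpNorm_add_le (hh'.1.sub hh.1) (aestronglyMeasurable_sub_stepFun hh.1 _)
        (by norm_num)).trans (add_le_add ?_ (hc k))
      exact (eLpNorm_sub_comm h' h 2 _).le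
  have hlim : Tendsto (fun k : ℕ => wienerConst H T * (1 / 2) ^ k +
      wienerConst H T * (n + (1 / 2) ^ k)) atTop
      (𝓝 (wienerConst H T * 0 + wienerConst H T * (n + 0))) :=
    (ENNReal.Tendsto.const_mul ENNReal.tendsto_half_pow (Or.inr wienerConst_ne_top)).add
      (ENNReal.Tendsto.const_mul (tendsto_const_nhds.add ENNReal.tendsto_half_pow)
        (Or.inr wienerConst_ne_top))
  simpa using ge_of_tendsto' hlim hbound

/-- L² approximation by step functions d_k gives a Cauchy sequence of integrals, with limit I. The
defining bound must hold in |𝓗| with constant 1, which L² estimates alone do not give. It follows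
from ‖∫ c - ∫ d_k‖² ≤ ‖d_k - c‖²_{|𝓗|} and the perturbation estimate `absHNormSq_le_add` around h -
c. -/
theorem IsFBM.exists_wienerExtension [CompleteSpace X] (hH : 1 / 2 < H) (hβ : IsFBM P H T β)
    {h : ℝ → X} (hh : MemLp h 2 (volume.restrict (Icc 0 T))) :
    ∃ I : Lp X 2 P, IsWienerExtension P H T β h I := by
  obtain ⟨d, hd⟩ := exists_stepFun_seq hh
  have hcauchy : CauchySeq fun k => hβ.stepLp (d k) := by
    refine cauchySeq_of_edist_le_geometric (1 / 2) (wienerConst H T * 2)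
      (by simp)
      (ENNReal.mul_ne_top wienerConst_ne_top (by simp)) fun k => ?_
    have h1 := (hβ.edist_stepLp_stepLp_sq_le hH (d k) (d (k + 1))).trans (absHNormSq_le hH
      ((stronglyMeasurable_stepFun (d (k + 1))).aestronglyMeasurable.sub
        (stronglyMeasurable_stepFun (d k)).aestronglyMeasurable))
    refine (ENNReal.le_of_sq_le_sq h1).trans ?_
    rw [mul_assoc]
    gcongr
    have e : (fun s => stepFun (d (k + 1)) s - stepFun (d k) s) =
        (fun s => h s - stepFun (d k) s) - fun s => h s - stepFun (d (k + 1)) s := by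
      ext s; simp
    rw [e, two_mul]
    refine (eLpNorm_sub_le (aestronglyMeasurable_sub_stepFun hh.1 _)
      (aestronglyMeasurable_sub_stepFun hh.1 _) (by norm_num)).trans
      (add_le_add (hd k) ((hd (k + 1)).trans ?_))
    exact pow_le_pow_right_of_le_one' (by simp) (Nat.le_succ k)
  obtain ⟨I, hI⟩ := cauchySeq_tendsto_of_complete hcauchy
  refine ⟨I, fun c => ?_⟩
  rw [← hβ.edist_stepLp]
  set N := absHNormSq H T (fun s => h s - stepFun c s)
  set n := eLpNorm (fun s => h s - stepFun c s) 2 (volume.restrict (Icc 0 T)) with hn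
  have hnfin : n ≠ ∞ := (hh.sub (memLp_stepFun c T)).2.ne
  -- The limit in k is taken at fixed ε; the remaining error is a multiple of ε, removed below by
  -- taking ε = 1/j.
  have hbound : ∀ ε : ℝ≥0∞, ε ≠ 0 → ε ≠ ∞ →
      edist (hβ.stepLp c) I ^ 2 ≤ N + wienerConst H T * (ε * n ^ 2) := by
    intro ε h0 h1
    have hl : Tendsto (fun k => edist (hβ.stepLp c) (hβ.stepLp (d k)) ^ 2) atTop
        (𝓝 (edist (hβ.stepLp c) I ^ 2)) :=
      ((ENNReal.continuous_pow 2).tendsto _).comp (tendsto_const_nhds.edist hI)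
    have hsq : Tendsto (fun k : ℕ => ((1 / 2 : ℝ≥0∞) ^ k) ^ 2) atTop (𝓝 0) :=
      ENNReal.tendsto_sq_zero ENNReal.tendsto_half_pow
    have hr : Tendsto (fun k : ℕ => N + wienerConst H T * (ε * n ^ 2 +
        (ε⁻¹ + 1) * ((1 / 2) ^ k) ^ 2)) atTop
        (𝓝 (N + wienerConst H T * (ε * n ^ 2 + (ε⁻¹ + 1) * 0))) :=
      tendsto_const_nhds.add (ENNReal.Tendsto.const_mul (tendsto_const_nhds.add
        (ENNReal.Tendsto.const_mul hsq (Or.inr (by simp [h0])))) (Or.inr wienerConst_ne_top))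
    rw [mul_zero, add_zero] at hr
    refine le_of_tendsto_of_tendsto' hl hr fun k => ?_
    refine (hβ.edist_stepLp_stepLp_sq_le hH c (d k)).trans ?_
    have hdk : eLpNorm (fun s => stepFun (d k) s - h s) 2 (volume.restrict (Icc 0 T)) ≤
        (1 / 2) ^ k := (eLpNorm_sub_comm _ _ _ _).le.trans (hd k)
    refine (absHNormSq_le_add hH (k := fun s => stepFun (d k) s - h s)
      (aestronglyMeasurable_sub_stepFun hh.1 c)
      ((stronglyMeasurable_stepFun (d k)).aestronglyMeasurable.sub hh.1)
      (fun s => by abel) h0 h1).trans ?_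
    gcongr
  have hε := ENNReal.tendsto_inv_nat_nhds_zero
  have hlim : Tendsto (fun j : ℕ => N + wienerConst H T * ((j : ℝ≥0∞)⁻¹ * n ^ 2)) atTop
      (𝓝 (N + wienerConst H T * (0 * n ^ 2))) :=
    tendsto_const_nhds.add (ENNReal.Tendsto.const_mul
      (ENNReal.Tendsto.mul_const hε (Or.inr (ENNReal.pow_ne_top hnfin)))
      (Or.inr wienerConst_ne_top))
  rw [zero_mul, mul_zero, add_zero] at hlim
  refine ge_of_tendsto hlim ?_
  filter_upwards [eventually_ge_atTop 1] with j hj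
  exact hbound _ (by simp) (by simp; omega)

/-- A Wiener integral may be witnessed by steps that converge only in |𝓗|, not in L². The bound
defining the extension is stated in that same norm, so the step integrals also converge to I, and
limits are unique. -/
theorem IsWienerExtension.eq_of_isWienerIntegral (hβ : IsFBM P H T β)
    {t : ℝ} (htT : t ≤ T) {h : ℝ → X} {I I' : Lp X 2 P}
    (hI : IsWienerExtension P H T β ((Icc 0 t).indicator h) I)
    (hI' : IsWienerIntegral P H β t h I') : I' = I := by
  obtain ⟨-, c, hc1, hc2⟩ := hI'
  have h1 : Tendsto (fun k => hβ.stepLp (extendStep htT (c k))) atTop (𝓝 I') := by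
    rw [tendsto_iff_edist_tendsto_0]
    simpa only [hβ.edist_stepLp, stepIntegral_extendStep] using hc2
  have h2 : Tendsto (fun k => hβ.stepLp (extendStep htT (c k))) atTop (𝓝 I) := by
    rw [tendsto_iff_edist_tendsto_0]
    have h3 : Tendsto (fun k => edist (hβ.stepLp (extendStep htT (c k))) I ^ 2) atTop (𝓝 0) := by
      refine tendsto_of_tendsto_of_tendsto_of_le_of_le tendsto_const_nhds hc1
        (fun _ => zero_le) fun k => ?_
      simp only
      rw [hβ.edist_stepLp]
      refine (hI _).trans (le_of_eq ?_)
      rw [← absHNormSq_indicator htT, stepFun_extendStep]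
      congr 1
      ext s
      by_cases hs : s ∈ Icc 0 t
      · simp only [indicator_of_mem hs]
      · simp only [indicator_of_notMem hs, stepFun_of_notMem _ hs, sub_zero]
    exact ENNReal.tendsto_zero_of_sq h3
  exact tendsto_nhds_unique h1 h2

theorem memLp_indicator_Icc {t : ℝ} (htT : t ≤ T) {h : ℝ → X} :
    MemLp ((Icc 0 t).indicator h) 2 (volume.restrict (Icc 0 T)) ↔
      MemLp h 2 (volume.restrict (Icc 0 t)) := by
  rw [memLp_indicator_iff_restrict measurableSet_Icc, Measure.restrict_restrict measurableSet_Icc,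
    inter_eq_left.2 (Icc_subset_Icc_right htT)]

theorem IsWienerExtension.isWienerIntegral (hH : 1 / 2 < H) {t : ℝ} (htT : t ≤ T)
    {h : ℝ → X} (hh : MemLp h 2 (volume.restrict (Icc 0 t))) {I : Lp X 2 P}
    (hI : IsWienerExtension P H T β ((Icc 0 t).indicator h) I) :
    IsWienerIntegral P H β t h I := by
  obtain ⟨c, hc⟩ := exists_stepFun_seq hh
  have h1 : Tendsto (fun k : ℕ => (wienerConst H t * (1 / 2) ^ k) ^ 2) atTop (𝓝 0) := by
    have h2 := ENNReal.Tendsto.const_mul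
      ENNReal.tendsto_half_pow (Or.inr (wienerConst_ne_top (H := H) (T := t)))
    rw [mul_zero] at h2
    exact ENNReal.tendsto_sq_zero h2
  have h2 : Tendsto (fun k => absHNormSq H t (fun s => h s - stepFun (c k) s)) atTop (𝓝 0) := by
    refine tendsto_of_tendsto_of_tendsto_of_le_of_le tendsto_const_nhds h1
      (fun _ => zero_le) fun k => ?_
    refine (absHNormSq_le hH (aestronglyMeasurable_sub_stepFun hh.1 (c k))).trans ?_
    gcongr
    exact hc k
  refine ⟨hh.1, c, h2, ?_⟩
  have h3 : Tendsto (fun k => eLpNorm (fun ω => stepIntegral β (c k) ω - I ω) 2 P ^ 2) atTop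
      (𝓝 0) := by
    refine tendsto_of_tendsto_of_tendsto_of_le_of_le tendsto_const_nhds h2
      (fun _ => zero_le) fun k => ?_
    have := hI (extendStep htT (c k))
    rw [stepIntegral_extendStep] at this
    refine this.trans (le_of_eq ?_)
    rw [← absHNormSq_indicator htT, stepFun_extendStep]
    congr 1
    ext s
    by_cases hs : s ∈ Icc 0 t
    · simp only [indicator_of_mem hs]
    · simp only [indicator_of_notMem hs, stepFun_of_notMem _ hs, sub_zero]
  exact ENNReal.tendsto_zero_of_sq h3

/-! ### Orthogonality of integrals with respect to independent noises -/

/-- The inner product is a finite combination of the expectations of β(a) β'(b), and these vanish by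
independence and centering. -/
theorem inner_stepLp_eq_zero {β' : ℝ → Ω → ℝ} (hβ : IsFBM P H T β) (hβ' : IsFBM P H T β')
    (hind : ∀ s t : Icc (0 : ℝ) T, IndepFun (β s) (β' t) P) (c c' : Icc (0 : ℝ) T →₀ X) :
    inner ℝ (hβ.stepLp c) (hβ'.stepLp c') = 0 := by
  rw [L2.inner_def]
  have e1 : ∫ ω, inner ℝ ((hβ.stepLp c : Lp X 2 P) ω) ((hβ'.stepLp c' : Lp X 2 P) ω) ∂P =
      ∫ ω, ∑ a ∈ c.support, ∑ b ∈ c'.support, inner ℝ (c a) (c' b) * (β a ω * β' b ω) ∂P := by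
    refine integral_congr_ae ?_
    filter_upwards [(hβ.memLp_stepIntegral c).coeFn_toLp, (hβ'.memLp_stepIntegral c').coeFn_toLp]
      with ω h1 h2
    unfold IsFBM.stepLp
    rw [h1, h2]
    unfold stepIntegral Finsupp.sum
    rw [sum_inner]
    refine Finset.sum_congr rfl fun a _ => ?_
    rw [inner_sum]
    refine Finset.sum_congr rfl fun b _ => ?_
    rw [real_inner_smul_left, real_inner_smul_right]
    ring
  have hint : ∀ a b : Icc (0 : ℝ) T,
      Integrable (fun ω => inner ℝ (c a) (c' b) * (β a ω * β' b ω)) P :=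
    fun a b => ((hβ.memLp a.2).integrable_mul (hβ'.memLp b.2)).const_mul _
  rw [e1, integral_finsetSum _ fun a _ => integrable_finsetSum _ fun b _ => hint a b]
  refine Finset.sum_eq_zero fun a _ => ?_
  rw [integral_finsetSum _ fun b _ => hint a b]
  refine Finset.sum_eq_zero fun b _ => ?_
  have h3 := (hind a b).integral_mul_eq_mul_integral
    (hβ.measurable a a.2).aestronglyMeasurable (hβ'.measurable b b.2).aestronglyMeasurable
  simp only [Pi.mul_apply] at h3
  rw [integral_const_mul, h3, hβ.centered a a.2, zero_mul, mul_zero]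

theorem IsWienerExtension.inner_eq_zero (hH : 1 / 2 < H) {β' : ℝ → Ω → ℝ}
    (hβ : IsFBM P H T β) (hβ' : IsFBM P H T β')
    (hind : ∀ s t : Icc (0 : ℝ) T, IndepFun (β s) (β' t) P) {h h' : ℝ → X} {I I' : Lp X 2 P}
    (hI : IsWienerExtension P H T β h I) (hI' : IsWienerExtension P H T β' h' I')
    (hh : MemLp h 2 (volume.restrict (Icc 0 T))) (hh' : MemLp h' 2 (volume.restrict (Icc 0 T))) :
    inner ℝ I I' = 0 := by
  obtain ⟨c, hc⟩ := exists_stepFun_seq hh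
  obtain ⟨c', hc'⟩ := exists_stepFun_seq hh'
  have h1 := (hI.tendsto_stepLp hH hβ hh.1 hc).inner (𝕜 := ℝ)
    (hI'.tendsto_stepLp hH hβ' hh'.1 hc')
  refine tendsto_nhds_unique h1 ?_
  simp only [inner_stepLp_eq_zero hβ hβ' hind]
  exact tendsto_const_nhds

end

/-! ### Orthogonal series and the stochastic convolution -/

section

/-! ### Auxiliary convergence lemmas -/

/-- Dominated convergence for the counting measure; with the discrete σ-algebra measurability is
automatic. -/
theorem ENNReal.tendsto_tsum_zero_of_dominated {ι κ : Type*} {l : Filter κ} [l.IsCountablyGenerated]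
    {f : κ → ι → ℝ≥0∞} {b : ι → ℝ≥0∞} (hb : ∑' n, b n ≠ ∞) (hfb : ∀ᶠ k in l, ∀ n, f k n ≤ b n)
    (hf : ∀ n, Tendsto (fun k => f k n) l (𝓝 0)) : Tendsto (fun k => ∑' n, f k n) l (𝓝 0) := by
  let _ : MeasurableSpace ι := ⊤
  have h1 := tendsto_lintegral_filter_of_dominated_convergence (μ := Measure.count) (l := l)
    (F := f) (f := fun _ => 0) b (Eventually.of_forall fun k => measurable_from_top)
    (hfb.mono fun k hk => Eventually.of_forall hk) (by rwa [lintegral_count])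
    (Eventually.of_forall hf)
  simpa only [lintegral_count, tsum_zero] using h1

theorem tendsto_eLpNorm_two_of_dominated {α κ E : Type*} [MeasurableSpace α]
    [NormedAddCommGroup E] {μ : Measure α} {l : Filter κ} [l.IsCountablyGenerated]
    {F : κ → α → E} {f : α → E} (b : α → ℝ≥0∞) (hb : ∫⁻ a, b a ^ 2 ∂μ ≠ ∞)
    (hF : ∀ᶠ k in l, AEStronglyMeasurable (F k) μ) (hf : AEStronglyMeasurable f μ)
    (hbound : ∀ᶠ k in l, ∀ᵐ a ∂μ, ‖F k a - f a‖ₑ ≤ b a)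
    (hlim : ∀ᵐ a ∂μ, Tendsto (fun k => F k a) l (𝓝 (f a))) :
    Tendsto (fun k => eLpNorm (fun a => F k a - f a) 2 μ) l (𝓝 0) := by
  refine ENNReal.tendsto_zero_of_sq ?_
  simp only [eLpNorm_two_sq]
  have h1 := tendsto_lintegral_filter_of_dominated_convergence' (μ := μ) (l := l)
    (F := fun k a => ‖F k a - f a‖ₑ ^ 2) (f := fun _ => 0) (fun a => b a ^ 2)
    (hF.mono fun k hk => ((hk.sub hf).enorm.pow_const 2))
    (hbound.mono fun k hk => hk.mono fun a ha => by gcongr) hb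
    (hlim.mono fun a ha => by
      refine ENNReal.tendsto_sq_zero ?_
      have := tendsto_iff_edist_tendsto_0.1 ha
      simpa only [edist_eq_enorm_sub] using this)
  simpa using h1

/-- Strong continuity becomes joint continuity because the operators are equibounded. Joint
continuity gives measurability of s ↦ V(t - s) p(s) for measurable p. -/
theorem continuous_uncurry_clm {E F : Type*} [NormedAddCommGroup E] [NormedSpace ℝ E]
    [NormedAddCommGroup F] [NormedSpace ℝ F] {V : ℝ → E →L[ℝ] F} {M : ℝ}
    (hM : ∀ τ, ‖V τ‖ ≤ M) (hV : ∀ x, Continuous fun τ => V τ x) :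
    Continuous fun p : ℝ × E => V p.1 p.2 := by
  rw [continuous_iff_continuousAt]
  rintro ⟨τ₀, x₀⟩
  rw [ContinuousAt, tendsto_iff_norm_sub_tendsto_zero]
  have h1 : Tendsto (fun p : ℝ × E => M * ‖p.2 - x₀‖ + ‖V p.1 x₀ - V τ₀ x₀‖) (𝓝 (τ₀, x₀))
      (𝓝 (M * ‖x₀ - x₀‖ + ‖V τ₀ x₀ - V τ₀ x₀‖)) := by
    have h2 := hV x₀
    have h3 : Continuous fun p : ℝ × E => M * ‖p.2 - x₀‖ + ‖V p.1 x₀ - V τ₀ x₀‖ := by fun_prop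
    exact h3.tendsto (τ₀, x₀)
  simp only [sub_self, norm_zero, mul_zero, add_zero] at h1
  refine squeeze_zero (fun _ => norm_nonneg _) (fun p => ?_) h1
  have e : V p.1 p.2 - V τ₀ x₀ = V p.1 (p.2 - x₀) + (V p.1 x₀ - V τ₀ x₀) := by
    rw [map_sub]; abel
  rw [e]
  refine (norm_add_le _ _).trans (add_le_add ?_ le_rfl)
  exact ((V p.1).le_opNorm _).trans (by gcongr; exact hM _)

/-! ### Orthogonal series -/

section Orthogonal

variable {ι E : Type*} [NormedAddCommGroup E] [InnerProductSpace ℝ E] {v : ι → E}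

/-- Passing to the lines spanned by the vectors lets `OrthogonalFamily` handle vectors of arbitrary
length, zero included. -/
theorem orthogonalFamily_span_singleton (hv : ∀ i j, i ≠ j → inner ℝ (v i) (v j) = 0) :
    OrthogonalFamily ℝ (fun i => (ℝ ∙ v i : Submodule ℝ E)) fun i => (ℝ ∙ v i).subtypeₗᵢ := by
  intro i j hij x y
  obtain ⟨a, ha⟩ := Submodule.mem_span_singleton.1 x.2
  obtain ⟨b, hb⟩ := Submodule.mem_span_singleton.1 y.2
  change inner ℝ (x : E) (y : E) = 0
  rw [← ha, ← hb, real_inner_smul_left, real_inner_smul_right, hv i j hij, mul_zero, mul_zero]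

theorem summable_of_orthogonal [CompleteSpace E] (hv : ∀ i j, i ≠ j → inner ℝ (v i) (v j) = 0)
    (hs : Summable fun i => ‖v i‖ ^ 2) : Summable v :=
  ((orthogonalFamily_span_singleton hv).summable_iff_norm_sq_summable
    fun i => ⟨v i, Submodule.mem_span_singleton_self _⟩).2 hs

theorem enorm_sq_le_tsum_of_orthogonal (hv : ∀ i j, i ≠ j → inner ℝ (v i) (v j) = 0) {J : E}
    (hJ : HasSum v J) : ‖J‖ₑ ^ 2 ≤ ∑' i, ‖v i‖ₑ ^ 2 := by
  have h1 : Tendsto (fun s : Finset ι => ‖∑ i ∈ s, v i‖ₑ ^ 2) atTop (𝓝 (‖J‖ₑ ^ 2)) :=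
    ((ENNReal.continuous_pow 2).tendsto _).comp (hJ.enorm)
  refine le_of_tendsto' h1 fun s => ?_
  have h2 : ‖∑ i ∈ s, v i‖ ^ 2 = ∑ i ∈ s, ‖v i‖ ^ 2 :=
    (orthogonalFamily_span_singleton hv).norm_sum
      (fun i => ⟨v i, Submodule.mem_span_singleton_self _⟩) s
  have h3 : ‖∑ i ∈ s, v i‖ₑ ^ 2 = ∑ i ∈ s, ‖v i‖ₑ ^ 2 := by
    rw [← ofReal_norm, ← ENNReal.ofReal_pow (norm_nonneg _), h2,
      ENNReal.ofReal_sum_of_nonneg fun i _ => by positivity]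
    refine Finset.sum_congr rfl fun i _ => ?_
    rw [ENNReal.ofReal_pow (norm_nonneg _), ofReal_norm]
  rw [h3]
  exact ENNReal.sum_le_tsum s

end Orthogonal

/-! ### Integrals with respect to the `Q`-fractional Brownian motion -/

variable {Ω : Type*} [MeasurableSpace Ω] {P : Measure Ω} {H T : ℝ}
  {X : Type*} [NormedAddCommGroup X] [InnerProductSpace ℝ X]
  {ι Y : Type*} [NormedAddCommGroup Y] [InnerProductSpace ℝ Y]

theorem IsWienerExtension.zero {β : ℝ → Ω → ℝ} (hH : 1 / 2 < H) (hβ : IsFBM P H T β) :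
    IsWienerExtension P H T β (fun _ => (0 : X)) 0 := by
  intro c
  have h1 := hβ.eLpNorm_stepIntegral_sq_le hH c
  simp only [zero_sub]
  rw [absHNormSq_neg]
  refine le_trans (le_of_eq ?_) h1
  congr 1
  refine eLpNorm_congr_ae ?_
  filter_upwards [Lp.coeFn_zero X 2 P] with ω hω
  rw [hω]; simp

namespace QFBM

variable (W : QFBM P H T ι Y)

theorem indepFun {n m : ι} (hnm : n ≠ m) (s t : Icc (0 : ℝ) T) :
    IndepFun (W.β n s) (W.β m t) P :=
  (W.indep.indepFun hnm).comp (measurable_pi_apply s) (measurable_pi_apply t)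

/-- Independence makes the component integrals pairwise orthogonal in L²(Ω; X), so summability of
the squared L² norms of the integrands suffices, although the norms themselves need not be summable.
-/
theorem exists_wienerExtension_hasSum [CompleteSpace X] (hH : 1 / 2 < H) {h : ι → ℝ → X}
    (hh : ∀ n, MemLp (h n) 2 (volume.restrict (Icc 0 T)))
    (hs : ∑' n, eLpNorm (h n) 2 (volume.restrict (Icc 0 T)) ^ 2 ≠ ∞) :
    ∃ (I : ι → Lp X 2 P) (J : Lp X 2 P),
      (∀ n, IsWienerExtension P H T (W.β n) (h n) (I n)) ∧ HasSum I J := by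
  choose I hI using fun n => (W.isFBM n).exists_wienerExtension hH (hh n)
  have horth : ∀ n m, n ≠ m → inner ℝ (I n) (I m) = 0 := fun n m hnm =>
    (hI n).inner_eq_zero hH (W.isFBM n) (W.isFBM m) (W.indepFun hnm) (hI m) (hh n) (hh m)
  have hbound : ∀ n, ‖I n‖ₑ ^ 2 ≤
      wienerConst H T ^ 2 * eLpNorm (h n) 2 (volume.restrict (Icc 0 T)) ^ 2 := fun n => by
    have := (hI n).edist_edist_le hH (W.isFBM n) (IsWienerExtension.zero hH (W.isFBM n)) (hh n)
      MemLp.zero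
    simp only [edist_zero_right, sub_zero] at this
    rw [← mul_pow]
    gcongr
  have hfin : ∑' n, ‖I n‖ₑ ^ 2 ≠ ∞ := by
    refine ne_top_of_le_ne_top ?_ (ENNReal.tsum_le_tsum hbound)
    rw [ENNReal.tsum_mul_left]
    exact ENNReal.mul_ne_top (ENNReal.pow_ne_top wienerConst_ne_top) hs
  have hsum : Summable fun n => ‖I n‖ ^ 2 := by
    have := ENNReal.summable_toReal hfin
    simpa using this
  exact ⟨I, _, hI, (summable_of_orthogonal horth hsum).hasSum⟩

/-- The differences of component integrals for distinct noises are again orthogonal, so the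
Lipschitz bounds of the components add up in squares. -/
theorem edist_sq_le_of_wienerExtension (hH : 1 / 2 < H) {h h' : ι → ℝ → X}
    (hh : ∀ n, MemLp (h n) 2 (volume.restrict (Icc 0 T)))
    (hh' : ∀ n, MemLp (h' n) 2 (volume.restrict (Icc 0 T))) {I I' : ι → Lp X 2 P}
    (hI : ∀ n, IsWienerExtension P H T (W.β n) (h n) (I n))
    (hI' : ∀ n, IsWienerExtension P H T (W.β n) (h' n) (I' n)) {J J' : Lp X 2 P}
    (hJ : HasSum I J) (hJ' : HasSum I' J') :
    edist J J' ^ 2 ≤ wienerConst H T ^ 2 *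
      ∑' n, eLpNorm (fun s => h n s - h' n s) 2 (volume.restrict (Icc 0 T)) ^ 2 := by
  have horth : ∀ n m, n ≠ m → inner ℝ (I n - I' n) (I m - I' m) = 0 := fun n m hnm => by
    have key := fun {h h' I I'} (a : IsWienerExtension P H T (W.β n) h I)
      (b : IsWienerExtension P H T (W.β m) h' I') (c : MemLp h 2 (volume.restrict (Icc 0 T)))
      (d : MemLp h' 2 (volume.restrict (Icc 0 T))) =>
      a.inner_eq_zero (X := X) hH (W.isFBM n) (W.isFBM m) (W.indepFun hnm) b c d
    rw [inner_sub_left, inner_sub_right, inner_sub_right, key (hI n) (hI m) (hh n) (hh m),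
      key (hI n) (hI' m) (hh n) (hh' m), key (hI' n) (hI m) (hh' n) (hh m),
      key (hI' n) (hI' m) (hh' n) (hh' m)]
    simp
  have h1 := enorm_sq_le_tsum_of_orthogonal horth (hJ.sub hJ')
  rw [edist_eq_enorm_sub, ← ENNReal.tsum_mul_left]
  refine h1.trans (ENNReal.tsum_le_tsum fun n => ?_)
  have := (hI n).edist_edist_le hH (W.isFBM n) (hI' n) (hh n) (hh' n)
  rw [edist_eq_enorm_sub] at this
  rw [← mul_pow]
  gcongr

variable {W} {σ : ℝ → Y →L[ℝ] X} {S : ℝ → X →L[ℝ] X} {M : ℝ}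

theorem SquareIntegrable.tsum_ne_top (hσ : W.SquareIntegrable σ) :
    ∑' n, eLpNorm (fun s => √(W.lam n) • σ s (W.e n)) 2 (volume.restrict (Icc 0 T)) ^ 2 ≠ ∞ := by
  refine ne_top_of_le_ne_top hσ.finite.ne ?_
  rw [ENNReal.tsum_eq_iSup_sum]
  refine iSup_le fun s => ?_
  simp only [eLpNorm_two_sq]
  rw [← lintegral_finsetSum' _ fun n _ => (hσ.measurable n).enorm.pow_const 2]
  exact lintegral_mono fun t => ENNReal.sum_le_tsum s

theorem SquareIntegrable.memLp (hσ : W.SquareIntegrable σ) (n : ι) :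
    MemLp (fun s => √(W.lam n) • σ s (W.e n)) 2 (volume.restrict (Icc 0 T)) := by
  refine ⟨hσ.measurable n, ?_⟩
  have := ENNReal.ne_top_of_tsum_ne_top hσ.tsum_ne_top n
  rw [lt_top_iff_ne_top]
  intro h
  rw [h] at this
  simp at this

/-- The integrand `1_{[0,t]}(s) √λ_n S(t - s) σ(s) e_n` of the stochastic convolution. -/
def convIntegrand (W : QFBM P H T ι Y) (S : ℝ → X →L[ℝ] X) (σ : ℝ → Y →L[ℝ] X) (t : ℝ) (n : ι) :
    ℝ → X :=
  (Icc 0 t).indicator fun s => √(W.lam n) • ((S (t - s)).comp (σ s)) (W.e n)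

/-- The absolute value is harmless on [0, t] and makes the operator family strongly continuous on
all of ℝ, as needed when t varies. -/
theorem convIntegrand_eq (t : ℝ) (n : ι) : W.convIntegrand S σ t n =
    (Icc 0 t).indicator fun s => S |t - s| (√(W.lam n) • σ s (W.e n)) := by
  ext s
  unfold convIntegrand
  by_cases hs : s ∈ Icc 0 t
  · rw [indicator_of_mem hs, indicator_of_mem hs, abs_of_nonneg (by linarith [hs.2])]
    simp
  · rw [indicator_of_notMem hs, indicator_of_notMem hs]

theorem enorm_convIntegrand_le (hM : ∀ t, 0 ≤ t → ‖S t‖ ≤ M) (t : ℝ) (n : ι) (s : ℝ) :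
    ‖W.convIntegrand S σ t n s‖ₑ ≤ ENNReal.ofReal M * ‖√(W.lam n) • σ s (W.e n)‖ₑ := by
  rw [convIntegrand_eq]
  refine (enorm_indicator_le_enorm_self _ _).trans (((S |t - s|).le_opENorm _).trans ?_)
  gcongr
  rw [← ofReal_norm]
  exact ENNReal.ofReal_le_ofReal (hM _ (abs_nonneg _))

theorem memLp_convIntegrand (hσ : W.SquareIntegrable σ) (hS : IsC0Semigroup S)
    (hM : ∀ t, 0 ≤ t → ‖S t‖ ≤ M) (t : ℝ) (n : ι) :
    MemLp (W.convIntegrand S σ t n) 2 (volume.restrict (Icc 0 T)) := by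
  refine (hσ.memLp n).of_le_mul (c := M) ?_ (Eventually.of_forall fun s => ?_)
  · rw [convIntegrand_eq]
    refine AEStronglyMeasurable.indicator ?_ measurableSet_Icc
    have hc := continuous_uncurry_clm (V := fun τ => S |τ|) (M := M)
      (fun τ => hM _ (abs_nonneg τ)) (hS.continuous_abs hM)
    exact hc.comp_aestronglyMeasurable
      (((by fun_prop : Continuous fun s : ℝ => t - s).aestronglyMeasurable).prodMk
        (hσ.measurable n))
  · have h1 := enorm_convIntegrand_le (W := W) (σ := σ) hM t n s
    have hM0 : 0 ≤ M := (norm_nonneg _).trans (hM 0 le_rfl)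
    rw [← ofReal_norm, ← ofReal_norm, ← ENNReal.ofReal_mul hM0] at h1
    exact (ENNReal.ofReal_le_ofReal_iff (by positivity)).1 h1

/-- Dominated convergence in s: the semigroup is strongly continuous, and the cutoff at t is locally
constant in t near t₀ for each s ≠ t₀ in [0, T]. -/
theorem tendsto_convIntegrand (hσ : W.SquareIntegrable σ) (hS : IsC0Semigroup S)
    (hM : ∀ t, 0 ≤ t → ‖S t‖ ≤ M) (t₀ : ℝ) (n : ι) :
    Tendsto (fun t => eLpNorm (fun s => W.convIntegrand S σ t n s - W.convIntegrand S σ t₀ n s) 2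
      (volume.restrict (Icc 0 T))) (𝓝 t₀) (𝓝 0) := by
  refine tendsto_eLpNorm_two_of_dominated
    (fun s => 2 * (ENNReal.ofReal M * ‖√(W.lam n) • σ s (W.e n)‖ₑ)) ?_
    (Eventually.of_forall fun t => (memLp_convIntegrand hσ hS hM t n).1)
    (memLp_convIntegrand hσ hS hM t₀ n).1 (Eventually.of_forall fun t =>
      Eventually.of_forall fun s => ?_) ?_
  · simp only [mul_pow]
    rw [lintegral_const_mul' _ _ (by simp), lintegral_const_mul' _ _ (by simp), ← eLpNorm_two_sq]
    exact ENNReal.mul_ne_top (by simp) (ENNReal.mul_ne_top (by simp)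
      (ENNReal.pow_ne_top (hσ.memLp n).2.ne))
  · rw [two_mul]
    exact enorm_sub_le.trans (add_le_add (enorm_convIntegrand_le hM t n s)
      (enorm_convIntegrand_le hM t₀ n s))
  · have hne : ∀ᵐ s ∂(volume.restrict (Icc 0 T)), s ≠ t₀ :=
      ae_restrict_of_ae (Measure.ae_ne volume t₀)
    filter_upwards [hne, ae_restrict_mem measurableSet_Icc] with s hs hsT
    simp only [convIntegrand_eq]
    rcases lt_or_gt_of_ne hs with h | h
    · have h1 : Tendsto (fun t => S |t - s| (√(W.lam n) • σ s (W.e n))) (𝓝 t₀)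
          (𝓝 (S |t₀ - s| (√(W.lam n) • σ s (W.e n)))) :=
        ((hS.continuous_abs hM _).comp (by fun_prop : Continuous fun t : ℝ => t - s)).tendsto t₀
      rw [indicator_of_mem (show s ∈ Icc 0 t₀ from ⟨hsT.1, h.le⟩)]
      refine h1.congr' ?_
      filter_upwards [Ioi_mem_nhds h] with t ht
      rw [indicator_of_mem (show s ∈ Icc 0 t from ⟨hsT.1, le_of_lt ht⟩)]
    · rw [indicator_of_notMem (show s ∉ Icc 0 t₀ from fun h2 => not_le.2 h h2.2)]
      refine tendsto_const_nhds.congr' ?_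
      filter_upwards [Iio_mem_nhds h] with t ht
      rw [indicator_of_notMem (show s ∉ Icc 0 t from fun h2 => not_le.2 ht h2.2)]

/-- The stochastic convolution `∫₀ᵗ S(t - s) σ(s) dB_Q^H(s)` exists, is uniquely determined, and is
continuous in `t`. -/
theorem exists_stochasticConvolution [CompleteSpace X] (hH : 1 / 2 < H)
    (hσ : W.SquareIntegrable σ) (hS : IsC0Semigroup S) (hM : ∀ t, 0 ≤ t → ‖S t‖ ≤ M) :
    ∃ J : ℝ → Lp X 2 P,
      (∀ t ∈ Icc 0 T, W.IsIntegral t (fun s => (S (t - s)).comp (σ s)) (J t)) ∧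
      (∀ t ∈ Icc 0 T, ∀ J', W.IsIntegral t (fun s => (S (t - s)).comp (σ s)) J' → J' = J t) ∧
      ContinuousOn J (Icc 0 T) ∧ J 0 = 0 := by
  have hmem := memLp_convIntegrand hσ hS hM
  have hle : ∀ t n, eLpNorm (W.convIntegrand S σ t n) 2 (volume.restrict (Icc 0 T)) ≤
      ENNReal.ofReal M *
        eLpNorm (fun s => √(W.lam n) • σ s (W.e n)) 2 (volume.restrict (Icc 0 T)) := by
    intro t n
    refine ENNReal.le_of_sq_le_sq ?_
    rw [mul_pow, eLpNorm_two_sq, eLpNorm_two_sq, ← lintegral_const_mul' _ _ (by simp)]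
    refine lintegral_mono fun s => ?_
    simp only
    rw [← mul_pow]
    gcongr
    exact enorm_convIntegrand_le hM t n s
  have hsum : ∀ t, ∑' n, eLpNorm (W.convIntegrand S σ t n) 2 (volume.restrict (Icc 0 T)) ^ 2 ≠ ∞ := by
    intro t
    refine ne_top_of_le_ne_top ?_ (ENNReal.tsum_le_tsum fun n => pow_le_pow_left' (hle t n) 2)
    simp only [mul_pow]
    rw [ENNReal.tsum_mul_left]
    exact ENNReal.mul_ne_top (by simp) hσ.tsum_ne_top
  choose I J hI hJ using fun t => W.exists_wienerExtension_hasSum hH (hmem t) (hsum t)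
  refine ⟨J, fun t ht => ⟨I t, fun n => ?_, hJ t⟩, fun t ht J' => ?_, ?_, ?_⟩
  · exact (hI t n).isWienerIntegral hH ht.2 ((memLp_indicator_Icc ht.2).1 (hmem t n))
  -- Uniqueness is componentwise: each Wiener integral is forced, hence so is the sum.
  · rintro ⟨I', hI', hJ'⟩
    have : I' = I t := funext fun n =>
      (hI t n).eq_of_isWienerIntegral (W.isFBM n) ht.2 (hI' n)
    rw [this] at hJ'
    exact hJ'.unique (hJ t)
  · refine Continuous.continuousOn (continuous_iff_continuousAt.2 fun t₀ => ?_)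
    rw [ContinuousAt, tendsto_iff_edist_tendsto_0]
    refine ENNReal.tendsto_zero_of_sq ?_
    -- The componentwise limits are summed by dominated convergence; the semigroup bound supplies a
    -- majorant independent of t, summable by the Hilbert–Schmidt hypothesis.
    have h1 : Tendsto (fun t => ∑' n, eLpNorm
        (fun s => W.convIntegrand S σ t n s - W.convIntegrand S σ t₀ n s) 2
        (volume.restrict (Icc 0 T)) ^ 2) (𝓝 t₀) (𝓝 0) := by
      refine ENNReal.tendsto_tsum_zero_of_dominated (b := fun n => (2 * (ENNReal.ofReal M *
        eLpNorm (fun s => √(W.lam n) • σ s (W.e n)) 2 (volume.restrict (Icc 0 T)))) ^ 2) ?_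
        (Eventually.of_forall fun t n => ?_)
        fun n => ENNReal.tendsto_sq_zero (tendsto_convIntegrand hσ hS hM t₀ n)
      · simp only [mul_pow]
        rw [ENNReal.tsum_mul_left, ENNReal.tsum_mul_left]
        exact ENNReal.mul_ne_top (by simp) (ENNReal.mul_ne_top (by simp) hσ.tsum_ne_top)
      · gcongr
        rw [two_mul]
        exact (eLpNorm_sub_le (hmem t n).1 (hmem t₀ n).1 (by norm_num)).trans
          (add_le_add (hle t n) (hle t₀ n))
    have h2 := ENNReal.Tendsto.const_mul h1
      (Or.inr (ENNReal.pow_ne_top (n := 2) (wienerConst_ne_top (H := H) (T := T))))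
    rw [mul_zero] at h2
    exact tendsto_of_tendsto_of_tendsto_of_le_of_le tendsto_const_nhds h2 (fun _ => zero_le)
      fun t => W.edist_sq_le_of_wienerExtension hH (hmem t) (hmem t₀) (hI t) (hI t₀) (hJ t) (hJ t₀)
  · have h1 := W.edist_sq_le_of_wienerExtension (h' := fun _ _ => 0) (J' := 0) hH
      (hmem 0) (fun n => MemLp.zero) (hI 0)
      (fun n => IsWienerExtension.zero hH (W.isFBM n)) (hJ 0) hasSum_zero
    have h2 : ∀ n, eLpNorm (fun s => W.convIntegrand S σ 0 n s - 0) 2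
        (volume.restrict (Icc 0 T)) = 0 := by
      intro n
      simp only [sub_zero]
      rw [eLpNorm_eq_zero_iff (hmem 0 n).1 two_ne_zero]
      refine ae_restrict_of_ae ((Measure.ae_ne volume 0).mono fun s hs => ?_)
      rw [convIntegrand, indicator_of_notMem]
      · rfl
      · rintro ⟨h3, h4⟩
        exact hs (le_antisymm h4 h3)
    simp only [h2] at h1
    simpa using h1

end QFBM

end

/-! ### Carathéodory measurability, concave moduli, and a Gronwall inequality -/

section

/-- A Carathéodory function composed with a measurable function is measurable. -/
theorem aestronglyMeasurable_caratheodory {α E E' : Type*} [MeasurableSpace α] {μ : Measure α}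
    [TopologicalSpace E] [TopologicalSpace.PseudoMetrizableSpace E] [NormedAddCommGroup E']
    {F : α → E → E'} (hF : ∀ u, AEStronglyMeasurable (fun a => F a u) μ)
    (hFc : ∀ᵐ a ∂μ, Continuous (F a)) {y : α → E} (hy : AEStronglyMeasurable y μ) :
    AEStronglyMeasurable (fun a => F a (y a)) μ := by
  obtain ⟨y', hy', hyy'⟩ := hy
  -- For a simple argument the composition is a finite sum of measurable pieces; continuity in the
  -- second variable passes to the limit of simple approximations.
  have h1 : ∀ g : SimpleFunc α E, AEStronglyMeasurable (fun a => F a (g a)) μ := by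
    intro g
    have e : (fun a => F a (g a)) = fun a => ∑ v ∈ g.range, (g ⁻¹' {v}).indicator (fun a => F a v) a := by
      ext a
      rw [Finset.sum_eq_single_of_mem (g a) (g.mem_range_self a)]
      · rw [indicator_of_mem]; rfl
      · intro v _ hv
        rw [indicator_of_notMem]
        exact fun h => hv h.symm
    rw [e]
    exact Finset.aestronglyMeasurable_fun_sum _ fun v _ => (hF v).indicator (g.measurableSet_fiber v)
  have h2 : AEStronglyMeasurable (fun a => F a (y' a)) μ := by
    refine aestronglyMeasurable_of_tendsto_ae atTop (f := fun n a => F a (hy'.approx n a))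
      (fun n => h1 _) (hFc.mono fun a ha => ?_)
    exact (ha.tendsto _).comp (hy'.tendsto_approx a)
  exact h2.congr (hyy'.mono fun a ha => by simp only [ha])

namespace IsConcaveModulus

variable {T : ℝ} {G : ℝ → ℝ → ℝ}

theorem aestronglyMeasurable_comp (hG : IsConcaveModulus T G) {z : ℝ → ℝ}
    (hz : AEStronglyMeasurable z (volume.restrict (Icc 0 T))) (h0 : ∀ s ∈ Icc 0 T, 0 ≤ z s) :
    AEStronglyMeasurable (fun s => G s (z s)) (volume.restrict (Icc 0 T)) := by
  have h1 := aestronglyMeasurable_caratheodory (F := fun s x => G s (max x 0))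
    (μ := volume.restrict (Icc 0 T)) (fun x => (hG.integrable _ (le_max_right x 0)).1)
    ((ae_restrict_mem measurableSet_Icc).mono fun s hs => by
      have := (hG.continuousOn s hs).comp_continuous (f := fun x : ℝ => max x 0) (by fun_prop)
        (fun x => mem_Ici.2 (le_max_right x 0))
      exact this) hz
  refine h1.congr ((ae_restrict_mem measurableSet_Icc).mono fun s hs => ?_)
  simp only [max_eq_left (h0 s hs)]

theorem integrableOn_comp (hG : IsConcaveModulus T G) {z : ℝ → ℝ} {B : ℝ}
    (hz : AEStronglyMeasurable z (volume.restrict (Icc 0 T))) (h0 : ∀ s ∈ Icc 0 T, 0 ≤ z s)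
    (hB : ∀ s ∈ Icc 0 T, z s ≤ B) (hB0 : 0 ≤ B) : IntegrableOn (fun s => G s (z s)) (Icc 0 T) := by
  refine (hG.integrable B hB0).mono' (hG.aestronglyMeasurable_comp hz h0)
    ((ae_restrict_mem measurableSet_Icc).mono fun s hs => ?_)
  rw [Real.norm_of_nonneg (hG.nonneg s hs _ (h0 s hs))]
  exact hG.monotoneOn s hs (h0 s hs) hB0 (hB s hs)

/-- For x ≥ 1, write 1 as the convex combination of x and 0 with weight 1/x on x: concavity and G(s,
0) ≥ 0 give G(s, x) ≤ x G(s, 1). For x ≤ 1 monotonicity suffices. -/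
theorem le_linear (hG : IsConcaveModulus T G) {s x : ℝ} (hs : s ∈ Icc 0 T) (hx : 0 ≤ x) : G s x ≤ G s 1 * (1 + x) := by
  have h1 : 0 ≤ G s 1 := hG.nonneg s hs 1 zero_le_one
  rcases le_total x 1 with h | h
  · have := hG.monotoneOn s hs hx (mem_Ici.2 zero_le_one) h
    nlinarith
  · have hx0 : 0 < x := by linarith
    have h2 := (hG.concaveOn s hs).2 (show x ∈ Ici 0 from hx)
      (mem_Ici.2 le_rfl : (0 : ℝ) ∈ Ici 0) (show 0 ≤ x⁻¹ by positivity)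
      (show 0 ≤ 1 - x⁻¹ from sub_nonneg.2 (inv_le_one_of_one_le₀ h)) (by ring)
    simp only [smul_eq_mul, mul_zero, add_zero, inv_mul_cancel₀ hx0.ne'] at h2
    have h3 : 0 ≤ (1 - x⁻¹) * G s 0 := mul_nonneg (sub_nonneg.2 (inv_le_one_of_one_le₀ h))
      (hG.nonneg s hs 0 le_rfl)
    have h4 : x⁻¹ * G s x ≤ G s 1 := by linarith
    rw [inv_mul_le_iff₀ hx0] at h4
    nlinarith

end IsConcaveModulus

/-- Exponential weights make a Volterra kernel with integrable majorant arbitrarily small. -/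
theorem exists_exp_weight {T : ℝ} {k : ℝ → ℝ} (hk : IntegrableOn k (Icc 0 T))
    (hk0 : ∀ s ∈ Icc 0 T, 0 ≤ k s) {ε : ℝ} (hε : 0 < ε) :
    ∃ w : ℝ, 0 ≤ w ∧ ∀ t ∈ Icc 0 T, ∫ s in (0 : ℝ)..t, k s * Real.exp (w * s) ≤
      ε * Real.exp (w * t) := by
  -- The kernel is split into its excess over a level N, small in L¹ for large N, and a part bounded
  -- by N, which a large exponential weight makes small.
  have h1 : Tendsto (fun n : ℕ => ∫ s in Icc 0 T, max (k s - n) 0) atTop (𝓝 0) := by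
    have := tendsto_integral_of_dominated_convergence (μ := volume.restrict (Icc 0 T))
      (F := fun (n : ℕ) s => max (k s - n) 0) (f := fun _ => 0) k
      (fun n => (hk.1.sub aestronglyMeasurable_const).sup aestronglyMeasurable_const) hk
      (fun n => (ae_restrict_mem measurableSet_Icc).mono fun s hs => by
        rw [Real.norm_of_nonneg (le_max_right _ _)]
        have : (0 : ℝ) ≤ n := Nat.cast_nonneg n
        exact max_le (by linarith) (hk0 s hs))
      (Eventually.of_forall fun s => by
        obtain ⟨N, hN⟩ := exists_nat_ge (k s)
        refine tendsto_const_nhds.congr' ?_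
        filter_upwards [eventually_ge_atTop N] with n hn
        have : (N : ℝ) ≤ n := by exact_mod_cast hn
        rw [max_eq_right (by linarith)])
    simpa using this
  obtain ⟨N, hN⟩ := (h1.eventually (gt_mem_nhds (half_pos hε))).exists
  -- Chosen so that N/w ≤ ε/2; the extra 1 keeps w positive when N = 0.
  set w : ℝ := 2 * (N + 1) / ε with hw
  have hw0 : 0 < w := by positivity
  refine ⟨w, hw0.le, fun t ht => ?_⟩
  have hsub : Icc 0 t ⊆ Icc 0 T := Icc_subset_Icc_right ht.2
  have hkt : IntervalIntegrable k volume 0 t :=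
    (intervalIntegrable_iff_integrableOn_Icc_of_le ht.1).2 (hk.mono_set hsub)
  have hmt : IntervalIntegrable (fun s => max (k s - N) 0) volume 0 t := by
    have h3 : IntervalIntegrable (fun s => k s - N) volume 0 t :=
      hkt.sub intervalIntegrable_const
    exact ⟨h3.1.sup (integrable_const 0), h3.2.sup (integrable_const 0)⟩
  have hexp : Continuous fun s : ℝ => Real.exp (w * s) := by fun_prop
  have i1 : IntervalIntegrable (fun s => k s * Real.exp (w * s)) volume 0 t :=
    hkt.mul_continuousOn hexp.continuousOn
  have i2 : IntervalIntegrable (fun s => max (k s - N) 0 * Real.exp (w * t)) volume 0 t :=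
    hmt.mul_const _
  have i3 : IntervalIntegrable (fun s => (N : ℝ) * Real.exp (w * s)) volume 0 t :=
    (hexp.const_mul (N : ℝ)).intervalIntegrable _ _
  calc ∫ s in (0 : ℝ)..t, k s * Real.exp (w * s)
      ≤ ∫ s in (0 : ℝ)..t, (max (k s - N) 0 * Real.exp (w * t) + N * Real.exp (w * s)) := by
        refine intervalIntegral.integral_mono_on ht.1 i1 (i2.add i3) fun s hs => ?_
        have h4 : Real.exp (w * s) ≤ Real.exp (w * t) := by gcongr; exact hs.2
        have h5 : k s ≤ max (k s - N) 0 + N := by linarith [le_max_left (k s - N) 0]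
        have h6 : 0 ≤ max (k s - N) 0 := le_max_right _ _
        have h7 := Real.exp_pos (w * s)
        nlinarith
    _ = (∫ s in (0 : ℝ)..t, max (k s - N) 0) * Real.exp (w * t) +
          N * ∫ s in (0 : ℝ)..t, Real.exp (w * s) := by
        rw [intervalIntegral.integral_add i2 i3, intervalIntegral.integral_mul_const,
          intervalIntegral.integral_const_mul]
    _ ≤ ε / 2 * Real.exp (w * t) + ε / 2 * Real.exp (w * t) := by
        refine add_le_add ?_ ?_
        · gcongr
          rw [intervalIntegral.integral_of_le ht.1, ← integral_Icc_eq_integral_Ioc]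
          refine (setIntegral_mono_set ?_ (Eventually.of_forall fun s => le_max_right _ _)
            hsub.eventuallyLE).trans hN.le
          have h8 : IntegrableOn (fun s => k s - N) (Icc 0 T) :=
            hk.sub (integrable_const _)
          exact h8.sup (integrable_const 0)
        · have h9 : ∫ s in (0 : ℝ)..t, Real.exp (w * s) = w⁻¹ * (Real.exp (w * t) - 1) := by
            rw [intervalIntegral.integral_comp_mul_left _ hw0.ne', integral_exp]
            simp
          rw [h9]
          have h10 : (N : ℝ) * w⁻¹ ≤ ε / 2 := by
            rw [hw]; field_simp; linarith
          have h11 : 0 ≤ (N : ℝ) * w⁻¹ := by positivity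
          have h12 := Real.exp_pos (w * t)
          nlinarith
    _ = ε * Real.exp (w * t) := by ring

/-- A Gronwall inequality for bounded, possibly discontinuous, functions. -/
theorem exists_gronwall_const {q c T : ℝ} (hq : q < 1) (hc : 0 ≤ c) (hT : 0 ≤ T) :
    ∃ D : ℝ, 0 < D ∧ ∀ z h : ℝ → ℝ, MonotoneOn z (Icc 0 T) → (∀ s ∈ Icc 0 T, 0 ≤ z s) →
      MonotoneOn h (Icc 0 T) → (∀ s ∈ Icc 0 T, 0 ≤ h s) →
      (∀ t ∈ Icc 0 T, z t ≤ q * z t + c * (∫ s in (0 : ℝ)..t, z s) + c * h t) →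
      ∀ t ∈ Icc 0 T, z t ≤ D * h t := by
  -- The constant left after absorbing q z(t) into the left-hand side.
  set c' := c / (1 - q) with hc'
  have h1q : 0 < 1 - q := by linarith
  have hc'0 : 0 ≤ c' := by positivity
  obtain ⟨w, hw0, hw⟩ := exists_exp_weight (T := T) (k := fun _ => c')
    continuous_const.integrableOn_Icc (fun s hs => hc'0) (ε := 1 / 2) (by norm_num)
  refine ⟨2 * c' * Real.exp (w * T) + 1, by positivity, fun z h hzm hz0 hhm hh0 hz t ht => ?_⟩
  have hsub : Icc 0 t ⊆ Icc 0 T := Icc_subset_Icc_right ht.2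
  have hTm : T ∈ Icc 0 T := ⟨hT, le_rfl⟩
  set v : ℝ → ℝ := fun s => Real.exp (-(w * s)) * z s with hv
  have hvb : BddAbove (v '' Icc 0 t) := by
    refine ⟨z T, ?_⟩
    rintro _ ⟨s, hs, rfl⟩
    have h2 : Real.exp (-(w * s)) ≤ 1 := Real.exp_le_one_iff.2 (by nlinarith [hs.1])
    have h3 := hzm (hsub hs) hTm (hsub hs).2
    have h4 := hz0 s (hsub hs)
    simp only [hv]
    nlinarith
  -- The supremum of z weighted by e^{-ws}. With the weight chosen for ε = 1/2, the integral term
  -- contributes at most m/2, so m ≤ 2 c' h(t). Only boundedness and monotonicity of z are used, not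
  -- continuity.
  set m := sSup (v '' Icc 0 t) with hm
  have hmle : ∀ s ∈ Icc 0 t, z s ≤ m * Real.exp (w * s) := by
    intro s hs
    have h5 : v s ≤ m := le_csSup hvb ⟨s, hs, rfl⟩
    have h6 : z s = v s * Real.exp (w * s) := by
      simp only [hv]
      rw [mul_right_comm, ← Real.exp_add]; simp
    rw [h6]; gcongr
  have hstep : ∀ s ∈ Icc 0 t, v s ≤ m / 2 + c' * h t := by
    intro s hs
    have h7 := hz s (hsub hs)
    have h8 : z s ≤ c' * (∫ u in (0 : ℝ)..s, z u) + c' * h s := by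
      rw [hc', div_mul_eq_mul_div, div_mul_eq_mul_div, ← add_div, le_div_iff₀ h1q]
      linarith
    have hiz : IntervalIntegrable z volume 0 s := by
      refine MonotoneOn.intervalIntegrable ?_
      rw [uIcc_of_le hs.1]
      exact hzm.mono ((Icc_subset_Icc_right hs.2).trans hsub)
    have h9 : c' * (∫ u in (0 : ℝ)..s, z u) ≤ m * (1 / 2 * Real.exp (w * s)) := by
      have hm0 : 0 ≤ m := by
        have := hz0 0 ⟨le_rfl, hT⟩
        have h10 := hmle 0 ⟨le_rfl, ht.1⟩
        simp only [mul_zero, Real.exp_zero, mul_one] at h10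
        linarith
      refine le_trans ?_ (mul_le_mul_of_nonneg_left (hw s (hsub hs)) hm0)
      rw [← intervalIntegral.integral_const_mul, ← intervalIntegral.integral_const_mul]
      refine intervalIntegral.integral_mono_on hs.1 (hiz.const_mul _) ?_ fun u hu => ?_
      · exact (by fun_prop : Continuous fun u => m * (c' * Real.exp (w * u))).intervalIntegrable _ _
      · have := hmle u ⟨hu.1, hu.2.trans hs.2⟩
        nlinarith
    have h11 : h s ≤ h t := hhm (hsub hs) ht hs.2
    have h12 : z s ≤ (m / 2 + c' * h t) * Real.exp (w * s) := by
      have h13 : 1 ≤ Real.exp (w * s) := Real.one_le_exp (mul_nonneg hw0 hs.1)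
      have h14 : 0 ≤ c' * h t := mul_nonneg hc'0 (hh0 t ht)
      have h15 : c' * h s ≤ c' * h t := by gcongr
      nlinarith
    simp only [hv]
    rw [Real.exp_neg, inv_mul_le_iff₀ (Real.exp_pos _), mul_comm]
    exact h12
  have hm2 : m ≤ m / 2 + c' * h t :=
    csSup_le ⟨_, 0, ⟨le_rfl, ht.1⟩, rfl⟩ (by rintro _ ⟨s, hs, rfl⟩; exact hstep s hs)
  have h16 := hmle t ⟨ht.1, le_rfl⟩
  have h17 : Real.exp (w * t) ≤ Real.exp (w * T) := by gcongr; exact ht.2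
  have h18 : 0 ≤ h t := hh0 t ht
  calc z t ≤ m * Real.exp (w * t) := h16
    _ ≤ (2 * (c' * h t)) * Real.exp (w * t) := by gcongr; linarith
    _ ≤ (2 * (c' * h t)) * Real.exp (w * T) := by gcongr
    _ ≤ _ := by nlinarith

end

/-! ### The Osgood-type inequality -/

section

/-- The right-hand side `q z(t) + c ∫₀ᵗ z + c ∫₀ᵗ G(s, z(s)) ds` of the Osgood-type inequality. -/
def osgoodMajorant (q c : ℝ) (G : ℝ → ℝ → ℝ) (z : ℝ → ℝ) (t : ℝ) : ℝ :=
  q * z t + c * (∫ s in (0 : ℝ)..t, z s) + c * ∫ s in (0 : ℝ)..t, G s (z s)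

section Majorant

variable {q c T : ℝ} {G : ℝ → ℝ → ℝ}

theorem aestronglyMeasurable_of_monotoneOn_Icc {z : ℝ → ℝ} (hz : MonotoneOn z (Icc 0 T)) :
    AEStronglyMeasurable z (volume.restrict (Icc 0 T)) :=
  (aemeasurable_restrict_of_monotoneOn measurableSet_Icc hz).aestronglyMeasurable

theorem monotoneOn_integral_of_nonneg {z : ℝ → ℝ} (hz : IntegrableOn z (Icc 0 T))
    (h0 : ∀ s ∈ Icc 0 T, 0 ≤ z s) : MonotoneOn (fun t => ∫ s in (0 : ℝ)..t, z s) (Icc 0 T) := by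
  intro a ha b hb hab
  refine intervalIntegral.integral_mono_interval le_rfl ha.1 hab
    ((ae_restrict_mem measurableSet_Ioc).mono fun s hs => h0 s ⟨hs.1.le, hs.2.trans hb.2⟩) ?_
  exact (intervalIntegrable_iff_integrableOn_Icc_of_le hb.1).2
    (hz.mono_set (Icc_subset_Icc_right hb.2))

theorem IsConcaveModulus.integrableOn_comp_monotoneOn (hG : IsConcaveModulus T G) (hT : 0 ≤ T)
    {z : ℝ → ℝ} (hz : MonotoneOn z (Icc 0 T)) (h0 : ∀ s ∈ Icc 0 T, 0 ≤ z s) :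
    IntegrableOn (fun s => G s (z s)) (Icc 0 T) :=
  hG.integrableOn_comp (B := z T) (aestronglyMeasurable_of_monotoneOn_Icc hz) h0
    (fun _ hs => hz hs ⟨hT, le_rfl⟩ hs.2) (h0 T ⟨hT, le_rfl⟩)

theorem osgoodMajorant_monotoneOn (hq0 : 0 ≤ q) (hc : 0 ≤ c) (hT : 0 ≤ T)
    (hG : IsConcaveModulus T G) {z : ℝ → ℝ} (hz : MonotoneOn z (Icc 0 T))
    (h0 : ∀ s ∈ Icc 0 T, 0 ≤ z s) : MonotoneOn (osgoodMajorant q c G z) (Icc 0 T) := by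
  intro a ha b hb hab
  have h1 := monotoneOn_integral_of_nonneg (hz.integrableOn_isCompact isCompact_Icc) h0 ha hb hab
  have h2 := monotoneOn_integral_of_nonneg (hG.integrableOn_comp_monotoneOn hT hz h0)
    (fun s hs => hG.nonneg s hs _ (h0 s hs)) ha hb hab
  have h3 := hz ha hb hab
  simp only at h1 h2
  unfold osgoodMajorant
  gcongr

theorem osgoodMajorant_nonneg (hq0 : 0 ≤ q) (hc : 0 ≤ c)
    (hG : IsConcaveModulus T G) {z : ℝ → ℝ}
    (h0 : ∀ s ∈ Icc 0 T, 0 ≤ z s) {t : ℝ} (ht : t ∈ Icc 0 T) : 0 ≤ osgoodMajorant q c G z t := by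
  have h1 : 0 ≤ ∫ s in (0 : ℝ)..t, z s :=
    intervalIntegral.integral_nonneg ht.1 fun s hs => h0 s ⟨hs.1, hs.2.trans ht.2⟩
  have h2 : 0 ≤ ∫ s in (0 : ℝ)..t, G s (z s) :=
    intervalIntegral.integral_nonneg ht.1 fun s hs =>
      hG.nonneg s ⟨hs.1, hs.2.trans ht.2⟩ _ (h0 s ⟨hs.1, hs.2.trans ht.2⟩)
  have h3 := h0 t ht
  unfold osgoodMajorant
  positivity

/-- Both integrals converge by dominated convergence, with majorants B and G(·, B); the latter is
integrable by the hypothesis on the modulus. -/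
theorem tendsto_osgoodMajorant (hG : IsConcaveModulus T G) {z : ℕ → ℝ → ℝ} {z' : ℝ → ℝ} {B : ℝ}
    (hzm : ∀ n, MonotoneOn (z n) (Icc 0 T)) (h0 : ∀ n, ∀ s ∈ Icc 0 T, 0 ≤ z n s)
    (hB : ∀ n, ∀ s ∈ Icc 0 T, z n s ≤ B) (hB0 : 0 ≤ B)
    (hlim : ∀ s ∈ Icc 0 T, Tendsto (fun n => z n s) atTop (𝓝 (z' s))) {t : ℝ} (ht : t ∈ Icc 0 T) :
    Tendsto (fun n => osgoodMajorant q c G (z n) t) atTop (𝓝 (osgoodMajorant q c G z' t)) := by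
  have hsub : uIoc 0 t ⊆ Icc 0 T := by
    rw [uIoc_of_le ht.1]
    exact Ioc_subset_Icc_self.trans (Icc_subset_Icc_right ht.2)
  refine (((hlim t ht).const_mul q).add (Tendsto.const_mul c ?_)).add (Tendsto.const_mul c ?_)
  · refine intervalIntegral.tendsto_integral_filter_of_dominated_convergence (fun _ => B)
      (Eventually.of_forall fun n =>
        (aestronglyMeasurable_of_monotoneOn_Icc (hzm n)).mono_measure (Measure.restrict_mono_set _ hsub))
      (Eventually.of_forall fun n => Eventually.of_forall fun s hs => ?_)
      intervalIntegrable_const (Eventually.of_forall fun s hs => hlim s (hsub hs))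
    rw [Real.norm_of_nonneg (h0 n s (hsub hs))]
    exact hB n s (hsub hs)
  · refine intervalIntegral.tendsto_integral_filter_of_dominated_convergence (fun s => G s B)
      (Eventually.of_forall fun n =>
        (hG.aestronglyMeasurable_comp (aestronglyMeasurable_of_monotoneOn_Icc (hzm n)) (h0 n)).mono_measure
          (Measure.restrict_mono_set _ hsub))
      (Eventually.of_forall fun n => Eventually.of_forall fun s hs => ?_)
      ?_ (Eventually.of_forall fun s hs => ?_)
    · rw [Real.norm_of_nonneg (hG.nonneg s (hsub hs) _ (h0 n s (hsub hs)))]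
      exact hG.monotoneOn s (hsub hs) (h0 n s (hsub hs)) hB0 (hB n s (hsub hs))
    · exact (intervalIntegrable_iff_integrableOn_Icc_of_le ht.1).2
        ((hG.integrable B hB0).mono_set (Icc_subset_Icc_right ht.2))
    · have hz' : z' s ∈ Ici (0 : ℝ) :=
        ge_of_tendsto' (hlim s (hsub hs)) fun n => h0 n s (hsub hs)
      exact ((hG.continuousOn s (hsub hs)) _ hz').tendsto.comp
        (tendsto_nhdsWithin_iff.2 ⟨hlim s (hsub hs),
          Eventually.of_forall fun n => h0 n s (hsub hs)⟩)

/-- The Gronwall inequality with h(t) = ∫₀ᵗ G(s, z(s)) ds eliminates q z and ∫ z, leaving z ≤ D ∫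
G(s, z), to which the Osgood hypothesis applies. -/
theorem eq_zero_of_le_osgoodMajorant (hq : q < 1) (hc : 0 ≤ c) (hT : 0 ≤ T)
    (hG : IsConcaveModulus T G)
    (hGu : ∀ D : ℝ, 0 < D → ∀ z : ℝ → ℝ, (∀ t ∈ Icc 0 T, 0 ≤ z t) → z 0 = 0 →
      IntegrableOn (fun s => G s (z s)) (Icc 0 T) →
      (∀ t ∈ Icc 0 T, z t ≤ D * ∫ s in (0 : ℝ)..t, G s (z s)) → ∀ t ∈ Icc 0 T, z t = 0)
    {z : ℝ → ℝ} (hz : MonotoneOn z (Icc 0 T)) (h0 : ∀ s ∈ Icc 0 T, 0 ≤ z s)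
    (hle : ∀ t ∈ Icc 0 T, z t ≤ osgoodMajorant q c G z t) : ∀ t ∈ Icc 0 T, z t = 0 := by
  obtain ⟨D, hD, h⟩ := exists_gronwall_const hq hc hT
  have hi := hG.integrableOn_comp_monotoneOn hT hz h0
  have h1 := h z (fun t => ∫ s in (0 : ℝ)..t, G s (z s)) hz h0
    (monotoneOn_integral_of_nonneg hi fun s hs => hG.nonneg s hs _ (h0 s hs))
    (fun t ht => intervalIntegral.integral_nonneg ht.1 fun s hs =>
      hG.nonneg s ⟨hs.1, hs.2.trans ht.2⟩ _ (h0 s ⟨hs.1, hs.2.trans ht.2⟩)) hle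
  refine hGu D hD z h0 (le_antisymm ?_ (h0 0 ⟨le_rfl, hT⟩)) hi h1
  simpa using h1 0 ⟨le_rfl, hT⟩

end Majorant

/-- The growth bound that makes the Picard iterates uniformly bounded. -/
theorem exists_weight_osgoodMajorant {q c T : ℝ} {G : ℝ → ℝ → ℝ} (hq : q < 1)
    (hc : 0 ≤ c) (hT : 0 ≤ T) (hG : IsConcaveModulus T G) {m : ℝ} (hm : 0 ≤ m) :
    ∃ R w : ℝ, 0 ≤ R ∧ 0 ≤ w ∧ ∀ t ∈ Icc 0 T, ∀ a b : ℝ,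
      a ^ 2 ≤ osgoodMajorant q c G (fun s => R * Real.exp (w * s)) t → b ^ 2 ≤ m →
      (a + b) ^ 2 ≤ R * Real.exp (w * t) := by
  have hp : 0 < 1 - q := by linarith
  have hG1 : ∀ s ∈ Icc 0 T, 0 ≤ G s 1 := fun s hs => hG.nonneg s hs 1 zero_le_one
  obtain ⟨w, hw0, hw⟩ := exists_exp_weight (T := T) (k := fun s => c * (1 + G s 1))
    ((continuous_const.integrableOn_Icc.add (hG.integrable 1 zero_le_one)).const_mul c)
    (fun s hs => mul_nonneg hc (add_nonneg zero_le_one (hG1 s hs))) (ε := (1 - q) / 8)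
    (by linarith)
  -- The weight in (a + b)² ≤ (1 + η) a² + (1 + η⁻¹) b². With the integral terms bounded by (1 -
  -- q)/8 of R e^{wt}, the total coefficient (1 + η)(q + (1 - q)/8) stays below 1.
  set η := (1 - q) / 2 with hη
  have hη0 : 0 < η := by rw [hη]; linarith
  set I1 := ∫ s in (0 : ℝ)..T, G s 1 with hI1
  have hI10 : 0 ≤ I1 := intervalIntegral.integral_nonneg hT hG1
  set C := (1 + η) * (c * I1) + (1 + η⁻¹) * m with hC
  have hC0 : 0 ≤ C := by positivity
  -- The gap between that coefficient and 1 is at least 3(1 - q)/8, so this R pays for all terms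
  -- that do not scale with R, collected in C.
  set R := C / (3 * (1 - q) / 8) with hR
  have hR0 : 0 ≤ R := by positivity
  have hRC : R * (3 * (1 - q) / 8) = C := by rw [hR]; field_simp
  refine ⟨R, w, hR0, hw0, fun t ht a b h1 h2 => ?_⟩
  set e := Real.exp (w * t) with he
  have he1 : 1 ≤ e := Real.one_le_exp (mul_nonneg hw0 ht.1)
  have hexp : Continuous fun s : ℝ => R * Real.exp (w * s) := by fun_prop
  have hsub : Icc 0 t ⊆ Icc 0 T := Icc_subset_Icc_right ht.2
  have hG1i : IntervalIntegrable (fun s => G s 1) volume 0 t :=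
    (intervalIntegrable_iff_integrableOn_Icc_of_le ht.1).2
      ((hG.integrable 1 zero_le_one).mono_set hsub)
  have hGi : IntervalIntegrable (fun s => G s (R * Real.exp (w * s))) volume 0 t := by
    refine (intervalIntegrable_iff_integrableOn_Icc_of_le ht.1).2
      (IntegrableOn.mono_set (hG.integrableOn_comp_monotoneOn hT ?_ ?_) hsub)
    · intro x _ y _ hxy
      simp only
      gcongr
    · intro s _
      positivity
  have hmaj : osgoodMajorant q c G (fun s => R * Real.exp (w * s)) t ≤
      q * (R * e) + R * ((1 - q) / 8 * e) + c * I1 := by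
    have h3 : c * (∫ s in (0 : ℝ)..t, R * Real.exp (w * s)) +
        c * (∫ s in (0 : ℝ)..t, G s (R * Real.exp (w * s))) ≤
        R * (∫ s in (0 : ℝ)..t, c * (1 + G s 1) * Real.exp (w * s)) +
          c * ∫ s in (0 : ℝ)..t, G s 1 := by
      have hki : IntervalIntegrable (fun s => c * (1 + G s 1) * Real.exp (w * s)) volume 0 t :=
        ((intervalIntegrable_const.add hG1i).const_mul c).mul_continuousOn
          (by fun_prop : Continuous fun s : ℝ => Real.exp (w * s)).continuousOn
      rw [← intervalIntegral.integral_const_mul, ← intervalIntegral.integral_const_mul,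
        ← intervalIntegral.integral_const_mul R, ← intervalIntegral.integral_const_mul c,
        ← intervalIntegral.integral_add ((hexp.intervalIntegrable _ _).const_mul c)
          (hGi.const_mul c),
        ← intervalIntegral.integral_add (hki.const_mul R) (hG1i.const_mul c)]
      refine intervalIntegral.integral_mono_on ht.1
        (((hexp.intervalIntegrable _ _).const_mul c).add (hGi.const_mul c))
        ((hki.const_mul R).add (hG1i.const_mul c)) fun s hs => ?_
      have h4 := hG.le_linear (hsub hs) (x := R * Real.exp (w * s)) (by positivity)
      have h5 := mul_le_mul_of_nonneg_left h4 hc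
      nlinarith
    have h6 : (∫ s in (0 : ℝ)..t, G s 1) ≤ I1 :=
      monotoneOn_integral_of_nonneg (hG.integrable 1 zero_le_one) hG1 ht ⟨hT, le_rfl⟩ ht.2
    have h7 := mul_le_mul_of_nonneg_left (hw t ht) hR0
    have h8 := mul_le_mul_of_nonneg_left h6 hc
    unfold osgoodMajorant
    simp only [← he] at h7 ⊢
    linarith
  have h9 : (a + b) ^ 2 ≤ (1 + η) * a ^ 2 + (1 + η⁻¹) * b ^ 2 := by
    have h10 : 0 ≤ η⁻¹ * (η * a - b) ^ 2 := by positivity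
    have h11 : η⁻¹ * (η * a - b) ^ 2 = η * a ^ 2 - 2 * a * b + η⁻¹ * b ^ 2 := by
      field_simp
      ring
    nlinarith
  have h12 : (1 + η) * a ^ 2 ≤ (1 + η) * (q * (R * e) + R * ((1 - q) / 8 * e) + c * I1) := by
    gcongr
    exact h1.trans hmaj
  have h13 : (1 + η⁻¹) * b ^ 2 ≤ (1 + η⁻¹) * m := by gcongr
  have h14 : (1 + η) * (q + (1 - q) / 8) ≤ 1 - 3 * (1 - q) / 8 := by
    rw [hη]; nlinarith
  have h15 : 0 ≤ R * e := by positivity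
  have h16 := mul_le_mul_of_nonneg_right h14 h15
  have h17 : C ≤ C * e := le_mul_of_one_le_right hC0 he1
  have h18 : C * e = R * e * (3 * (1 - q) / 8) := by rw [← hRC]; ring
  have h19 : (1 + η) * (q * (R * e) + R * ((1 - q) / 8 * e) + c * I1) + (1 + η⁻¹) * m =
      (1 + η) * (q + (1 - q) / 8) * (R * e) + C := by rw [hC]; ring
  linarith

end

/-! ### Fixed points by Picard iteration under an Osgood condition -/

section

section FixedPoint

variable {E : Type*} [NormedAddCommGroup E] {r T : ℝ} {φ : ℝ → E}

/-- Continuous curves on `[-r, T]` with initial segment `φ`. -/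
def IsAdmissible (r T : ℝ) (φ x : ℝ → E) : Prop :=
  ContinuousOn x (Icc (-r) T) ∧ ∀ t ∈ Icc (-r) 0, x t = φ t

/-- Continuation of the initial segment `φ` by the curve `v`. -/
def glue (φ v : ℝ → E) (t : ℝ) : E := if t ≤ 0 then φ t else v t

theorem isAdmissible_glue (hr : 0 ≤ r) (hT : 0 ≤ T) (hφ : ContinuousOn φ (Icc (-r) 0)) {v : ℝ → E}
    (hv : ContinuousOn v (Icc 0 T)) (hv0 : v 0 = φ 0) : IsAdmissible r T φ (glue φ v) := by
  have e2 : EqOn (glue φ v) v (Icc 0 T) := fun t ht => by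
    rcases eq_or_lt_of_le ht.1 with h | h
    · simp [glue, ← h, hv0]
    · simp [glue, h.not_ge]
  have e1 : ∀ t ∈ Icc (-r) 0, glue φ v t = φ t := fun t ht => by simp [glue, ht.2]
  refine ⟨?_, e1⟩
  have : Icc (-r) T = Icc (-r) 0 ∪ Icc 0 T := (Icc_union_Icc_eq_Icc (by linarith) hT).symm
  rw [this]
  exact (hφ.congr e1).union_of_isClosed (hv.congr e2) isClosed_Icc isClosed_Icc

/-- The running supremum of `w` over `[-r, s]`. -/
theorem exists_running_sup (hr : 0 ≤ r) {κ : Type*} {p : κ → Prop} (hp : ∃ k, p k)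
    {w : κ → ℝ → ℝ} {B : ℝ} (hw0 : ∀ k, ∀ τ ∈ Icc (-r) T, 0 ≤ w k τ)
    (hB : ∀ k, p k → ∀ τ ∈ Icc (-r) T, w k τ ≤ B) :
    ∃ z : ℝ → ℝ, MonotoneOn z (Icc 0 T) ∧ (∀ s ∈ Icc 0 T, 0 ≤ z s) ∧
      (∀ s ∈ Icc 0 T, ∀ k, p k → ∀ τ ∈ Icc (-r) s, w k τ ≤ z s) ∧
      ∀ s ∈ Icc 0 T, ∀ b, (∀ k, p k → ∀ τ ∈ Icc (-r) s, w k τ ≤ b) → z s ≤ b := by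
  obtain ⟨k0, hk0⟩ := hp
  set V : ℝ → Set ℝ := fun s => {y | ∃ k, p k ∧ ∃ τ ∈ Icc (-r) s, w k τ = y} with hV
  have hbdd : ∀ s ∈ Icc 0 T, BddAbove (V s) := by
    rintro s hs
    refine ⟨B, ?_⟩
    rintro _ ⟨k, hk, τ, hτ, rfl⟩
    exact hB k hk τ ⟨hτ.1, hτ.2.trans hs.2⟩
  have hne : ∀ s ∈ Icc 0 T, w k0 (-r) ∈ V s := fun s hs =>
    ⟨k0, hk0, -r, ⟨le_rfl, by linarith [hs.1]⟩, rfl⟩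
  refine ⟨fun s => sSup (V s), ?_, ?_, ?_, ?_⟩
  · intro a ha b hb hab
    refine csSup_le_csSup (hbdd b hb) ⟨_, hne a ha⟩ ?_
    rintro _ ⟨k, hk, τ, hτ, rfl⟩
    exact ⟨k, hk, τ, ⟨hτ.1, hτ.2.trans hab⟩, rfl⟩
  · intro s hs
    exact (hw0 k0 (-r) ⟨le_rfl, by linarith [hs.1, hs.2]⟩).trans (le_csSup (hbdd s hs) (hne s hs))
  · intro s hs k hk τ hτ
    exact le_csSup (hbdd s hs) ⟨k, hk, τ, hτ, rfl⟩
  · intro s hs b hb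
    refine csSup_le ⟨_, hne s hs⟩ ?_
    rintro _ ⟨k, hk, τ, hτ, rfl⟩
    exact hb k hk τ hτ

/-- Existence and uniqueness of a fixed point under an Osgood condition. -/
theorem exists_unique_fixedPoint_of_osgood [CompleteSpace E] {q c : ℝ} {G : ℝ → ℝ → ℝ}
    (hr : 0 ≤ r) (hT : 0 ≤ T) (hq0 : 0 ≤ q) (hq : q < 1) (hc : 0 ≤ c) (hG : IsConcaveModulus T G)
    (hG0 : ∀ t ∈ Icc 0 T, G t 0 = 0)
    (hGu : ∀ D : ℝ, 0 < D → ∀ z : ℝ → ℝ, (∀ t ∈ Icc 0 T, 0 ≤ z t) → z 0 = 0 →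
      IntegrableOn (fun s => G s (z s)) (Icc 0 T) →
      (∀ t ∈ Icc 0 T, z t ≤ D * ∫ s in (0 : ℝ)..t, G s (z s)) → ∀ t ∈ Icc 0 T, z t = 0)
    (hφ : ContinuousOn φ (Icc (-r) 0)) (Λ : (ℝ → E) → ℝ → E)
    (h1 : ∀ x, IsAdmissible r T φ x → ContinuousOn (Λ x) (Icc 0 T) ∧ Λ x 0 = φ 0)
    (h2 : ∀ x y, IsAdmissible r T φ x → IsAdmissible r T φ y → ∀ z : ℝ → ℝ,
      MonotoneOn z (Icc 0 T) → (∀ s ∈ Icc 0 T, 0 ≤ z s) →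
      (∀ s ∈ Icc 0 T, ∀ τ ∈ Icc (-r) s, ‖x τ - y τ‖ ^ 2 ≤ z s) →
      ∀ t ∈ Icc 0 T, ‖Λ x t - Λ y t‖ ^ 2 ≤ osgoodMajorant q c G z t) :
    ∃ x, IsAdmissible r T φ x ∧ EqOn (Λ x) x (Icc 0 T) ∧
      ∀ y, IsAdmissible r T φ y → EqOn (Λ y) y (Icc 0 T) → EqOn y x (Icc (-r) T) := by
  have hTm : T ∈ Icc 0 T := ⟨hT, le_rfl⟩
  have h0m : (0 : ℝ) ∈ Icc (-r) 0 := ⟨by linarith, le_rfl⟩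
  have hsub : Icc 0 T ⊆ Icc (-r) T := Icc_subset_Icc_left (by linarith)
  have huniq : ∀ x y, IsAdmissible r T φ x → EqOn (Λ x) x (Icc 0 T) → IsAdmissible r T φ y →
      EqOn (Λ y) y (Icc 0 T) → EqOn y x (Icc (-r) T) := by
    intro x y hx hxΛ hy hyΛ
    obtain ⟨B, hB⟩ := isCompact_Icc.exists_bound_of_continuousOn
      ((hx.1.sub hy.1).norm.pow 2)
    -- The running supremum dominates the values at delayed times and is monotone, hence measurable.
    -- A one-point index set suffices for a single pair of curves.
    obtain ⟨z, hzm, hz0, hz, hzl⟩ := exists_running_sup (T := T) hr (κ := Unit) (p := fun _ => True)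
      ⟨(), trivial⟩ (w := fun _ τ => ‖x τ - y τ‖ ^ 2) (B := B) (fun _ _ _ => by positivity)
      (fun _ _ τ hτ => (le_abs_self _).trans (hB τ hτ))
    have hz' : ∀ s ∈ Icc 0 T, ∀ τ ∈ Icc (-r) s, ‖x τ - y τ‖ ^ 2 ≤ z s := fun s hs τ hτ =>
      hz s hs () trivial τ hτ
    have hle : ∀ t ∈ Icc 0 T, z t ≤ osgoodMajorant q c G z t := by
      intro t ht
      refine hzl t ht _ fun _ _ τ hτ => ?_
      rcases le_total τ 0 with h | h
      · simp only [hx.2 τ ⟨hτ.1, h⟩, hy.2 τ ⟨hτ.1, h⟩, sub_self, norm_zero]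
        simpa using osgoodMajorant_nonneg hq0 hc hG hz0 ht
      · have hτT : τ ∈ Icc 0 T := ⟨h, hτ.2.trans ht.2⟩
        have := h2 x y hx hy z hzm hz0 hz' τ hτT
        rw [hxΛ hτT, hyΛ hτT] at this
        exact this.trans (osgoodMajorant_monotoneOn hq0 hc hT hG hzm hz0 hτT ht hτ.2)
    have hzero := eq_zero_of_le_osgoodMajorant hq hc hT hG hGu hzm hz0 hle T hTm
    intro τ hτ
    have h3 := hz' T hTm τ hτ
    rw [hzero] at h3
    have h4 : ‖x τ - y τ‖ = 0 := by
      have := norm_nonneg (x τ - y τ)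
      nlinarith
    exact (sub_eq_zero.1 (norm_eq_zero.1 h4)).symm
  -- the Picard iteration
  set X : ℕ → ℝ → E := fun n => (fun x => glue φ (Λ x))^[n] (glue φ fun _ => φ 0) with hX
  have hXs : ∀ n, X (n + 1) = glue φ (Λ (X n)) := fun n => by
    simp only [hX, Function.iterate_succ_apply']
  have hadm : ∀ n, IsAdmissible r T φ (X n) := by
    intro n
    induction n with
    | zero => exact isAdmissible_glue hr hT hφ continuousOn_const rfl
    | succ n ih =>
      rw [hXs]
      exact isAdmissible_glue hr hT hφ (h1 _ ih).1 (h1 _ ih).2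
  have hXΛ : ∀ n, ∀ t ∈ Icc 0 T, X (n + 1) t = Λ (X n) t := by
    intro n t ht
    rw [hXs]
    rcases eq_or_lt_of_le ht.1 with h | h
    · simp [glue, ← h, (h1 _ (hadm n)).2]
    · simp [glue, h.not_ge]
  -- uniform bound
  obtain ⟨m, hm⟩ := isCompact_Icc.exists_bound_of_continuousOn
    (((h1 _ (hadm 0)).1.sub ((hadm 0).1.mono hsub)).norm.pow 2)
  have hm' : ∀ t ∈ Icc 0 T, ‖Λ (X 0) t - X 0 t‖ ^ 2 ≤ m := fun t ht =>
    (le_abs_self _).trans (hm t ht)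
  have hm0 : 0 ≤ m := (by positivity : (0 : ℝ) ≤ ‖Λ (X 0) T - X 0 T‖ ^ 2).trans (hm' T hTm)
  obtain ⟨R, w, hR, hw, hRw⟩ := exists_weight_osgoodMajorant hq hc hT hG hm0
  -- The curve R e^{ws} is a barrier: splitting X (n+1) - X 0 into Λ (X n) - Λ (X 0) and Λ (X 0) - X
  -- 0 shows that the bound is inherited by the next iterate.
  have hbound : ∀ n, ∀ s ∈ Icc 0 T, ∀ τ ∈ Icc (-r) s,
      ‖X n τ - X 0 τ‖ ^ 2 ≤ R * Real.exp (w * s) := by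
    intro n
    induction n with
    | zero => intro s _ τ _; simp; positivity
    | succ n ih =>
      intro s hs τ hτ
      rcases le_total τ 0 with h | h
      · rw [(hadm _).2 τ ⟨hτ.1, h⟩, (hadm _).2 τ ⟨hτ.1, h⟩]; simp; positivity
      · have hτT : τ ∈ Icc 0 T := ⟨h, hτ.2.trans hs.2⟩
        have h3 := h2 _ _ (hadm n) (hadm 0) (fun s => R * Real.exp (w * s))
          (fun a _ b _ hab => by simp only; gcongr) (fun s _ => by positivity) ih τ hτT
        have h4 := hRw τ hτT _ _ h3 (hm' τ hτT)
        have h5 : ‖X (n + 1) τ - X 0 τ‖ ≤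
            ‖Λ (X n) τ - Λ (X 0) τ‖ + ‖Λ (X 0) τ - X 0 τ‖ := by
          rw [hXΛ n τ hτT]
          exact norm_sub_le_norm_sub_add_norm_sub _ _ _
        calc ‖X (n + 1) τ - X 0 τ‖ ^ 2 ≤ _ := pow_le_pow_left₀ (norm_nonneg _) h5 2
          _ ≤ _ := h4
          _ ≤ _ := by gcongr; exact hτ.2
  set B := 4 * (R * Real.exp (w * T)) with hBdef
  have hB0 : 0 ≤ B := by positivity
  have hXB : ∀ a b, ∀ τ ∈ Icc (-r) T, ‖X a τ - X b τ‖ ^ 2 ≤ B := by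
    intro a b τ hτ
    have h3 := hbound a T hTm τ hτ
    have h4 := hbound b T hTm τ hτ
    have h5 : ‖X a τ - X b τ‖ ≤ ‖X a τ - X 0 τ‖ + ‖X b τ - X 0 τ‖ := by
      rw [← norm_neg (X b τ - X 0 τ), neg_sub]
      exact norm_sub_le_norm_sub_add_norm_sub _ _ _
    have h6 := pow_le_pow_left₀ (norm_nonneg _) h5 2
    nlinarith [sq_nonneg (‖X a τ - X 0 τ‖ - ‖X b τ - X 0 τ‖)]
  -- oscillation of the tails
  have hosc := fun n : ℕ => exists_running_sup (T := T) hr (κ := ℕ × ℕ)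
    (p := fun k => n ≤ k.1 ∧ n ≤ k.2) ⟨(n, n), le_rfl, le_rfl⟩
    (w := fun k τ => ‖X k.1 τ - X k.2 τ‖ ^ 2) (B := B) (fun _ _ _ => by positivity)
    (fun k _ τ hτ => hXB k.1 k.2 τ hτ)
  choose z hzm hz0 hz hzl using hosc
  have hzB : ∀ n, ∀ s ∈ Icc 0 T, z n s ≤ B := fun n s hs =>
    hzl n s hs B fun k _ τ hτ => hXB k.1 k.2 τ ⟨hτ.1, hτ.2.trans hs.2⟩
  have hanti : ∀ s ∈ Icc 0 T, Antitone fun n => z n s := fun s hs a b hab =>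
    hzl b s hs _ fun k hk τ hτ => hz a s hs k ⟨hab.trans hk.1, hab.trans hk.2⟩ τ hτ
  -- Indices at least n + 1 are shifted down by one, so the tail oscillation of the images is
  -- controlled by that of the preceding tail. On [-r, 0] all iterates agree.
  have hrec : ∀ n, ∀ t ∈ Icc 0 T, z (n + 1) t ≤ osgoodMajorant q c G (z n) t := by
    intro n t ht
    refine hzl (n + 1) t ht _ ?_
    rintro ⟨a, b⟩ ⟨ha, hb⟩ τ hτ
    simp only at ha hb ⊢
    rcases le_total τ 0 with h | h
    · rw [(hadm _).2 τ ⟨hτ.1, h⟩, (hadm _).2 τ ⟨hτ.1, h⟩]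
      simpa using osgoodMajorant_nonneg hq0 hc hG (hz0 n) ht
    · obtain ⟨a, rfl⟩ := Nat.exists_eq_add_of_le' (Nat.one_le_of_lt (Nat.lt_of_succ_le ha))
      obtain ⟨b, rfl⟩ := Nat.exists_eq_add_of_le' (Nat.one_le_of_lt (Nat.lt_of_succ_le hb))
      have hτT : τ ∈ Icc 0 T := ⟨h, hτ.2.trans ht.2⟩
      rw [hXΛ a τ hτT, hXΛ b τ hτT]
      exact (h2 _ _ (hadm a) (hadm b) (z n) (hzm n) (hz0 n)
        (fun s hs τ hτ => hz n s hs (a, b) ⟨by simpa using ha, by simpa using hb⟩ τ hτ) τ hτT).trans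
        (osgoodMajorant_monotoneOn hq0 hc hT hG (hzm n) (hz0 n) hτT ht hτ.2)
  have hlim : ∀ s ∈ Icc 0 T, Tendsto (fun n => z n s) atTop (𝓝 (⨅ n, z n s)) := fun s hs =>
    tendsto_atTop_ciInf (hanti s hs) ⟨0, by rintro _ ⟨n, rfl⟩; exact hz0 n s hs⟩
  -- The oscillations decrease in n, so they converge pointwise; their limit satisfies the
  -- self-referential inequality and therefore vanishes.
  have hzero : Tendsto (fun n => z n T) atTop (𝓝 0) := by
    have h3 : ∀ t ∈ Icc 0 T, ⨅ n, z n t = 0 := by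
      refine eq_zero_of_le_osgoodMajorant hq hc hT hG hGu (z := fun t => ⨅ n, z n t) ?_ ?_ ?_
      · intro a ha b hb hab
        exact le_of_tendsto_of_tendsto' (hlim a ha) (hlim b hb) fun n => hzm n ha hb hab
      · intro s hs
        exact ge_of_tendsto' (hlim s hs) fun n => hz0 n s hs
      · intro t ht
        exact le_of_tendsto_of_tendsto' ((tendsto_add_atTop_iff_nat 1).2 (hlim t ht))
          (tendsto_osgoodMajorant hG hzm hz0 hzB hB0 hlim ht) fun n => hrec n t ht
    simpa only [h3 T hTm] using hlim T hTm
  -- the limit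
  have hcau : ∀ τ ∈ Icc (-r) T, CauchySeq fun n => X n τ := by
    intro τ hτ
    refine cauchySeq_of_le_tendsto_0 (fun n => √(z n T)) (fun a b n ha hb => ?_) ?_
    · rw [dist_eq_norm]
      exact Real.le_sqrt_of_sq_le (hz n T hTm (a, b) ⟨ha, hb⟩ τ hτ)
    · simpa [Function.comp_def] using (Real.continuous_sqrt.tendsto 0).comp hzero
  choose! x hx using fun τ (hτ : τ ∈ Icc (-r) T) => cauchySeq_tendsto_of_complete (hcau τ hτ)
  have hxn : ∀ n, ∀ τ ∈ Icc (-r) T, ‖x τ - X n τ‖ ^ 2 ≤ z n T := by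
    intro n τ hτ
    have h3 : Tendsto (fun a => ‖X a τ - X n τ‖ ^ 2) atTop (𝓝 (‖x τ - X n τ‖ ^ 2)) :=
      (((hx τ hτ).sub_const _).norm).pow 2
    refine le_of_tendsto h3 ?_
    filter_upwards [eventually_ge_atTop n] with a ha
    exact hz n T hTm (a, n) ⟨ha, le_rfl⟩ τ hτ
  have hxadm : IsAdmissible r T φ x := by
    refine ⟨?_, fun t ht => ?_⟩
    · have h3 : TendstoUniformlyOn X x atTop (Icc (-r) T) := by
        rw [Metric.tendstoUniformlyOn_iff]
        intro ε hε
        filter_upwards [hzero.eventually (gt_mem_nhds (by positivity : 0 < ε ^ 2))] with n hn τ hτ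
        rw [dist_eq_norm]
        exact lt_of_pow_lt_pow_left₀ 2 hε.le ((hxn n τ hτ).trans_lt hn)
      exact h3.continuousOn (Frequently.of_forall fun n => (hadm n).1)
    · have ht' : t ∈ Icc (-r) T := ⟨ht.1, ht.2.trans hT⟩
      exact tendsto_nhds_unique (hx t ht') (tendsto_const_nhds.congr fun n => ((hadm n).2 t ht).symm)
  have hfix : EqOn (Λ x) x (Icc 0 T) := by
    intro t ht
    -- Inserting the constant functions z n T → 0 as bounds for ‖x - X n‖² gives Λ (X n) → Λ x; here
    -- G(t, 0) = 0 is needed.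
    have h3 : Tendsto (fun n => osgoodMajorant q c G (fun _ => z n T) t) atTop (𝓝 0) := by
      have h4 := tendsto_osgoodMajorant (q := q) (c := c) hG (z := fun n _ => z n T)
        (z' := fun _ => 0) (B := B) (fun n _ _ _ _ _ => le_rfl) (fun n _ _ => hz0 n T hTm)
        (fun n _ _ => hzB n T hTm) hB0 (fun _ _ => hzero) ht
      have h5 : osgoodMajorant q c G (fun _ => 0) t = 0 := by
        have : ∫ s in (0 : ℝ)..t, G s 0 = 0 := by
          rw [intervalIntegral.integral_congr (g := fun _ => 0)]
          · simp
          · intro s hs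
            rw [uIcc_of_le ht.1] at hs
            exact hG0 s ⟨hs.1, hs.2.trans ht.2⟩
        simp [osgoodMajorant, this]
      rwa [h5] at h4
    have h6 : Tendsto (fun n => ‖Λ x t - Λ (X n) t‖ ^ 2) atTop (𝓝 0) :=
      squeeze_zero (fun n => by positivity) (fun n => h2 _ _ hxadm (hadm n) (fun _ => z n T)
        (fun _ _ _ _ _ => le_rfl) (fun _ _ => hz0 n T hTm)
        (fun s hs τ hτ => hxn n τ ⟨hτ.1, hτ.2.trans hs.2⟩) t ht) h3
    have h7 : Tendsto (fun n => Λ (X n) t) atTop (𝓝 (Λ x t)) := by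
      rw [tendsto_iff_norm_sub_tendsto_zero]
      have h8 := (Real.continuous_sqrt.tendsto 0).comp h6
      simpa [Function.comp_def, Real.sqrt_sq, norm_sub_rev] using h8
    have h9 : Tendsto (fun n => Λ (X n) t) atTop (𝓝 (x t)) :=
      ((tendsto_add_atTop_iff_nat 1).2 (hx t (hsub ht))).congr fun n => hXΛ n t ht
    exact tendsto_nhds_unique h7 h9
  exact ⟨x, hxadm, hfix, fun y hy hyΛ => huniq x y hxadm hfix hy hyΛ⟩

end FixedPoint

end

/-! ### Superposition operators on L²(Ω; X) -/

section

section Superposition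

variable {Ω : Type*} [MeasurableSpace Ω] {P : Measure Ω} [IsProbabilityMeasure P]
  {X : Type*} [NormedAddCommGroup X] [InnerProductSpace ℝ X]

theorem superpose_of_memLp {F : X → X} {u : Lp X 2 P} (h : MemLp (fun ω => F (u ω)) 2 P) :
    superpose F u = h.toLp _ := dif_pos h

theorem coeFn_superpose {F : X → X} {u : Lp X 2 P} (h : MemLp (fun ω => F (u ω)) 2 P) :
    superpose F u =ᵐ[P] fun ω => F (u ω) := by
  rw [superpose_of_memLp h]
  exact h.coeFn_toLp

theorem memLp_comp_of_growth {F : X → X} (hF : Continuous F) {a : ℝ}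
    (ha : ∀ v, ‖F v‖ ^ 2 ≤ a * (‖v‖ ^ 2 + 1)) (u : Lp X 2 P) :
    MemLp (fun ω => F (u ω)) 2 P := by
  have h1 : MemLp (fun ω => √a * (‖u ω‖ + 1)) 2 P :=
    ((Lp.memLp u).norm.add (memLp_const 1)).const_mul _
  refine h1.mono' (hF.comp_aestronglyMeasurable (Lp.aestronglyMeasurable u))
    (Eventually.of_forall fun ω => ?_)
  have ha0 : 0 ≤ a := by
    have := ha 0
    simp only [norm_zero] at this
    nlinarith [sq_nonneg ‖F 0‖]
  refine abs_le_of_sq_le_sq' ?_ (by positivity) |>.2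
  rw [mul_pow, Real.sq_sqrt ha0]
  refine (ha _).trans (mul_le_mul_of_nonneg_left ?_ ha0)
  nlinarith [norm_nonneg (u ω)]

theorem superpose_clm (L : X →L[ℝ] X) {F : X → X} {u : Lp X 2 P}
    (h : MemLp (fun ω => F (u ω)) 2 P) :
    superpose (fun v => L (F v)) u = L.compLpL 2 P (superpose F u) := by
  have h' : MemLp (fun ω => L (F (u ω))) 2 P := L.comp_memLp' h
  refine Lp.ext ((coeFn_superpose h').trans ?_)
  filter_upwards [L.coeFn_compLpL (p := 2) (superpose F u), coeFn_superpose h] with ω h1 h2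
  rw [h1, h2]

theorem norm_sq_eq_integral_norm_sq (u : Lp X 2 P) : ‖u‖ ^ 2 = ∫ ω, ‖u ω‖ ^ 2 ∂P := by
  rw [← real_inner_self_eq_norm_sq, L2.inner_def]
  simp only [real_inner_self_eq_norm_sq]

theorem integrable_norm_sq (u : Lp X 2 P) : Integrable (fun ω => ‖u ω‖ ^ 2) P := by
  have := (Lp.memLp u).integrable_norm_pow (by norm_num)
  simpa using this

theorem norm_superpose_sub_le {F : X → X} {C : ℝ} (hC : ∀ v w, ‖F v - F w‖ ≤ C * ‖v - w‖)
    {u v : Lp X 2 P} (hu : MemLp (fun ω => F (u ω)) 2 P) (hv : MemLp (fun ω => F (v ω)) 2 P) :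
    ‖superpose F u - superpose F v‖ ≤ C * ‖u - v‖ := by
  refine Lp.norm_le_mul_norm_of_ae_le_mul ?_
  filter_upwards [Lp.coeFn_sub (superpose F u) (superpose F v), Lp.coeFn_sub u v,
    coeFn_superpose hu, coeFn_superpose hv] with ω h1 h2 h3 h4
  rw [h1, h2, Pi.sub_apply, Pi.sub_apply, h3, h4]
  exact hC _ _

theorem norm_sq_superpose_le {F : X → X} {a : ℝ} (ha : ∀ v, ‖F v‖ ^ 2 ≤ a * (‖v‖ ^ 2 + 1))
    {u : Lp X 2 P} (hu : MemLp (fun ω => F (u ω)) 2 P) :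
    ‖superpose F u‖ ^ 2 ≤ a * (‖u‖ ^ 2 + 1) := by
  rw [norm_sq_eq_integral_norm_sq, norm_sq_eq_integral_norm_sq]
  have h1 : a * (∫ ω, ‖u ω‖ ^ 2 ∂P + 1) = ∫ ω, a * (‖u ω‖ ^ 2 + 1) ∂P := by
    rw [integral_const_mul, integral_add (integrable_norm_sq u) (integrable_const 1)]
    simp
  rw [h1]
  refine integral_mono_ae (integrable_norm_sq _)
    (((integrable_norm_sq u).add (integrable_const 1)).const_mul a) ?_
  filter_upwards [coeFn_superpose hu] with ω h2
  rw [h2]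
  exact ha _

/-- Jensen's inequality for a superposition operator with a concave modulus of continuity. -/
theorem norm_sq_superpose_sub_le {T : ℝ} {G : ℝ → ℝ → ℝ} (hG : IsConcaveModulus T G) {s : ℝ}
    (hs : s ∈ Icc 0 T) {F : X → X} (hF : ∀ v w, ‖F v - F w‖ ^ 2 ≤ G s (‖v - w‖ ^ 2))
    {u v : Lp X 2 P} (hu : MemLp (fun ω => F (u ω)) 2 P) (hv : MemLp (fun ω => F (v ω)) 2 P) :
    ‖superpose F u - superpose F v‖ ^ 2 ≤ G s (‖u - v‖ ^ 2) := by
  rw [norm_sq_eq_integral_norm_sq, norm_sq_eq_integral_norm_sq]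
  have hi : Integrable (fun ω => G s (‖(u - v : Lp X 2 P) ω‖ ^ 2)) P := by
    have hc : Continuous fun y : ℝ => G s (max y 0) :=
      (hG.continuousOn s hs).comp_continuous (f := fun y : ℝ => max y 0) (by fun_prop)
        (fun y => mem_Ici.2 (le_max_right y 0))
    have hm : AEStronglyMeasurable (fun ω => G s (‖(u - v : Lp X 2 P) ω‖ ^ 2)) P := by
      refine (hc.comp_aestronglyMeasurable (integrable_norm_sq (u - v)).1).congr
        (Eventually.of_forall fun ω => ?_)
      simp only [max_eq_left (sq_nonneg ‖(u - v : Lp X 2 P) ω‖)]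
    refine (((integrable_const 1).add (integrable_norm_sq (u - v))).const_mul (G s 1)).mono' hm
      (Eventually.of_forall fun ω => ?_)
    rw [Real.norm_of_nonneg (hG.nonneg s hs _ (by positivity))]
    exact hG.le_linear hs (by positivity)
  refine le_trans (integral_mono_ae (integrable_norm_sq _) hi ?_)
    ((hG.concaveOn s hs).le_map_integral (hG.continuousOn s hs) isClosed_Ici
      (Eventually.of_forall fun ω => mem_Ici.2 (sq_nonneg _)) (integrable_norm_sq (u - v)) hi)
  filter_upwards [Lp.coeFn_sub (superpose F u) (superpose F v), Lp.coeFn_sub u v,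
    coeFn_superpose hu, coeFn_superpose hv] with ω h1 h2 h3 h4
  rw [h1, h2, Pi.sub_apply, Pi.sub_apply, h3, h4]
  exact hF _ _

/-- A map with a modulus of continuity vanishing at `0` is continuous. -/
theorem continuous_of_modulus {E E' : Type*} [NormedAddCommGroup E] [NormedAddCommGroup E'] {T : ℝ} {G : ℝ → ℝ → ℝ} (hG : IsConcaveModulus T G) {s : ℝ}
    (hs : s ∈ Icc 0 T) (hG0 : G s 0 = 0) {F : E → E'}
    (hF : ∀ v w, ‖F v - F w‖ ^ 2 ≤ G s (‖v - w‖ ^ 2)) : Continuous F := by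
  rw [continuous_iff_continuousAt]
  intro u
  rw [ContinuousAt, tendsto_iff_norm_sub_tendsto_zero]
  have h1 : Tendsto (fun v : E => ‖v - u‖ ^ 2) (𝓝 u) (𝓝[Ici 0] 0) := by
    refine tendsto_nhdsWithin_iff.2 ⟨?_, Eventually.of_forall fun v => mem_Ici.2 (sq_nonneg _)⟩
    have : Continuous fun v : E => ‖v - u‖ ^ 2 := by fun_prop
    simpa using this.tendsto u
  have h2 : Tendsto (fun v : E => G s (‖v - u‖ ^ 2)) (𝓝 u) (𝓝 0) := by
    have := ((hG.continuousOn s hs) 0 (mem_Ici.2 le_rfl)).tendsto.comp h1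
    rwa [hG0] at this
  have h3 : Tendsto (fun v : E => ‖F v - F u‖ ^ 2) (𝓝 u) (𝓝 0) :=
    squeeze_zero (fun v => by positivity) (fun v => hF v u) h2
  simpa [Function.comp_def, Real.sqrt_sq] using (Real.continuous_sqrt.tendsto 0).comp h3

theorem continuous_superpose_of_modulus {T : ℝ} {G : ℝ → ℝ → ℝ} (hG : IsConcaveModulus T G) {s : ℝ}
    (hs : s ∈ Icc 0 T) (hG0 : G s 0 = 0) {F : X → X}
    (hF : ∀ v w, ‖F v - F w‖ ^ 2 ≤ G s (‖v - w‖ ^ 2))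
    (hL : ∀ u : Lp X 2 P, MemLp (fun ω => F (u ω)) 2 P) :
    Continuous fun u : Lp X 2 P => superpose F u :=
  continuous_of_modulus hG hs hG0 fun u v => norm_sq_superpose_sub_le hG hs hF (hL u) (hL v)

/-- A family of superposition operators is jointly continuous along a curve. -/
theorem continuousOn_superpose {T : ℝ} {F : ℝ → X → X} {a C : ℝ}
    (hF : ContinuousOn (fun p : ℝ × X => F p.1 p.2) (Icc 0 T ×ˢ univ))
    (ha : ∀ t ∈ Icc 0 T, ∀ v, ‖F t v‖ ^ 2 ≤ a * (‖v‖ ^ 2 + 1))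
    (hC : ∀ t ∈ Icc 0 T, ∀ v w, ‖F t v - F t w‖ ≤ C * ‖v - w‖)
    (hL : ∀ t ∈ Icc 0 T, ∀ u : Lp X 2 P, MemLp (fun ω => F t (u ω)) 2 P)
    {y : ℝ → Lp X 2 P} (hy : ContinuousOn y (Icc 0 T)) :
    ContinuousOn (fun t => superpose (F t) (y t)) (Icc 0 T) := by
  intro t₀ ht₀
  have ha0 : 0 ≤ a := by
    have := ha t₀ ht₀ 0
    simp only [norm_zero] at this
    nlinarith [sq_nonneg ‖F t₀ 0‖]
  -- The time parameter is moved first with the argument frozen, by dominated convergence; the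
  -- change of argument is then controlled by the uniform Lipschitz bound.
  have h1 : Tendsto (fun t => superpose (F t) (y t₀)) (𝓝[Icc 0 T] t₀)
      (𝓝 (superpose (F t₀) (y t₀))) := by
    rw [Lp.tendsto_Lp_iff_tendsto_eLpNorm']
    have hb : ∀ t ∈ Icc 0 T, ∀ v, ‖F t v‖ ≤ √a * (‖v‖ + 1) := fun t ht v => by
      refine abs_le_of_sq_le_sq' ?_ (by positivity) |>.2
      rw [mul_pow, Real.sq_sqrt ha0]
      refine (ha t ht _).trans (mul_le_mul_of_nonneg_left ?_ ha0)
      nlinarith [norm_nonneg v]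
    have h2 := tendsto_eLpNorm_two_of_dominated (μ := P) (l := 𝓝[Icc 0 T] t₀)
      (F := fun t ω => F t (y t₀ ω)) (f := fun ω => F t₀ (y t₀ ω))
      (fun ω => ‖2 * (√a * (‖y t₀ ω‖ + 1))‖ₑ) ?_
      (eventually_mem_nhdsWithin.mono fun t ht => (hL t ht _).1) (hL t₀ ht₀ _).1
      (eventually_mem_nhdsWithin.mono fun t ht => Eventually.of_forall fun ω => ?_)
      (Eventually.of_forall fun ω => ?_)
    · refine h2.congr' ?_
      filter_upwards [eventually_mem_nhdsWithin] with t ht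
      refine eLpNorm_congr_ae ?_
      filter_upwards [coeFn_superpose (hL t ht (y t₀)), coeFn_superpose (hL t₀ ht₀ (y t₀))]
        with ω h3 h4
      simp only [Pi.sub_apply, h3, h4]
    · have h5 : MemLp (fun ω => 2 * (√a * (‖y t₀ ω‖ + 1))) 2 P :=
        (((Lp.memLp (y t₀)).norm.add (memLp_const 1)).const_mul _).const_mul _
      rw [← eLpNorm_two_sq]
      exact (ENNReal.pow_lt_top h5.2).ne
    · refine enorm_le_iff_norm_le.2 ?_
      rw [Real.norm_of_nonneg (by positivity)]
      exact (norm_sub_le _ _).trans (by linarith [hb t ht (y t₀ ω), hb t₀ ht₀ (y t₀ ω)])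
    · have h6 : ContinuousOn (fun t => F t (y t₀ ω)) (Icc 0 T) :=
        hF.comp (f := fun t => (t, y t₀ ω)) (by fun_prop) fun t ht => ⟨ht, mem_univ _⟩
      exact h6 t₀ ht₀
  have h2 : Tendsto (fun t => superpose (F t) (y t) - superpose (F t) (y t₀)) (𝓝[Icc 0 T] t₀)
      (𝓝 0) := by
    rw [tendsto_zero_iff_norm_tendsto_zero]
    have h3 : Tendsto (fun t => C * ‖y t - y t₀‖) (𝓝[Icc 0 T] t₀) (𝓝 0) := by
      have := (tendsto_iff_norm_sub_tendsto_zero.1 (hy t₀ ht₀).tendsto).const_mul C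
      simpa using this
    refine squeeze_zero' (Eventually.of_forall fun t => norm_nonneg _) ?_ h3
    filter_upwards [eventually_mem_nhdsWithin] with t ht
    exact norm_superpose_sub_le (hC t ht) (hL t ht _) (hL t ht _)
  have := h2.add h1
  simpa [ContinuousWithinAt] using this

theorem continuous_indicatorConstLp {s : Set Ω} (hs : MeasurableSet s) :
    Continuous fun c : X => indicatorConstLp 2 hs (measure_ne_top P s) c := by
  refine continuous_iff_continuousAt.2 fun c => ?_
  rw [ContinuousAt, tendsto_iff_norm_sub_tendsto_zero]
  have h1 : Tendsto (fun d : X => ‖d - c‖ * P.real s ^ (1 / (2 : ℝ≥0∞).toReal)) (𝓝 c) (𝓝 0) := by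
    have : Continuous fun d : X => ‖d - c‖ * P.real s ^ (1 / (2 : ℝ≥0∞).toReal) := by fun_prop
    simpa using this.tendsto c
  refine squeeze_zero (fun _ => norm_nonneg _) (fun d => ?_) h1
  rw [indicatorConstLp_sub]
  exact norm_indicatorConstLp_le

/-- Measurability in the parameter holds for constants on a set, passes to sums with disjoint
supports, and is closed under L² limits by continuity of the superposition. Since F a 0 = 0,
superposition is additive over disjoint supports. -/
theorem aestronglyMeasurable_superpose_of_map_zero {α : Type*} [MeasurableSpace α] {ν : Measure α}
    {F : α → X → X} (hm : ∀ v, AEStronglyMeasurable (fun a => F a v) ν)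
    (hc : ∀ᵐ a ∂ν, Continuous fun u : Lp X 2 P => superpose (F a) u)
    (hL : ∀ᵐ a ∂ν, ∀ u : Lp X 2 P, MemLp (fun ω => F a (u ω)) 2 P) (h0 : ∀ a, F a 0 = 0)
    (u : Lp X 2 P) : AEStronglyMeasurable (fun a => superpose (F a) u) ν := by
  refine Lp.induction (E := X) (p := 2) (μ := P) (by norm_num)
    (fun u => AEStronglyMeasurable (fun a => superpose (F a) u) ν) ?_ ?_ ?_ u
  · intro c s hs hμs
    rw [Lp.simpleFunc.coe_indicatorConst]
    refine ((continuous_indicatorConstLp (P := P) hs).comp_aestronglyMeasurable (hm c)).congr ?_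
    filter_upwards [hL] with a ha
    refine Lp.ext ?_
    filter_upwards [indicatorConstLp_coeFn (p := 2) (hs := hs) (hμs := measure_ne_top P s)
      (c := F a c), coeFn_superpose (ha (indicatorConstLp 2 hs hμs.ne c)),
      indicatorConstLp_coeFn (p := 2) (hs := hs) (hμs := hμs.ne) (c := c)] with ω h1 h2 h3
    rw [h1, h2, h3]
    by_cases hω : ω ∈ s <;> simp [hω, h0]
  · intro v w hv hw hvw h1 h2
    refine (h1.add h2).congr ?_
    filter_upwards [hL] with a ha
    refine Lp.ext ?_
    filter_upwards [coeFn_superpose (ha (hv.toLp v)), coeFn_superpose (ha (hw.toLp w)),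
      coeFn_superpose (ha (hv.toLp v + hw.toLp w)), Lp.coeFn_add (hv.toLp v) (hw.toLp w),
      Lp.coeFn_add (superpose (F a) (hv.toLp v)) (superpose (F a) (hw.toLp w)),
      hv.coeFn_toLp, hw.coeFn_toLp] with ω e1 e2 e3 e4 e5 e6 e7
    rw [Pi.add_apply, e5, Pi.add_apply, e1, e2, e3, e4, Pi.add_apply, e6, e7]
    by_cases hω : v ω = 0
    · simp [hω, h0]
    · have : w ω = 0 := by
        by_contra hne
        exact (Set.disjoint_left.1 hvw) hω hne
      simp [this, h0]
  · refine isSeqClosed_iff_isClosed.1 fun un u' hun hlim => ?_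
    exact aestronglyMeasurable_of_tendsto_ae atTop hun
      (hc.mono fun a ha => (ha.tendsto u').comp hlim)

/-- Subtracting the value at 0 reduces to the normalized case; the constant random variable F a 0
depends measurably on a. -/
theorem aestronglyMeasurable_superpose {α : Type*} [MeasurableSpace α] {ν : Measure α}
    {F : α → X → X} (hm : ∀ v, AEStronglyMeasurable (fun a => F a v) ν)
    (hc : ∀ᵐ a ∂ν, Continuous fun u : Lp X 2 P => superpose (F a) u)
    (hL : ∀ᵐ a ∂ν, ∀ u : Lp X 2 P, MemLp (fun ω => F a (u ω)) 2 P)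
    (u : Lp X 2 P) : AEStronglyMeasurable (fun a => superpose (F a) u) ν := by
  have hL' : ∀ᵐ a ∂ν, ∀ u : Lp X 2 P, MemLp (fun ω => F a (u ω) - F a 0) 2 P :=
    hL.mono fun a ha u => (ha u).sub (memLp_const _)
  have e : ∀ᵐ a ∂ν, ∀ u : Lp X 2 P, superpose (fun v => F a v - F a 0) u =
      superpose (F a) u - Lp.const 2 P (F a 0) := by
    filter_upwards [hL, hL'] with a h1 h2 u
    refine Lp.ext ?_
    filter_upwards [coeFn_superpose (h1 u),
      coeFn_superpose (F := fun v => F a v - F a 0) (h2 u),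
      Lp.coeFn_const (p := 2) (μ := P) (c := F a 0),
      Lp.coeFn_sub (superpose (F a) u) (Lp.const 2 P (F a 0))] with ω e1 e2 e3 e4
    rw [e2, e4, Pi.sub_apply, e1, e3]
    rfl
  have hcst : AEStronglyMeasurable (fun a => Lp.const 2 P (F a 0)) ν :=
    (Lp.constL (E := X) 2 P ℝ).continuous.comp_aestronglyMeasurable (hm 0)
  have h1 := aestronglyMeasurable_superpose_of_map_zero (P := P) (ν := ν)
    (F := fun a v => F a v - F a 0) (fun v => (hm v).sub (hm 0))
    (by
      filter_upwards [hc, e] with a h2 h3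
      simp only [h3]
      exact h2.sub continuous_const) hL' (fun a => sub_self _) u
  refine (h1.add hcst).congr ?_
  filter_upwards [e] with a ha
  simp only [Pi.add_apply, ha u, sub_add_cancel]

/-- Lifting bounded operators to `L²(Ω; X)` preserves strong continuity. -/
theorem continuous_compLpL_apply {V : ℝ → X →L[ℝ] X} {M : ℝ} (hM : ∀ τ, ‖V τ‖ ≤ M)
    (hV : ∀ x, Continuous fun τ => V τ x) (u : Lp X 2 P) :
    Continuous fun τ => (V τ).compLpL 2 P u := by
  refine continuous_iff_continuousAt.2 fun t₀ => ?_
  have hM0 : 0 ≤ M := (norm_nonneg _).trans (hM 0)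
  rw [ContinuousAt, Lp.tendsto_Lp_iff_tendsto_eLpNorm']
  have h2 := tendsto_eLpNorm_two_of_dominated (μ := P) (l := 𝓝 t₀)
    (F := fun t ω => V t (u ω)) (f := fun ω => V t₀ (u ω))
    (fun ω => ‖2 * (M * ‖u ω‖)‖ₑ) ?_
    (Eventually.of_forall fun t => (V t).continuous.comp_aestronglyMeasurable
      (Lp.aestronglyMeasurable u))
    ((V t₀).continuous.comp_aestronglyMeasurable (Lp.aestronglyMeasurable u))
    (Eventually.of_forall fun t => Eventually.of_forall fun ω => ?_)
    (Eventually.of_forall fun ω => (hV (u ω)).tendsto t₀)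
  · refine h2.congr fun t => eLpNorm_congr_ae ?_
    filter_upwards [(V t).coeFn_compLpL (p := 2) u, (V t₀).coeFn_compLpL (p := 2) u] with ω h3 h4
    simp only [Pi.sub_apply, h3, h4]
  · have h5 : MemLp (fun ω => 2 * (M * ‖u ω‖)) 2 P := ((Lp.memLp u).norm.const_mul _).const_mul _
    rw [← eLpNorm_two_sq]
    exact (ENNReal.pow_lt_top h5.2).ne
  · refine enorm_le_iff_norm_le.2 ?_
    rw [Real.norm_of_nonneg (by positivity)]
    have h6 : ∀ τ, ‖V τ (u ω)‖ ≤ M * ‖u ω‖ := fun τ =>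
      ((V τ).le_opNorm _).trans (by gcongr; exact hM τ)
    exact (norm_sub_le _ _).trans (by linarith [h6 t, h6 t₀])

theorem continuousOn_compLpL {V : ℝ → X →L[ℝ] X} {s : Set ℝ} (hV : ContinuousOn V s) :
    ContinuousOn (fun τ => (V τ).compLpL 2 P) s :=
  ((ContinuousLinearMap.compLpL₂ 2 P
    (ContinuousLinearMap.id ℝ (X →L[ℝ] X))).continuous.comp_continuousOn hV : _)

end Superposition

end

/-! ### Deterministic convolutions -/

section

section Convolution

variable {E : Type*} [NormedAddCommGroup E] [NormedSpace ℝ E]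

/-- Continuity of `t ↦ ∫₀ᵗ h(t, s) ds` under domination. -/
theorem continuousOn_integral_of_dominated {T : ℝ} {h : ℝ → ℝ → E} {b : ℝ → ℝ}
    (hb : IntegrableOn b (Ioc 0 T))
    (hm : ∀ t ∈ Icc 0 T, AEStronglyMeasurable (h t) (volume.restrict (Ioc 0 t)))
    (hbd : ∀ t ∈ Icc 0 T, ∀ s ∈ Ioc 0 t, ‖h t s‖ ≤ b s)
    (hc : ∀ s ∈ Ioc 0 T, Continuous fun t => h t s) :
    ContinuousOn (fun t => ∫ s in (0 : ℝ)..t, h t s) (Icc 0 T) ∧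
      ∀ t ∈ Icc 0 T, IntervalIntegrable (h t) volume 0 t := by
  have hb0 : ∀ t ∈ Icc 0 T, ∀ s ∈ Ioc 0 t, ‖(Iic t).indicator (h t) s‖ ≤ b s := fun t ht s hs =>
    (norm_indicator_le_norm_self _ _).trans (hbd t ht s hs)
  have hinter : ∀ t ∈ Icc 0 T, Ioc 0 T ∩ Iic t = Ioc 0 t := fun t ht => by
    rw [Ioc_inter_Iic, min_eq_right ht.2]
  refine ⟨?_, fun t ht => ?_⟩
  -- The variable endpoint becomes an indicator over the fixed interval, so dominated convergence
  -- applies; the indicator jumps only at s = t₀, a null set.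
  · have e : EqOn (fun t => ∫ s in (0 : ℝ)..t, h t s)
        (fun t => ∫ s in Ioc 0 T, (Iic t).indicator (h t) s) (Icc 0 T) := by
      intro t ht
      simp only
      rw [intervalIntegral.integral_of_le ht.1, setIntegral_indicator measurableSet_Iic,
        hinter t ht]
    refine ContinuousOn.congr ?_ e
    intro t₀ ht₀
    refine tendsto_integral_filter_of_dominated_convergence (fun s => ‖b s‖)
      (eventually_mem_nhdsWithin.mono fun t ht => ?_)
      (eventually_mem_nhdsWithin.mono fun t ht => ?_) hb.norm ?_
    · rw [aestronglyMeasurable_indicator_iff measurableSet_Iic, Measure.restrict_restrict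
        measurableSet_Iic, inter_comm, hinter t ht]
      exact hm t ht
    · refine (ae_restrict_mem measurableSet_Ioc).mono fun s hs => ?_
      by_cases hst : s ≤ t
      · exact (hb0 t ht s ⟨hs.1, hst⟩).trans (le_abs_self _)
      · rw [indicator_of_notMem (by simpa using hst)]
        simp
    · have hne : ∀ᵐ s ∂(volume.restrict (Ioc 0 T)), s ≠ t₀ :=
        ae_restrict_of_ae (by simp [ae_iff])
      filter_upwards [hne, ae_restrict_mem measurableSet_Ioc] with s hs hsT
      rcases lt_or_gt_of_ne hs with h1 | h1
      · rw [indicator_of_mem (mem_Iic.2 h1.le)]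
        refine (((hc s hsT).tendsto t₀).mono_left nhdsWithin_le_nhds).congr' ?_
        filter_upwards [nhdsWithin_le_nhds (lt_mem_nhds h1)] with t ht
        rw [indicator_of_mem (mem_Iic.2 (le_of_lt ht))]
      · rw [indicator_of_notMem (by simpa using h1)]
        refine tendsto_const_nhds.congr' ?_
        filter_upwards [nhdsWithin_le_nhds (gt_mem_nhds h1)] with t ht
        rw [indicator_of_notMem (by simpa using ht)]
  · rw [intervalIntegrable_iff_integrableOn_Ioc_of_le ht.1]
    exact (hb.mono_set (Ioc_subset_Ioc_right ht.2)).mono' (hm t ht)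
      ((ae_restrict_mem measurableSet_Ioc).mono fun s hs => hbd t ht s hs)

/-- Convolution of a bounded strongly continuous family with an integrable function. -/
theorem continuousOn_convolution {T M : ℝ} {V : ℝ → E →L[ℝ] E} (hM : ∀ τ, ‖V τ‖ ≤ M)
    (hV : ∀ x, Continuous fun τ => V τ x) {p : ℝ → E} (hp : IntegrableOn p (Ioc 0 T)) :
    ContinuousOn (fun t => ∫ s in (0 : ℝ)..t, V (t - s) (p s)) (Icc 0 T) ∧
      ∀ t ∈ Icc 0 T, IntervalIntegrable (fun s => V (t - s) (p s)) volume 0 t := by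
  refine continuousOn_integral_of_dominated (h := fun t s => V (t - s) (p s))
    (hp.norm.const_mul M) (fun t ht => ?_)
    (fun t _ s _ => ((V (t - s)).le_opNorm _).trans (by gcongr; exact hM _))
    (fun s _ => (hV (p s)).comp (by fun_prop))
  exact (continuous_uncurry_clm hM hV).comp_aestronglyMeasurable
    ((by fun_prop : Continuous fun s : ℝ => t - s).aestronglyMeasurable.prodMk
      (hp.1.mono_measure (Measure.restrict_mono_set _ (Ioc_subset_Ioc_right ht.2))))

/-- Convolution of an integrably singular operator family with a continuous function. -/
theorem continuousOn_singular_convolution {T : ℝ} {V : ℝ → E →L[ℝ] E} {a : ℝ → ℝ}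
    (hV : ContinuousOn V (Ioi 0)) (ha : IntegrableOn a (Ioc 0 T))
    (hVa : ∀ τ ∈ Ioc 0 T, ‖V τ‖ ≤ a τ) {p : ℝ → E} (hp : ContinuousOn p (Icc 0 T)) :
    ContinuousOn (fun t => ∫ s in (0 : ℝ)..t, V (t - s) (p s)) (Icc 0 T) ∧
      ∀ t ∈ Icc 0 T, IntervalIntegrable (fun s => V (t - s) (p s)) volume 0 t := by
  rcases lt_or_ge T 0 with hT | hT
  · simp [Icc_eq_empty (not_le.2 hT)]
  -- A continuous bounded extension to ℝ, so that p'(t - τ) is continuous in t even when t - τ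
  -- leaves the interval.
  set p' := IccExtend hT ((Icc 0 T).domRestrict p) with hp'
  have hpc : Continuous p' := (continuousOn_iff_continuous_domRestrict.1 hp).Icc_extend'
  have hpe : ∀ s ∈ Icc 0 T, p' s = p s := fun s hs => by
    rw [hp', IccExtend_of_mem _ _ hs]; rfl
  obtain ⟨B, hB⟩ := isCompact_Icc.exists_bound_of_continuousOn hp
  have hB' : ∀ s, ‖p' s‖ ≤ B := fun s => by
    rw [hp', IccExtend, Function.comp_apply]
    exact hB _ (projIcc 0 T hT s).2
  -- After substituting τ = t - s the singular factor V(τ) no longer depends on t, and its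
  -- integrable bound serves as the majorant.
  obtain ⟨h1, h2⟩ := continuousOn_integral_of_dominated (T := T)
    (h := fun t τ => V τ (p' (t - τ))) (b := fun τ => a τ * B) (ha.mul_const B)
    (fun t ht => by
      refine ContinuousOn.aestronglyMeasurable ?_ measurableSet_Ioc
      exact (hV.mono fun s hs => hs.1).clm_apply (hpc.comp (by fun_prop)).continuousOn)
    (fun t ht τ hτ => ((V τ).le_opNorm _).trans
      (mul_le_mul (hVa τ ⟨hτ.1, hτ.2.trans ht.2⟩) (hB' _) (norm_nonneg _)
        ((norm_nonneg _).trans (hVa τ ⟨hτ.1, hτ.2.trans ht.2⟩))))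
    (fun τ _ => (V τ).continuous.comp (hpc.comp (by fun_prop)))
  have e : ∀ t ∈ Icc 0 T, EqOn (fun s => V (t - s) (p' s)) (fun s => V (t - s) (p s))
      (uIcc 0 t) := fun t ht s hs => by
    rw [uIcc_of_le ht.1] at hs
    simp only [hpe s ⟨hs.1, hs.2.trans ht.2⟩]
  refine ⟨h1.congr fun t ht => ?_, fun t ht => ?_⟩
  · simp only
    rw [← intervalIntegral.integral_congr (e t ht)]
    have := intervalIntegral.integral_comp_sub_left (a := 0) (b := t)
      (fun τ => V τ (p' (t - τ))) t
    simpa using this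
  · refine IntervalIntegrable.congr (fun s hs => e t ht (uIoc_subset_uIcc hs)) ?_
    have := (h2 t ht).comp_sub_left t
    simpa using this.symm

/-- A Cauchy–Schwarz estimate for vector-valued integrals. -/
theorem norm_integral_sq_le {t : ℝ} (ht : 0 ≤ t) {w : ℝ → E} {a b : ℝ → ℝ}
    (ha : IntervalIntegrable (fun s => a s ^ 2) volume 0 t) (hb : IntervalIntegrable b volume 0 t)
    (hb0 : ∀ s ∈ Ioo 0 t, 0 ≤ b s) (h : ∀ s ∈ Ioo 0 t, ‖w s‖ ^ 2 ≤ a s ^ 2 * b s) :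
    ‖∫ s in (0 : ℝ)..t, w s‖ ^ 2 ≤ (∫ s in (0 : ℝ)..t, a s ^ 2) * ∫ s in (0 : ℝ)..t, b s := by
  have hmem : ∀ᵐ s ∂volume, s ∈ Ioc 0 t → s ∈ Ioo 0 t := by
    have hne : ∀ᵐ s : ℝ, s ≠ t := by simp [ae_iff]
    exact hne.mono fun s hs hst => ⟨hst.1, lt_of_le_of_ne hst.2 hs⟩
  set A := ∫ s in (0 : ℝ)..t, a s ^ 2
  set B := ∫ s in (0 : ℝ)..t, b s
  set N := ‖∫ s in (0 : ℝ)..t, w s‖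
  have hA : 0 ≤ A := intervalIntegral.integral_nonneg ht fun s _ => sq_nonneg _
  have hB : 0 ≤ B := by
    refine intervalIntegral.integral_nonneg_of_ae_restrict ht ?_
    rw [EventuallyLE, ← restrict_Ioc_eq_restrict_Icc, ae_restrict_iff' measurableSet_Ioc]
    exact hmem.mono fun s hs hst => hb0 s (hs hst)
  have hN : 0 ≤ N := norm_nonneg _
  -- The pointwise bound ‖w‖ ≤ |a| √b is linearized by AM–GM with parameter x. Integrating gives a
  -- quadratic inequality in x, whose discriminant is the claimed estimate.
  have key : ∀ x : ℝ, 0 < x → 2 * N * x ≤ A * (x * x) + B := by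
    intro x hx
    have h1 : N ≤ ∫ s in (0 : ℝ)..t, (x / 2 * a s ^ 2 + (2 * x)⁻¹ * b s) := by
      refine intervalIntegral.norm_integral_le_of_norm_le ht
        (hmem.mono fun s hs hst => ?_) ((ha.const_mul _).add (hb.const_mul _))
      have h2 := h s (hs hst)
      have h3 := hb0 s (hs hst)
      have h4 : 0 ≤ x / 2 * a s ^ 2 + (2 * x)⁻¹ * b s := by positivity
      refine abs_le_of_sq_le_sq' (h2.trans ?_) h4 |>.2
      have h5 : (x / 2 * a s ^ 2 + (2 * x)⁻¹ * b s) ^ 2 - a s ^ 2 * b s =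
          (x / 2 * a s ^ 2 - (2 * x)⁻¹ * b s) ^ 2 := by
        field_simp
        ring
      nlinarith [sq_nonneg (x / 2 * a s ^ 2 - (2 * x)⁻¹ * b s)]
    rw [intervalIntegral.integral_add (ha.const_mul _) (hb.const_mul _),
      intervalIntegral.integral_const_mul, intervalIntegral.integral_const_mul] at h1
    have h6 := mul_le_mul_of_nonneg_right h1 (by positivity : 0 ≤ 2 * x)
    have h7 : (x / 2 * A + (2 * x)⁻¹ * B) * (2 * x) = A * (x * x) + B := by
      field_simp
    calc 2 * N * x = N * (2 * x) := by ring
      _ ≤ _ := h6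
      _ = _ := h7
  have h8 : discrim A (-(2 * N)) B ≤ 0 := by
    refine discrim_le_zero fun x => ?_
    rcases lt_or_ge 0 x with hx | hx
    · linarith [key x hx]
    · have : 0 ≤ A * (x * x) := by nlinarith [mul_self_nonneg x]
      nlinarith
  rw [discrim] at h8
  nlinarith

end Convolution

end

end NeutralSFDE

end

/-! ### Assembly of the proof -/

open NeutralSFDE in
theorem theorem3p1
    {Ω : Type*} [MeasurableSpace Ω] (P : Measure Ω) [IsProbabilityMeasure P]
    {X : Type*} [NormedAddCommGroup X] [InnerProductSpace ℝ X] [CompleteSpace X]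
    [TopologicalSpace.SeparableSpace X]
    {Y : Type*} [NormedAddCommGroup Y] [InnerProductSpace ℝ Y] [CompleteSpace Y]
    [TopologicalSpace.SeparableSpace Y]
    {ι : Type*} (H T r : ℝ) (hH : 1 / 2 < H) (hH' : H < 1) (hT : 0 < T) (hr : 0 ≤ r)
    (W : QFBM P H T ι Y)
    (A : X →ₗ.[ℝ] X) (S : ℝ → X →L[ℝ] X)
    (hS : IsAnalyticSemigroup S) (hA : IsGenerator A S)
    (hbdd : ∃ M : ℝ, ∀ t : ℝ, 0 ≤ t → ‖S t‖ ≤ M) (h0 : (0 : ℝ) ∈ resolventSet A)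
    (f g : ℝ → X → X) (σ : ℝ → Y →L[ℝ] X) (ρ : ℝ → ℝ) (φ : ℝ → Lp X 2 P)
    (hf : ∀ x, AEStronglyMeasurable (fun t => f t x) (volume.restrict (Icc 0 T)))
    (h1 : ∃ K, GrowthCondition T f K) (h1' : W.SquareIntegrable σ)
    (h2 : ∃ G, OsgoodCondition T f G)
    (h3 : ∃ β l Mg : ℝ, NeutralCondition T A g β l Mg)
    (h4 : DelayCondition r T ρ)
    (hφ : ContinuousOn φ (Icc (-r) 0)) :
    ∃ x : ℝ → Lp X 2 P, IsMildSolution W r A S f g σ ρ φ x ∧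
      ∀ y : ℝ → Lp X 2 P, IsMildSolution W r A S f g σ ρ φ y → EqOn y x (Icc (-r) T) := by
  obtain ⟨M, hM⟩ := hbdd
  obtain ⟨K, hK⟩ := h1
  obtain ⟨G, hG⟩ := h2
  obtain ⟨β, l, Mg, hN⟩ := h3
  have hβ0 : 0 < β := by linarith [hN.half_lt]
  obtain ⟨hinv, Θ, hΘc, hΘ, hΘb⟩ := exists_generator_mul_negFracPow hS hA ⟨M, hM⟩ h0 hβ0 hN.lt_one
  obtain ⟨C, hC0, hΘC⟩ := hΘb T
  obtain ⟨J, hJ, hJu, hJc, hJ0⟩ := QFBM.exists_stochasticConvolution hH h1' hS.1 hM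
  have hM0 : 0 ≤ M := (norm_nonneg _).trans (hM 0 le_rfl)
  -- the operators lifted to `L²(Ω; X)`
  set B := negFracPow A β with hB
  set 𝔤 : ℝ → X → X := fun s v => pval (fracPow A β) (g s v) with h𝔤
  set V : ℝ → Lp X 2 P →L[ℝ] Lp X 2 P := fun τ => (S |τ|).compLpL 2 P with hV
  set Θ' : ℝ → Lp X 2 P →L[ℝ] Lp X 2 P := fun τ => (Θ τ).compLpL 2 P with hΘ'
  have hVM : ∀ τ, ‖V τ‖ ≤ M := fun τ =>
    (ContinuousLinearMap.norm_compLpL_le _).trans (hM _ (abs_nonneg τ))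
  have hVc : ∀ u, Continuous fun τ => V τ u := fun u =>
    continuous_compLpL_apply (V := fun τ => S |τ|) (fun τ => hM _ (abs_nonneg τ))
      (fun x => hS.1.continuous_abs hM x) u
  have hΘ'c : ContinuousOn Θ' (Ioi 0) := continuousOn_compLpL hΘc
  have hΘ'C : ∀ τ ∈ Ioc 0 T, ‖Θ' τ‖ ≤ C * τ ^ (β - 1) := fun τ hτ =>
    (ContinuousLinearMap.norm_compLpL_le _).trans (hΘC τ hτ)
  -- The factorization through the fractional power moves every unbounded operator onto B or Θ,
  -- leaving the continuous, Lipschitz map 𝔤.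
  have hg𝔤 : ∀ s ∈ Icc 0 T, g s = fun v => B (𝔤 s v) := fun s hs =>
    funext fun v => (hinv _ (hN.mem_domain s hs v)).symm
  -- superposition operators
  have hfG0 : ∀ s ∈ Icc 0 T, Continuous (f s) := fun s hs =>
    continuous_of_modulus hG.modulus hs (hG.zero s hs) (hG.bound s hs)
  have hfK : ∀ s ∈ Icc 0 T, ∀ v, ‖f s v‖ ^ 2 ≤ K s 1 * (‖v‖ ^ 2 + 1) := fun s hs v => by
    refine (hK.bound s hs v).trans ((hK.modulus.le_linear hs (sq_nonneg _)).trans_eq ?_)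
    ring
  have hLf : ∀ s ∈ Icc 0 T, ∀ u : Lp X 2 P, MemLp (fun ω => f s (u ω)) 2 P := fun s hs u =>
    memLp_comp_of_growth (hfG0 s hs) (hfK s hs) u
  have hLg : ∀ s ∈ Icc 0 T, ∀ u : Lp X 2 P, MemLp (fun ω => 𝔤 s (u ω)) 2 P := fun s hs u => by
    refine memLp_comp_of_growth ?_ (hN.growth s hs) u
    have := hN.continuousOn.comp_continuous (f := fun v : X => (s, v)) (by fun_prop)
      (fun v => ⟨hs, mem_univ _⟩)
    exact this
  have hsg : ∀ s ∈ Icc 0 T, ∀ u : Lp X 2 P,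
      superpose (g s) u = B.compLpL 2 P (superpose (𝔤 s) u) := fun s hs u => by
    rw [hg𝔤 s hs]
    exact superpose_clm B (hLg s hs u)
  have hfun : ∀ τ, 0 < τ → ∀ s ∈ Icc 0 T, (fun v => pval A (S τ (g s v))) =
      fun v => Θ τ (𝔤 s v) := fun τ hτ s hs => by
    funext v
    rw [hg𝔤 s hs]
    exact hΘ τ hτ _
  have hsA : ∀ t ∈ Icc 0 T, ∀ s ∈ Ico 0 t, ∀ u : Lp X 2 P,
      superpose (fun v => pval A (S (t - s) (g s v))) u = Θ' (t - s) (superpose (𝔤 s) u) := by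
    intro t ht s hs u
    have hsT : s ∈ Icc 0 T := ⟨hs.1, hs.2.le.trans ht.2⟩
    rw [hfun _ (sub_pos.2 hs.2) s hsT]
    exact superpose_clm (Θ (t - s)) (hLg s hsT u)
  have hsf : ∀ t ∈ Icc 0 T, ∀ s ∈ Icc 0 t, ∀ u : Lp X 2 P,
      superpose (fun v => S (t - s) (f s v)) u = V (t - s) (superpose (f s) u) := by
    intro t ht s hs u
    simp only [hV, abs_of_nonneg (sub_nonneg.2 hs.2)]
    exact superpose_clm (S (t - s)) (hLf s ⟨hs.1, hs.2.trans ht.2⟩ u)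
  have hρ : ∀ s ∈ Icc 0 T, ρ s ∈ Icc (-r) s := fun s hs => ⟨h4.lower s hs, h4.upper s hs⟩
  have h0T : (0 : ℝ) ∈ Icc 0 T := ⟨le_rfl, hT.le⟩
  have hdelay : ∀ x : ℝ → Lp X 2 P, ContinuousOn x (Icc (-r) T) →
      ContinuousOn (fun s => x (ρ s)) (Icc 0 T) := fun x hx =>
    hx.comp h4.continuousOn fun s hs => ⟨(hρ s hs).1, (hρ s hs).2.trans hs.2⟩
  have hpg : ∀ x : ℝ → Lp X 2 P, ContinuousOn x (Icc (-r) T) →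
      ContinuousOn (fun s => superpose (𝔤 s) (x (ρ s))) (Icc 0 T) := fun x hx =>
    continuousOn_superpose hN.continuousOn hN.growth hN.lipschitz hLg (hdelay x hx)
  have hpf : ∀ x : ℝ → Lp X 2 P, ContinuousOn x (Icc (-r) T) →
      IntegrableOn (fun s => superpose (f s) (x (ρ s))) (Icc 0 T) := by
    intro x hx
    have hcf : ∀ s ∈ Icc 0 T, Continuous fun u : Lp X 2 P => superpose (f s) u := fun s hs =>
      continuous_superpose_of_modulus hG.modulus hs (hG.zero s hs) (hG.bound s hs) (hLf s hs)
    have hae := ae_restrict_mem (μ := volume) (measurableSet_Icc (a := (0 : ℝ)) (b := T))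
    have hmeas : AEStronglyMeasurable (fun s => superpose (f s) (x (ρ s)))
        (volume.restrict (Icc 0 T)) :=
      aestronglyMeasurable_caratheodory (F := fun s u => superpose (f s) u)
        (fun u => aestronglyMeasurable_superpose hf (hae.mono hcf) (hae.mono hLf) u)
        (hae.mono hcf) ((hdelay x hx).aestronglyMeasurable measurableSet_Icc)
    obtain ⟨R, hR⟩ := isCompact_Icc.exists_bound_of_continuousOn (hdelay x hx)
    -- The growth bound controls the square of the norm; ‖p‖ ≤ 1 + ‖p‖² turns it into an integrable
    -- majorant with coefficient K(s, 1).
    refine Integrable.mono' ((continuous_const.integrableOn_Icc (f := fun _ => (1 : ℝ))).add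
      ((hK.modulus.integrable 1 zero_le_one).mul_const (R ^ 2 + 1))) hmeas (hae.mono fun s hs => ?_)
    have h5 := norm_sq_superpose_le (hfK s hs) (hLf s hs (x (ρ s)))
    have h6 : ‖x (ρ s)‖ ^ 2 ≤ R ^ 2 := pow_le_pow_left₀ (norm_nonneg _) (hR s hs) 2
    have h7 := mul_le_mul_of_nonneg_left (add_le_add_left h6 1)
      (hK.modulus.nonneg s hs 1 zero_le_one)
    change _ ≤ 1 + K s 1 * (R ^ 2 + 1)
    nlinarith [sq_nonneg (‖superpose (f s) (x (ρ s))‖ - 1)]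
  -- integrability of the singular kernel
  have hker : ∀ t, 0 ≤ t → IntervalIntegrable (fun τ => (C * τ ^ (β - 1)) ^ 2) volume 0 t := by
    intro t ht
    -- The exponent 2(β - 1) exceeds -1 exactly because β > 1/2.
    have h5 : IntervalIntegrable (fun τ : ℝ => C ^ 2 * τ ^ ((β - 1) * (2 : ℕ))) volume 0 t :=
      (intervalIntegral.intervalIntegrable_rpow' (by push_cast; linarith [hN.half_lt])).const_mul _
    refine h5.congr fun τ hτ => ?_
    rw [uIoc_of_le ht] at hτ
    rw [mul_pow, Real.rpow_mul_natCast hτ.1.le]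
  have hker1 : IntegrableOn (fun τ => C * τ ^ (β - 1)) (Ioc 0 T) :=
    ((intervalIntegrable_iff_integrableOn_Ioc_of_le hT.le).1
      (intervalIntegral.intervalIntegrable_rpow' (by linarith))).const_mul C
  -- the fixed point map
  set I₁ : (ℝ → Lp X 2 P) → ℝ → Lp X 2 P := fun x t =>
    ∫ s in (0 : ℝ)..t, Θ' (t - s) (superpose (𝔤 s) (x (ρ s))) with hI₁
  set I₂ : (ℝ → Lp X 2 P) → ℝ → Lp X 2 P := fun x t =>
    ∫ s in (0 : ℝ)..t, V (t - s) (superpose (f s) (x (ρ s))) with hI₂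
  have hI₁c : ∀ x : ℝ → Lp X 2 P, ContinuousOn x (Icc (-r) T) → ContinuousOn (I₁ x) (Icc 0 T) ∧
      ∀ t ∈ Icc 0 T, IntervalIntegrable
        (fun s => Θ' (t - s) (superpose (𝔤 s) (x (ρ s)))) volume 0 t := fun x hx =>
    continuousOn_singular_convolution hΘ'c hker1 hΘ'C (hpg x hx)
  have hI₂c : ∀ x : ℝ → Lp X 2 P, ContinuousOn x (Icc (-r) T) → ContinuousOn (I₂ x) (Icc 0 T) ∧
      ∀ t ∈ Icc 0 T, IntervalIntegrable
        (fun s => V (t - s) (superpose (f s) (x (ρ s)))) volume 0 t := fun x hx =>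
    continuousOn_convolution hVM hVc ((hpf x hx).mono_set Ioc_subset_Icc_self)
  set Λ : (ℝ → Lp X 2 P) → ℝ → Lp X 2 P := fun x t =>
    V t (φ 0 + superpose (g 0) (φ (ρ 0))) - B.compLpL 2 P (superpose (𝔤 t) (x (ρ t))) - I₁ x t +
      I₂ x t + J t with hΛ
  have hΛ1 : ∀ x, IsAdmissible r T φ x → ContinuousOn (Λ x) (Icc 0 T) ∧ Λ x 0 = φ 0 := by
    intro x hx
    refine ⟨((((hVc _).continuousOn.sub ((B.compLpL 2 P).continuous.comp_continuousOn
      (hpg x hx.1))).sub (hI₁c x hx.1).1).add (hI₂c x hx.1).1).add hJc, ?_⟩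
    have h5 : V 0 = 1 := by
      ext1 u
      refine Lp.ext ?_
      filter_upwards [(S |0|).coeFn_compLpL (p := 2) u] with ω h6
      simp only [hV, h6]
      simp [hS.1.zero]
    have h6 : x (ρ 0) = φ (ρ 0) := hx.2 _ (hρ 0 h0T)
    simp only [hΛ, hI₁, hI₂, intervalIntegral.integral_same, hJ0, h5, h6, ← hsg 0 h0T]
    simp
  set κ := ∫ τ in (0 : ℝ)..T, (C * τ ^ (β - 1)) ^ 2 with hκ
  have hκ0 : 0 ≤ κ := intervalIntegral.integral_nonneg hT.le fun _ _ => sq_nonneg _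
  -- One constant serving both integral terms: the first summand comes from the singular
  -- convolution, the second from the drift f.
  set c := 3 * (κ * Mg ^ 2) + 3 * (M ^ 2 * T) with hc
  have hc0 : 0 ≤ c := by positivity
  have hΛ2 : ∀ x y, IsAdmissible r T φ x → IsAdmissible r T φ y → ∀ z : ℝ → ℝ,
      MonotoneOn z (Icc 0 T) → (∀ s ∈ Icc 0 T, 0 ≤ z s) →
      (∀ s ∈ Icc 0 T, ∀ τ ∈ Icc (-r) s, ‖x τ - y τ‖ ^ 2 ≤ z s) →
      ∀ t ∈ Icc 0 T, ‖Λ x t - Λ y t‖ ^ 2 ≤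
        osgoodMajorant (3 * ‖B‖ ^ 2 * Mg ^ 2) c G z t := by
    intro x y hx hy z hzm hz0 hz t ht
    have hsub : Icc 0 t ⊆ Icc 0 T := Icc_subset_Icc_right ht.2
    have hz' : ∀ s ∈ Icc 0 T, ‖x (ρ s) - y (ρ s)‖ ^ 2 ≤ z s := fun s hs => hz s hs _ (hρ s hs)
    have hgz : ∀ s ∈ Icc 0 T,
        ‖superpose (𝔤 s) (x (ρ s)) - superpose (𝔤 s) (y (ρ s))‖ ^ 2 ≤ Mg ^ 2 * z s := by
      intro s hs
      have h5 := norm_superpose_sub_le (hN.lipschitz s hs) (hLg s hs (x (ρ s))) (hLg s hs (y (ρ s)))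
      calc _ ≤ (Mg * ‖x (ρ s) - y (ρ s)‖) ^ 2 := pow_le_pow_left₀ (norm_nonneg _) h5 2
        _ = Mg ^ 2 * ‖x (ρ s) - y (ρ s)‖ ^ 2 := mul_pow _ _ _
        _ ≤ _ := by gcongr; exact hz' s hs
    have hzi : IntervalIntegrable z volume 0 t :=
      (intervalIntegrable_iff_integrableOn_Icc_of_le ht.1).2
        ((hzm.integrableOn_isCompact isCompact_Icc).mono_set hsub)
    have hGi : IntervalIntegrable (fun s => G s (z s)) volume 0 t :=
      (intervalIntegrable_iff_integrableOn_Icc_of_le ht.1).2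
        ((hG.modulus.integrableOn_comp_monotoneOn hT.le hzm hz0).mono_set hsub)
    have hz00 : 0 ≤ ∫ s in (0 : ℝ)..t, z s :=
      intervalIntegral.integral_nonneg ht.1 fun s hs => hz0 s (hsub hs)
    have hGz0 : 0 ≤ ∫ s in (0 : ℝ)..t, G s (z s) :=
      intervalIntegral.integral_nonneg ht.1 fun s hs =>
        hG.modulus.nonneg s (hsub hs) _ (hz0 s (hsub hs))
    have e1 : ‖B.compLpL 2 P (superpose (𝔤 t) (y (ρ t))) -
        B.compLpL 2 P (superpose (𝔤 t) (x (ρ t)))‖ ^ 2 ≤ ‖B‖ ^ 2 * (Mg ^ 2 * z t) := by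
      rw [← map_sub]
      have h5 : ‖B.compLpL 2 P (superpose (𝔤 t) (y (ρ t)) - superpose (𝔤 t) (x (ρ t)))‖ ≤
          ‖B‖ * ‖superpose (𝔤 t) (x (ρ t)) - superpose (𝔤 t) (y (ρ t))‖ := by
        rw [norm_sub_rev (superpose (𝔤 t) (x (ρ t)))]
        exact (B.compLpL 2 P).le_of_opNorm_le (ContinuousLinearMap.norm_compLpL_le B) _
      refine (pow_le_pow_left₀ (norm_nonneg _) h5 2).trans ?_
      rw [mul_pow]
      gcongr
      exact hgz t ht
    -- Cauchy–Schwarz separates the square of the singular kernel, whose integral is at most κ, from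
    -- the Lipschitz bound Mg² z.
    have e2 : ‖I₁ x t - I₁ y t‖ ^ 2 ≤ κ * (Mg ^ 2 * ∫ s in (0 : ℝ)..t, z s) := by
      simp only [hI₁]
      rw [← intervalIntegral.integral_sub ((hI₁c x hx.1).2 t ht) ((hI₁c y hy.1).2 t ht),
        ← intervalIntegral.integral_const_mul]
      have h5 : IntervalIntegrable (fun s => (C * (t - s) ^ (β - 1)) ^ 2) volume 0 t := by
        have := (hker t ht.1).comp_sub_left t
        simpa using this.symm
      have h6 : ∫ s in (0 : ℝ)..t, (C * (t - s) ^ (β - 1)) ^ 2 ≤ κ := by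
        have h7 := intervalIntegral.integral_comp_sub_left (a := 0) (b := t)
          (fun τ => (C * τ ^ (β - 1)) ^ 2) t
        simp only [sub_self, sub_zero] at h7
        rw [h7]
        exact intervalIntegral.integral_mono_interval le_rfl ht.1 ht.2
          (Eventually.of_forall fun _ => sq_nonneg _) (hker T hT.le)
      refine (norm_integral_sq_le ht.1 h5 (hzi.const_mul (Mg ^ 2))
        (fun s hs => mul_nonneg (sq_nonneg _) (hz0 s (hsub (Ioo_subset_Icc_self hs))))
        (fun s hs => ?_)).trans (mul_le_mul_of_nonneg_right h6 ?_)
      · rw [← map_sub]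
        have h8 := (Θ' (t - s)).le_of_opNorm_le
          (hΘ'C (t - s) ⟨sub_pos.2 hs.2, by linarith [hs.1, ht.2]⟩)
          (superpose (𝔤 s) (x (ρ s)) - superpose (𝔤 s) (y (ρ s)))
        refine (pow_le_pow_left₀ (norm_nonneg _) h8 2).trans ?_
        rw [mul_pow]
        gcongr
        exact hgz s (hsub (Ioo_subset_Icc_self hs))
      · rw [intervalIntegral.integral_const_mul]
        positivity
    have e3 : ‖I₂ x t - I₂ y t‖ ^ 2 ≤ M ^ 2 * T * ∫ s in (0 : ℝ)..t, G s (z s) := by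
      simp only [hI₂]
      rw [← intervalIntegral.integral_sub ((hI₂c x hx.1).2 t ht) ((hI₂c y hy.1).2 t ht)]
      have h6 : ∫ _ in (0 : ℝ)..t, M ^ 2 ≤ M ^ 2 * T := by
        rw [intervalIntegral.integral_const, smul_eq_mul, sub_zero, mul_comm]
        gcongr
        exact ht.2
      refine (norm_integral_sq_le ht.1 (a := fun _ => M) intervalIntegrable_const hGi
        (fun s hs => hG.modulus.nonneg s (hsub (Ioo_subset_Icc_self hs)) _
          (hz0 s (hsub (Ioo_subset_Icc_self hs)))) (fun s hs => ?_)).trans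
        (mul_le_mul_of_nonneg_right h6 hGz0)
      have hsT := hsub (Ioo_subset_Icc_self hs)
      rw [← map_sub]
      have h8 := (V (t - s)).le_of_opNorm_le (hVM (t - s))
        (superpose (f s) (x (ρ s)) - superpose (f s) (y (ρ s)))
      refine (pow_le_pow_left₀ (norm_nonneg _) h8 2).trans ?_
      rw [mul_pow]
      gcongr
      exact (norm_sq_superpose_sub_le hG.modulus hsT (hG.bound s hsT) (hLf s hsT _)
        (hLf s hsT _)).trans (hG.modulus.monotoneOn s hsT (mem_Ici.2 (sq_nonneg _)) (hz0 s hsT) (hz' s hsT))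
    have e4 : Λ x t - Λ y t = (B.compLpL 2 P (superpose (𝔤 t) (y (ρ t))) -
        B.compLpL 2 P (superpose (𝔤 t) (x (ρ t)))) - (I₁ x t - I₁ y t) + (I₂ x t - I₂ y t) := by
      simp only [hΛ]
      abel
    have e5 : ‖Λ x t - Λ y t‖ ≤ ‖B.compLpL 2 P (superpose (𝔤 t) (y (ρ t))) -
        B.compLpL 2 P (superpose (𝔤 t) (x (ρ t)))‖ + ‖I₁ x t - I₁ y t‖ + ‖I₂ x t - I₂ y t‖ := by
      rw [e4]
      exact (norm_add_le _ _).trans (add_le_add_left (norm_sub_le _ _) _)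
    -- Three differences survive, hence the factor 3, which matches the smallness condition 3‖B‖²Mg²
    -- < 1.
    have e6 : ∀ a b d : ℝ, (a + b + d) ^ 2 ≤ 3 * (a ^ 2 + b ^ 2 + d ^ 2) := fun a b d => by
      nlinarith [sq_nonneg (a - b), sq_nonneg (b - d), sq_nonneg (a - d)]
    have e7 := (pow_le_pow_left₀ (norm_nonneg _) e5 2).trans (e6 _ _ _)
    have e8 : 0 ≤ M ^ 2 * T * ∫ s in (0 : ℝ)..t, z s := by positivity
    have e9 : 0 ≤ κ * Mg ^ 2 * ∫ s in (0 : ℝ)..t, G s (z s) := by positivity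
    unfold osgoodMajorant
    rw [hc]
    linarith
  obtain ⟨x, hx, hxΛ, hxu⟩ := exists_unique_fixedPoint_of_osgood hr hT.le (by positivity)
    hN.small_lipschitz hc0 hG.modulus hG.zero hG.unique hφ Λ hΛ1 hΛ2
  -- the integrands of the mild formulation
  have hae1 : ∀ x : ℝ → Lp X 2 P, ∀ t ∈ Icc 0 T,
      (fun s => superpose (fun v => pval A (S (t - s) (g s v))) (x (ρ s)))
        =ᵐ[volume.restrict (uIoc 0 t)] fun s => Θ' (t - s) (superpose (𝔤 s) (x (ρ s))) := by
    intro x t ht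
    have hne : ∀ᵐ s ∂(volume.restrict (uIoc 0 t)), s ≠ t := ae_restrict_of_ae (by simp [ae_iff])
    filter_upwards [hne, ae_restrict_mem measurableSet_uIoc] with s h5 h6
    rw [uIoc_of_le ht.1] at h6
    exact hsA t ht s ⟨h6.1.le, lt_of_le_of_ne h6.2 h5⟩ _
  have hae2 : ∀ x : ℝ → Lp X 2 P, ∀ t ∈ Icc 0 T,
      (fun s => superpose (fun v => S (t - s) (f s v)) (x (ρ s)))
        =ᵐ[volume.restrict (uIoc 0 t)] fun s => V (t - s) (superpose (f s) (x (ρ s))) := by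
    intro x t ht
    filter_upwards [ae_restrict_mem measurableSet_uIoc] with s h6
    rw [uIoc_of_le ht.1] at h6
    exact hsf t ht s ⟨h6.1.le, h6.2⟩ _
  have hrhs : ∀ x : ℝ → Lp X 2 P, ∀ t ∈ Icc 0 T,
      (S t).compLp (φ 0 + superpose (g 0) (φ (ρ 0))) - superpose (g t) (x (ρ t))
      - (∫ s in (0 : ℝ)..t, superpose (fun v => pval A (S (t - s) (g s v))) (x (ρ s)))
      + (∫ s in (0 : ℝ)..t, superpose (fun v => S (t - s) (f s v)) (x (ρ s))) + J t = Λ x t := by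
    intro x t ht
    rw [intervalIntegral.integral_congr_ae_restrict (hae1 x t ht),
      intervalIntegral.integral_congr_ae_restrict (hae2 x t ht), hsg t ht]
    simp only [hΛ, hI₁, hI₂, hV, abs_of_nonneg ht.1]
    rfl
  refine ⟨x, ⟨hx.1, hx.2, fun t ht => ?_, fun t ht s hs => ?_, fun t ht => hLf t ht _,
    fun t ht => ?_, fun t ht => ?_, fun t ht => ⟨J t, hJ t ht, ?_⟩⟩, fun y hy => ?_⟩
  · rw [hg𝔤 t ht]
    exact B.comp_memLp' (hLg t ht _)
  · have hsT : s ∈ Icc 0 T := ⟨hs.1, hs.2.le.trans ht.2⟩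
    have h5 : (fun ω => pval A (S (t - s) (g s (x (ρ s) ω)))) =
        fun ω => Θ (t - s) (𝔤 s (x (ρ s) ω)) :=
      funext fun ω => congrFun (hfun _ (sub_pos.2 hs.2) s hsT) _
    rw [h5]
    exact (Θ (t - s)).comp_memLp' (hLg s hsT _)
  · exact ((hI₁c x hx.1).2 t ht).congr_ae (hae1 x t ht).symm
  · exact ((hI₂c x hx.1).2 t ht).congr_ae (hae2 x t ht).symm
  · rw [hrhs x t ht, hxΛ ht]
  -- A second solution comes with its own version J' of the stochastic convolution; uniqueness of
  -- that integral identifies it with J t and makes y a fixed point of the same Λ.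
  · refine hxu y ⟨hy.continuousOn, hy.initial⟩ fun t ht => ?_
    obtain ⟨J', hJ', h5⟩ := hy.equation t ht
    rw [h5, hJu t ht J' hJ', hrhs y t ht]
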